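/- Let $H$ be a separable real Hilbert space, and let $V\subset H$ be a dense subspace which is itself a separable Hilbert space with a norm $\|\cdot\|_V$ defining a stronger topology than that of $H$. Let $P$ be a skew-adjoint operator on $H$ with domain $V$ whose graph norm is equivalent to $\|\cdot\|_V$. Let $W$ be a real Hilbert space and $S:V\to W$ a continuous linear map. Write $\mathcal B(H)$ for the bounded linear operators on $H$ with the operator norm, $\mathcal B_{\rm symm}(H)$ for the self-adjoint ones, and $\mathbf R_+=[0,\infty)$. Let $\mathcal M$ be the space of triples $(A,B,Q)$ with $A\in\mathcal B_{\rm symm}(H)$, $B\in\mathcal B(H)$, and $Q\in L^1(\mathbf R,\mathcal B_{\rm symm}(H))\cap C^0(\mathbf R_+,\mathcal B(H))$ causal ($Q(t)=0$ for $t<0$), with finite norm $$\|(A,B,Q)\|_{\mathcal M}=\|A\|_{\mathcal B(H)}+\|B\|_{\mathcal B(H)}+\max\left(\|Q\|_{L^1(\mathbf R_+,\mathcal B(H))},\|Q\|_{L^\infty(\mathbf R_+,\mathcal B(H))}\right),$$ and let $\mathcal P\subset\mathcal M$ be the set of those triples for which there are constants $0<C_*\le C^*$ with $C_*I\le A\le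 C^*I$. A function on $\mathbf R$ is called causal if it vanishes (almost everywhere) on some half-line $(-\infty,T)$. Let $k\ge 2$ and let $f\in H^k_{\rm loc}(\mathbf R,H)$ be causal. For $(A,B,Q)\in\mathcal P$, a causal strong solution of $$A u'(t)+P u(t)+B u(t)+\int_{\mathbf R} Q(t-s)u(s)\,ds=f(t)$$ is a causal $u\in C^1(\mathbf R,H)\cap C^0(\mathbf R,V)$ which satisfies the equation ($f$ being identified with its continuous representative). Then $\mathcal M$ is a Banach space, $\mathcal P$ is open in $\mathcal M$, and for every $(A,B,Q)\in\mathcal P$ there is exactly one causal strong solution $u$, so that $\mathcal F_f[A,B,Q]=Su$ is well defined on $\mathcal P$. Moreover, for all real $T_0\le T_1$, the map $\mathcal F_f$ is of class $C^{k-1}$ (in the sense of Fréchet) from $\mathcal P\subset\mathcal M$ to $C^0([T_0,T_1],W)$ with the supremum norm. -/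

import Mathlib

open MeasureTheory Set Filter Topology
open scoped NNReal ENNReal ContDiff BoundedContinuousFunction InnerProductSpace

/-! ### Function classes on the time axis -/

section TimeFunctions

variable {E : Type*} [NormedAddCommGroup E]

/-- `g` is locally square integrable, `g ∈ L²_loc(ℝ, E)`. -/
def MemL2Loc (g : ℝ → E) : Prop :=
  ∀ a b : ℝ, MemLp g 2 (volume.restrict (Icc a b))

/-- `g ∈ L²₊(ℝ, E)`: `g` is square integrable on every half-line `(-∞, T]`. -/
def MemL2Plus (g : ℝ → E) : Prop :=
  ∀ T : ℝ, MemLp g 2 (volume.restrict (Iic T))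

/-- `g` is causal: it vanishes (almost everywhere) on some half-line `(-∞, T)`. -/
def IsCausal (g : ℝ → E) : Prop :=
  ∃ T : ℝ, ∀ᵐ t : ℝ, t < T → g t = 0

variable [NormedSpace ℝ E]

/-- `g'` is a weak (distributional) derivative of `g` on `ℝ`. -/
def IsWeakDeriv (g g' : ℝ → E) : Prop :=
  ∀ φ : ℝ → ℝ, ContDiff ℝ ∞ φ → HasCompactSupport φ →
    ∫ t, deriv φ t • g t = -∫ t, φ t • g' t

/-- `g ∈ H^k_loc(ℝ, E)`: `g` and its weak derivatives up to order `k` exist and belong to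
`L²_loc(ℝ, E)`. -/
def MemHLoc : ℕ → (ℝ → E) → Prop
  | 0, g => MemL2Loc g
  | k + 1, g => MemL2Loc g ∧ ∃ g' : ℝ → E, IsWeakDeriv g g' ∧ MemHLoc k g'

end TimeFunctions

/-! ### The coefficient space -/

section Coefficients

variable (H : Type*) [NormedAddCommGroup H] [InnerProductSpace ℝ H] [CompleteSpace H]

/-- The space of bounded self-adjoint operators on `H`. -/
def BSymm : Type _ := selfAdjoint.submodule ℝ (H →L[ℝ] H)

/-- The operator norm on the bounded self-adjoint operators. -/
noncomputable instance : NormedAddCommGroup (BSymm H) :=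
  Submodule.normedAddCommGroup (selfAdjoint.submodule ℝ (H →L[ℝ] H))

noncomputable instance : NormedSpace ℝ (BSymm H) :=
  Submodule.normedSpace (selfAdjoint.submodule ℝ (H →L[ℝ] H))

variable {H} in
/-- A bounded self-adjoint operator, seen as a bounded operator. -/
def BSymm.toCLM (A : BSymm H) : H →L[ℝ] H := Subtype.val A

variable {H} in
/-- Extension by zero to the whole line of an operator-valued function on `[0, ∞)`. -/
noncomputable def causalExt (g : ℝ≥0 → BSymm H) (t : ℝ) : BSymm H :=
  if 0 ≤ t then g t.toNNReal else 0

/-- The causal memory kernels `Q ∈ L¹(ℝ, B_symm(H)) ∩ C⁰([0, ∞), B(H))`, `Q(t) = 0` for `t < 0`,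
for which the norm `max (‖Q‖_{L¹}) (‖Q‖_{L^∞})` is finite. The intersection is realized as the
subspace of those pairs in `L¹ × C_b` whose two components are the same function; the norm
inherited from the product is the maximum of the `L¹` norm and the supremum norm. -/
noncomputable def MemoryKernel :
    Submodule ℝ (Lp (BSymm H) 1 (volume : Measure ℝ) × (ℝ≥0 →ᵇ BSymm H)) where
  carrier := {q | (q.1 : ℝ → BSymm H) =ᵐ[volume] causalExt q.2}
  add_mem' := by
    intro p q hp hq
    have h := Lp.coeFn_add p.1 q.1
    simp only [mem_ofPred_eq] at hp hq ⊢
    filter_upwards [h, hp, hq] with t h1 h2 h3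
    simp only [Prod.fst_add, Prod.snd_add, h1, Pi.add_apply, h2, h3, causalExt]
    split_ifs <;> simp
  zero_mem' := by
    have h := Lp.coeFn_zero (BSymm H) 1 (volume : Measure ℝ)
    simp only [mem_ofPred_eq]
    filter_upwards [h] with t _
    simp [causalExt]
  smul_mem' := by
    intro c q hq
    have h := Lp.coeFn_smul c q.1
    simp only [mem_ofPred_eq] at hq ⊢
    filter_upwards [h, hq] with t h1 h2
    simp only [Prod.smul_fst, Prod.smul_snd, h1, Pi.smul_apply, h2, causalExt]
    split_ifs <;> simp

/-- The coefficient space `M = B_symm(H) × B(H) × [L¹ ∩ C⁰]` of triples `(A, B, Q)`, with norm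
`‖A‖ + ‖B‖ + max (‖Q‖_{L¹}) (‖Q‖_{L^∞})`. -/
abbrev CoeffSpace : Type _ :=
  WithLp 1 (BSymm H × WithLp 1 ((H →L[ℝ] H) × MemoryKernel H))

variable {H}

namespace CoeffSpace

/-- The coefficient `A` of `u'`. -/
noncomputable def opA (m : CoeffSpace H) : H →L[ℝ] H := m.fst.toCLM

/-- The coefficient `B` of the zeroth order term. -/
noncomputable def opB (m : CoeffSpace H) : H →L[ℝ] H := m.snd.fst

/-- The memory kernel `Q`, as a function on the whole line. -/
noncomputable def kernel (m : CoeffSpace H) (t : ℝ) : H →L[ℝ] H :=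
  (causalExt m.snd.snd.1.2 t).toCLM

/-- The memory operator `R[v](t) = ∫ Q(t - s) v(s) ds`. -/
noncomputable def memory (m : CoeffSpace H) (v : ℝ → H) (t : ℝ) : H :=
  ∫ s, m.kernel (t - s) (v s)

end CoeffSpace

/-- The norm of the coefficient space, written out. -/
theorem CoeffSpace.norm_eq (m : CoeffSpace H) :
    ‖m‖ = ‖m.opA‖ + ‖m.opB‖ + max ‖m.snd.snd.1.1‖ ‖m.snd.snd.1.2‖ := by
  rw [WithLp.prod_norm_eq_of_L1, WithLp.prod_norm_eq_of_L1 m.snd, ← add_assoc]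
  rfl

/-- The triples `(A, B, Q)` with `c I ≤ A ≤ C I`, `‖B‖ ≤ b` and `‖Q‖_{L¹} + ‖Q‖_{L^∞} ≤ q`. -/
def admissibleWith (c C b q : ℝ) : Set (CoeffSpace H) :=
  {m | (∀ x : H, c * ‖x‖ ^ 2 ≤ ⟪m.opA x, x⟫_ℝ ∧ ⟪m.opA x, x⟫_ℝ ≤ C * ‖x‖ ^ 2) ∧
    ‖m.opB‖ ≤ b ∧ ‖m.snd.snd.1.1‖ + ‖m.snd.snd.1.2‖ ≤ q}

variable (H) in
/-- The set of admissible coefficient triples: the union of all the sets above over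
`0 < c ≤ C`, `0 ≤ b`, `0 ≤ q`. -/
def admissible : Set (CoeffSpace H) :=
  {m | ∃ c C b q : ℝ, 0 < c ∧ c ≤ C ∧ 0 ≤ b ∧ 0 ≤ q ∧ m ∈ admissibleWith c C b q}

end Coefficients

/-! ### The evolution problem -/

section Evolution

variable {H V : Type*} [NormedAddCommGroup H] [InnerProductSpace ℝ H] [CompleteSpace H]
  [NormedAddCommGroup V] [InnerProductSpace ℝ V]

/-- The unbounded operator on `H` with domain `V` (embedded in `H` through the injection `ι`) that
acts as `P : V → H`. -/
noncomputable def unboundedOp (ι : V →L[ℝ] H) (hι : Function.Injective ι) (P : V →ₗ[ℝ] H) :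
    H →ₗ.[ℝ] H where
  domain := LinearMap.range (ι : V →ₗ[ℝ] H)
  toFun := P ∘ₗ (LinearEquiv.ofInjective (ι : V →ₗ[ℝ] H) hι).symm.toLinearMap

/-- A densely defined operator `D` on `H` is skew-adjoint: `D* = -D`, domains included. -/
def IsSkewAdjointOp (D : H →ₗ.[ℝ] H) : Prop :=
  Dense (D.domain : Set H) ∧ D.adjoint = -D

/-- The graph norm of `P` is equivalent to the norm of its domain `V`. -/
def GraphNormEquiv (ι : V →L[ℝ] H) (P : V →ₗ[ℝ] H) : Prop :=
  ∃ c C : ℝ, 0 < c ∧ 0 < C ∧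
    ∀ v : V, c * ‖v‖ ≤ ‖ι v‖ + ‖P v‖ ∧ ‖ι v‖ + ‖P v‖ ≤ C * ‖v‖

/-- `u ∈ C¹(ℝ, H) ∩ C⁰(ℝ, V) ∩ L²₊(ℝ, H)` is a causal strong solution of
`A u' + P u + B u + R[u] = f`. Since `f` is determined only up to null sets, the equation is
required for almost every `t`; its left-hand side is continuous in `t`, so that it holds for every
`t` as soon as `f` is continuous. -/
structure IsCausalStrongSolution (ι : V →L[ℝ] H) (P : V →ₗ[ℝ] H) (f : ℝ → H)
    (m : CoeffSpace H) (u : ℝ → V) : Prop where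
  continuous : Continuous u
  contDiff : ContDiff ℝ 1 (fun t => ι (u t))
  memL2Plus : MemL2Plus (fun t => ι (u t))
  causal : IsCausal u
  equation : ∀ᵐ t : ℝ, m.opA (deriv (fun s => ι (u s)) t) + P (u t) + m.opB (ι (u t)) +
    m.memory (fun s => ι (u s)) t = f t

open Classical in
/-- The causal strong solution of the evolution problem (and `0` if there is none). -/
noncomputable def causalSolution (ι : V →L[ℝ] H) (P : V →ₗ[ℝ] H) (f : ℝ → H)
    (m : CoeffSpace H) : ℝ → V :=
  if h : ∃ u : ℝ → V, IsCausalStrongSolution ι P f m u then h.choose else 0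

/-- The forward map `F_f[A, B, Q] = S u`, where `u` is the causal strong solution. -/
noncomputable def forwardMap {W : Type*} [NormedAddCommGroup W] [InnerProductSpace ℝ W]
    (ι : V →L[ℝ] H) (P : V →ₗ[ℝ] H) (S : V →L[ℝ] W) (f : ℝ → H)
    (m : CoeffSpace H) (t : ℝ) : W :=
  S (causalSolution ι P f m t)

end Evolution

/-! Let a lie to the left of the support of f, and let J be the primitive vanishing at a. On [a, b]
the problem with right-hand side x ∈ L¹, integrated once, reads A w + (P + B + Q*) J w = J x. Write
T(m) : L¹ → C⁰ for the solution operator x ↦ w.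

Construction of T(m). With P replaced by its Yosida approximation P R_n, R_n = (1 + P/(n+1))⁻¹, the
integrated equation is a Volterra equation of the second kind, solvable by
`CausallyBounded.isUnit_one_add`. The energy ⟨A w, w⟩, in a norm with weight exp(-ν(t - a)) whose ν
is large enough to absorb B and Q, gives a bound from L¹ to C⁰ that is uniform in n and locally
uniform in m (`energy_estimate`). On the dense set of data J g, g continuous, the same estimate
shows that the approximations are Cauchy. Their strong limit is `solOp`, and it commutes with J.

Dependence on m. Subtracting two equations eliminates P and leaves the second resolvent identity J
T(m') - J T(m) = -T(m') L T(m), where L w = δA w + (δB + δQ*) J w and δ = m' - m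
(`CoerciveWith.solOp_sub`). Since δA multiplies a time derivative, one factor J is lost. So T is
only known to be locally bounded, J T is locally Lipschitz, and J² T has derivative -J T L T. As
this is again bilinear in T, a Leibniz rule "with loss" iterates the argument to all orders
(`LossyReg.of_resolvent_identity`). In operator norm j derivatives would cost j + 1 factors J.
Applied to a fixed x they cost only j, because x is a limit of elements J g_n and T(m) J = J T(m),
so evaluation at x is a norm limit of functionals that factor through J (`LossyReg.contDiffOn`).
Thus m ↦ J^j T(m) x is of class C^j.

The forward map. A causal f ∈ H^k_loc is J^k h with h locally integrable and causal. Put w = T(m) h;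
then u = J^k w and u' = J^(k-1) w. To measure u in V one reads P u off the equation and applies R_0
= (1 + P)⁻¹: u = R_0 (u + f - A u' - B u - Q*u). The derivative u' carries k - 1 factors J, whence
the class C^(k-1). Uniqueness is the energy estimate without source, and it also patches the
solutions on the intervals [a, b] into a global one. -/

set_option maxSynthPendingDepth 3
set_option linter.unusedSectionVars false

/-! ### Differentiation with loss of regularity -/

section LossyRegularity

universe u

variable {M : Type u} [NormedAddCommGroup M] [NormedSpace ℝ M] {U : Set M}

/-- `T` is bounded near every point of `U`. -/
def LocBddOn (U : Set M) {F : Type*} [Norm F] (T : M → F) : Prop :=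
  ∀ m ∈ U, ∃ C : ℝ, ∀ᶠ x in 𝓝 m, ‖T x‖ ≤ C

/-- `T` is locally bounded and differentiable `j` times at the cost of one factor of the smoothing
operator `J` per derivative and of one further factor. -/
def LossyReg (U : Set M) : ℕ → ∀ {F : Type u} [NormedAddCommGroup F] [NormedSpace ℝ F],
    (F →L[ℝ] F) → (M → F) → Prop
  | 0, _, _, _, J, T => LocBddOn U T ∧ ContinuousOn (fun m => J (T m)) U
  | j + 1, F, _, _, J, T => LocBddOn U T ∧ ContinuousOn (fun m => J (T m)) U ∧
      ∃ T' : M → (M →L[ℝ] F), LossyReg U j (ContinuousLinearMap.compL ℝ M F F J) T' ∧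
        ∀ m ∈ U, HasFDerivAt (fun x => J (J (T x))) (J ∘L T' m) m

variable {F F₁ F₂ : Type u} [NormedAddCommGroup F] [NormedSpace ℝ F]
  [NormedAddCommGroup F₁] [NormedSpace ℝ F₁] [NormedAddCommGroup F₂] [NormedSpace ℝ F₂]

theorem LossyReg.locBddOn {j : ℕ} {J : F →L[ℝ] F} {T : M → F} (h : LossyReg U j J T) :
    LocBddOn U T := by
  cases j with
  | zero => exact h.1
  | succ j => exact h.1

theorem LossyReg.of_succ (j : ℕ) : ∀ {F : Type u} [NormedAddCommGroup F] [NormedSpace ℝ F]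
    {J : F →L[ℝ] F} {T : M → F}, LossyReg U (j + 1) J T → LossyReg U j J T := by
  induction j with
  | zero => exact fun h => ⟨h.1, h.2.1⟩
  | succ j ih =>
    intro F _ _ J T h
    obtain ⟨h1, h2, T', h3, h4⟩ := h
    exact ⟨h1, h2, T', ih h3, h4⟩

theorem LocBddOn.add {T T' : M → F} (h : LocBddOn U T) (h' : LocBddOn U T') :
    LocBddOn U (fun m => T m + T' m) := by
  intro m hm
  obtain ⟨C, hC⟩ := h m hm
  obtain ⟨C', hC'⟩ := h' m hm
  refine ⟨C + C', ?_⟩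
  filter_upwards [hC, hC'] with x h1 h2 using (norm_add_le _ _).trans (add_le_add h1 h2)

theorem LossyReg.add (j : ℕ) : ∀ {F : Type u} [NormedAddCommGroup F] [NormedSpace ℝ F]
    {J : F →L[ℝ] F} {T T' : M → F}, LossyReg U j J T → LossyReg U j J T' →
      LossyReg U j J (fun m => T m + T' m) := by
  induction j with
  | zero =>
    intro F _ _ J T T' h h'
    refine ⟨h.1.add h'.1, ?_⟩
    simp only [map_add]
    exact h.2.add h'.2
  | succ j ih =>
    intro F _ _ J T T' h h'
    obtain ⟨h1, h2, D, h3, h4⟩ := h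
    obtain ⟨h1', h2', D', h3', h4'⟩ := h'
    refine ⟨h1.add h1', ?_, fun m => D m + D' m, ih h3 h3', fun m hm => ?_⟩
    · simp only [map_add]
      exact h2.add h2'
    · simp only [map_add, ContinuousLinearMap.comp_add]
      exact (h4 m hm).add (h4' m hm)

theorem LocBddOn.bilin {T : M → F₁} {T' : M → F₂} (b : F₁ →L[ℝ] F₂ →L[ℝ] F)
    (h : LocBddOn U T) (h' : LocBddOn U T') : LocBddOn U (fun m => b (T m) (T' m)) := by
  intro m hm
  obtain ⟨C, hC⟩ := h m hm
  obtain ⟨C', hC'⟩ := h' m hm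
  refine ⟨‖b‖ * C * C', ?_⟩
  filter_upwards [hC, hC'] with x h1 h2
  refine (b.le_opNorm₂ _ _).trans ?_
  have := (norm_nonneg _).trans h1
  gcongr

theorem isBigO_one_of_eventually_le {T : M → F} {m : M} {C : ℝ} (h : ∀ᶠ x in 𝓝 m, ‖T x‖ ≤ C) :
    T =O[𝓝 m] (fun _ => (1 : ℝ)) :=
  Asymptotics.IsBigO.of_bound C (by simpa using h)

theorem bilin_isLittleO {α : Type*} {l : Filter α} (b : F₁ →L[ℝ] F₂ →L[ℝ] F) {f : α → F₁}
    {g : α → F₂} {G : Type*} [NormedAddCommGroup G] {k : α → G}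
    (hf : f =o[l] k) (hg : g =O[l] (fun _ => (1 : ℝ))) : (fun x => b (f x) (g x)) =o[l] k := by
  have h : (fun x => b (f x) (g x)) =O[l] (fun x => ‖f x‖ * ‖g x‖) :=
    Asymptotics.IsBigO.of_bound ‖b‖ (Eventually.of_forall fun x => by
      simpa [mul_assoc] using b.le_opNorm₂ (f x) (g x))
  refine h.trans_isLittleO ?_
  simpa using (hf.norm_norm.mul_isBigO hg.norm_norm).norm_right

theorem bilin_isLittleO' {α : Type*} {l : Filter α} (b : F₁ →L[ℝ] F₂ →L[ℝ] F) {f : α → F₁}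
    {g : α → F₂} {G : Type*} [NormedAddCommGroup G] {k : α → G}
    (hf : f =O[l] k) (hg : g =o[l] (fun _ => (1 : ℝ))) : (fun x => b (f x) (g x)) =o[l] k := by
  have h : (fun x => b (f x) (g x)) =O[l] (fun x => ‖f x‖ * ‖g x‖) :=
    Asymptotics.IsBigO.of_bound ‖b‖ (Eventually.of_forall fun x => by
      simpa [mul_assoc] using b.le_opNorm₂ (f x) (g x))
  refine h.trans_isLittleO ?_
  simpa using (hf.norm_norm.mul_isLittleO hg.norm_norm).norm_right

/-- The increment is telescoped, and in each term the single J is moved onto the factor that varies.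
The other factor then only has to be bounded. -/
theorem LossyReg.continuousOn_bilin {J₁ : F₁ →L[ℝ] F₁} {J₂ : F₂ →L[ℝ] F₂} {J : F →L[ℝ] F}
    (b : F₁ →L[ℝ] F₂ →L[ℝ] F) (hb₁ : ∀ x y, b (J₁ x) y = J (b x y))
    (hb₂ : ∀ x y, b x (J₂ y) = J (b x y)) {T : M → F₁} {T' : M → F₂}
    (hT : LocBddOn U T) (hT' : LocBddOn U T') (hc : ContinuousOn (fun m => J₁ (T m)) U)
    (hc' : ContinuousOn (fun m => J₂ (T' m)) U) (hU : IsOpen U) :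
    ContinuousOn (fun m => J (b (T m) (T' m))) U := by
  intro m hm
  refine ContinuousAt.continuousWithinAt ?_
  have e : ∀ x, J (b (T x) (T' x)) = b (J₁ (T x) - J₁ (T m)) (T' x)
      + b (T m) (J₂ (T' x) - J₂ (T' m)) + J (b (T m) (T' m)) := by
    intro x
    simp only [map_sub, hb₁, hb₂, sub_apply]
    abel
  obtain ⟨C', hC'⟩ := hT' m hm
  have c1 : Tendsto (fun x => J₁ (T x) - J₁ (T m)) (𝓝 m) (𝓝 0) := by
    simpa using ((hc.continuousAt (hU.mem_nhds hm)).tendsto).sub_const (J₁ (T m))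
  have c2 : Tendsto (fun x => J₂ (T' x) - J₂ (T' m)) (𝓝 m) (𝓝 0) := by
    simpa using ((hc'.continuousAt (hU.mem_nhds hm)).tendsto).sub_const (J₂ (T' m))
  have t1 : Tendsto (fun x => b (J₁ (T x) - J₁ (T m)) (T' x)) (𝓝 m) (𝓝 0) := by
    rw [← Asymptotics.isLittleO_one_iff ℝ] at c1 ⊢
    exact bilin_isLittleO b c1 (isBigO_one_of_eventually_le hC')
  have t2 : Tendsto (fun x => b (T m) (J₂ (T' x) - J₂ (T' m))) (𝓝 m) (𝓝 0) := by
    have := ((b (T m)).continuous.tendsto 0).comp c2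
    rwa [map_zero] at this
  have t := (t1.add t2).add_const (J (b (T m) (T' m)))
  simp only [add_zero, zero_add] at t
  exact t.congr fun x => (e x).symm

/-- The remainder of the Leibniz rule has three terms: the two remainders of the factors, each using
up both J's, and the mixed term `b (D (x - m)) (J₂ (T' x) - J₂ (T' m))`, in which the continuity of
`J₂ ∘ T'` supplies the smallness. -/
theorem LossyReg.hasFDerivAt_bilin {J₁ : F₁ →L[ℝ] F₁} {J₂ : F₂ →L[ℝ] F₂} {J : F →L[ℝ] F}
    (b : F₁ →L[ℝ] F₂ →L[ℝ] F) (hb₁ : ∀ x y, b (J₁ x) y = J (b x y))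
    (hb₂ : ∀ x y, b x (J₂ y) = J (b x y)) {T : M → F₁} {T' : M → F₂} {m : M}
    {D : M →L[ℝ] F₁} {D' : M →L[ℝ] F₂} {C' : ℝ} (hC' : ∀ᶠ x in 𝓝 m, ‖T' x‖ ≤ C')
    (hc' : ContinuousAt (fun m => J₂ (T' m)) m)
    (hd : HasFDerivAt (fun x => J₁ (J₁ (T x))) (J₁ ∘L D) m)
    (hd' : HasFDerivAt (fun x => J₂ (J₂ (T' x))) (J₂ ∘L D') m) :
    HasFDerivAt (fun x => J (J (b (T x) (T' x))))
      (J ∘L ((b.flip (T' m)) ∘L D + (b (T m)) ∘L D')) m := by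
  rw [hasFDerivAt_iff_isLittleO] at *
  have c2 : Tendsto (fun x => J₂ (T' x) - J₂ (T' m)) (𝓝 m) (𝓝 0) := by
    simpa using hc'.tendsto.sub_const (J₂ (T' m))
  rw [← Asymptotics.isLittleO_one_iff ℝ] at c2
  have t1 := bilin_isLittleO b hd (isBigO_one_of_eventually_le hC')
  have t2 : (fun x => b (D (x - m)) (J₂ (T' x) - J₂ (T' m))) =o[𝓝 m] fun x => x - m :=
    bilin_isLittleO' b (D.isBigO_sub (𝓝 m) m) c2
  have t3 : (fun x => (b (T m)) (J₂ (J₂ (T' x)) - J₂ (J₂ (T' m)) - (J₂ ∘L D') (x - m)))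
      =o[𝓝 m] fun x => x - m := ((b (T m)).isBigO_comp _ _).trans_isLittleO hd'
  refine ((t1.add t2).add t3).congr_left fun x => ?_
  simp only [map_sub, hb₁, hb₂, sub_apply, ContinuousLinearMap.comp_apply,
    add_apply, ContinuousLinearMap.flip_apply, map_add]
  abel

/-- The derivative is a sum of two pairings, each of one factor with the derivative of the other, so
the induction is applied to the operator-valued pairings `b₁` and `b₂`. For this reason the spaces
and the pairing vary in the induction. -/
theorem LossyReg.bilin (hU : IsOpen U) (j : ℕ) : ∀ {F F₁ F₂ : Type u} [NormedAddCommGroup F]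
    [NormedSpace ℝ F] [NormedAddCommGroup F₁] [NormedSpace ℝ F₁] [NormedAddCommGroup F₂]
    [NormedSpace ℝ F₂] {J₁ : F₁ →L[ℝ] F₁} {J₂ : F₂ →L[ℝ] F₂} {J : F →L[ℝ] F}
    (b : F₁ →L[ℝ] F₂ →L[ℝ] F) (_ : ∀ x y, b (J₁ x) y = J (b x y))
    (_ : ∀ x y, b x (J₂ y) = J (b x y)) {T : M → F₁} {T' : M → F₂},
    LossyReg U j J₁ T → LossyReg U j J₂ T' → LossyReg U j J (fun m => b (T m) (T' m)) := by
  induction j with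
  | zero =>
    intro F F₁ F₂ _ _ _ _ _ _ J₁ J₂ J b hb₁ hb₂ T T' h h'
    exact ⟨h.1.bilin b h'.1, continuousOn_bilin b hb₁ hb₂ h.1 h'.1 h.2 h'.2 hU⟩
  | succ j ih =>
    intro F F₁ F₂ _ _ _ _ _ _ J₁ J₂ J b hb₁ hb₂ T T' h h'
    have k := LossyReg.of_succ j h
    have k' := LossyReg.of_succ j h'
    obtain ⟨h1, h2, D, h3, h4⟩ := h
    obtain ⟨h1', h2', D', h3', h4'⟩ := h'
    let b₁ : (M →L[ℝ] F₁) →L[ℝ] F₂ →L[ℝ] (M →L[ℝ] F) :=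
      ((ContinuousLinearMap.compL ℝ M F₁ F).comp b.flip).flip
    let b₂ : F₁ →L[ℝ] (M →L[ℝ] F₂) →L[ℝ] (M →L[ℝ] F) := (ContinuousLinearMap.compL ℝ M F₂ F).comp b
    refine ⟨h1.bilin b h1', continuousOn_bilin b hb₁ hb₂ h1 h1' h2 h2' hU,
      fun m => b₁ (D m) (T' m) + b₂ (T m) (D' m), ?_, fun m hm => ?_⟩
    · refine LossyReg.add j (ih b₁ ?_ ?_ h3 k') (ih b₂ ?_ ?_ k h3')
      · intro x y; ext z; simp [b₁, hb₁]
      · intro x y; ext z; simp [b₁, hb₂]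
      · intro x y; ext z; simp [b₂, hb₁]
      · intro x y; ext z; simp [b₂, hb₂]
    · obtain ⟨C', hC'⟩ := h1' m hm
      exact hasFDerivAt_bilin b hb₁ hb₂ hC' (h2'.continuousAt (hU.mem_nhds hm)) (h4 m hm) (h4' m hm)

/-- A locally bounded family that satisfies a second resolvent identity, up to one factor of the
smoothing operator, is differentiable with loss to every order. -/
theorem LossyReg.of_resolvent_identity (hU : IsOpen U) {J : F →L[ℝ] F}
    (b : F →L[ℝ] F →L[ℝ] (M →L[ℝ] F)) (hb₁ : ∀ x y, b (J x) y = J ∘L (b x y))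
    (hb₂ : ∀ x y, b x (J y) = J ∘L (b x y)) {T : M → F} (hT : LocBddOn U T)
    (h : ∀ m ∈ U, ∀ m' ∈ U, J (T m') - J (T m) = b (T m') (T m) (m' - m)) (j : ℕ) :
    LossyReg U j J T := by
  have hc : ContinuousOn (fun m => J (T m)) U := by
    intro m hm
    refine ContinuousAt.continuousWithinAt ?_
    obtain ⟨C, hC⟩ := hT m hm
    rw [ContinuousAt, tendsto_iff_norm_sub_tendsto_zero]
    have t : Tendsto (fun x => ‖b‖ * C * ‖T m‖ * ‖x - m‖) (𝓝 m) (𝓝 0) := by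
      have : Continuous fun x => ‖b‖ * C * ‖T m‖ * ‖x - m‖ := by fun_prop
      simpa using this.tendsto m
    refine squeeze_zero' (Eventually.of_forall fun x => norm_nonneg _) ?_ t
    filter_upwards [hC, hU.mem_nhds hm] with x hx hxU
    rw [h m hm x hxU]
    refine ((b (T x) (T m)).le_opNorm _).trans ?_
    gcongr
    refine (b.le_opNorm₂ _ _).trans ?_
    gcongr
  induction j with
  | zero => exact ⟨hT, hc⟩
  | succ j ih =>
    -- The derivative is the resolvent identity with m' = m. It is bilinear in `T` itself, so the
    -- regularity of order j already obtained for `T` gives that of the derivative.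
    refine ⟨hT, hc, fun m => b (T m) (T m), LossyReg.bilin hU j b hb₁ hb₂ ih ih, fun m hm => ?_⟩
    rw [hasFDerivAt_iff_isLittleO]
    have c : (fun x => J (T x) - J (T m)) =o[𝓝 m] (fun _ => (1 : ℝ)) := by
      rw [Asymptotics.isLittleO_one_iff]
      simpa using ((hc.continuousAt (hU.mem_nhds hm)).tendsto).sub_const (J (T m))
    have c1 : (fun x => b (J (T x) - J (T m)) (T m)) =o[𝓝 m] (fun _ => (1 : ℝ)) :=
      ((b.flip (T m)).isBigO_comp _ _).trans_isLittleO c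
    have c2 : (fun x => b (J (T x) - J (T m)) (T m) (x - m)) =o[𝓝 m] (fun x => x - m) :=
      bilin_isLittleO' (ContinuousLinearMap.apply ℝ F) (Asymptotics.isBigO_refl _ _) c1
    refine c2.congr' ?_ EventuallyEq.rfl
    filter_upwards [hU.mem_nhds hm] with x hx
    simp [hb₁, ← h m hm x hx]

/-- The functionals on a space with a smoothing operator `J` that are limits of functionals which
factor through `J`. -/
def SmoothingLimit (J : F →L[ℝ] F) (e : F →L[ℝ] F₁) : Prop :=
  ∃ p : ℕ → (F →L[ℝ] F₁), Tendsto (fun n => p n ∘L J) atTop (𝓝 e)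

theorem SmoothingLimit.comp {J : F →L[ℝ] F} {e : F →L[ℝ] F₁} (h : SmoothingLimit J e) :
    SmoothingLimit J (e ∘L J) := by
  obtain ⟨p, hp⟩ := h
  exact ⟨fun n => p n ∘L J,
    ((((ContinuousLinearMap.compL ℝ F F F₁).flip J).continuous).tendsto e).comp hp⟩

theorem SmoothingLimit.lift {J : F →L[ℝ] F} {e : F →L[ℝ] F₁} (h : SmoothingLimit J e) :
    SmoothingLimit (ContinuousLinearMap.compL ℝ M F F J) (ContinuousLinearMap.compL ℝ M F F₁ e) := by
  obtain ⟨p, hp⟩ := h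
  exact ⟨fun n => ContinuousLinearMap.compL ℝ M F F₁ (p n),
    (((ContinuousLinearMap.compL ℝ M F F₁).continuous).tendsto e).comp hp⟩

/-- Convergence of `p n ∘L J` in operator norm is uniform on bounded sets. Thus `e ∘ T` inherits
properties of `J ∘ T` although `T` is merely locally bounded. -/
theorem SmoothingLimit.tendstoLocallyUniformlyOn {J : F →L[ℝ] F} {e : F →L[ℝ] F₁}
    {p : ℕ → (F →L[ℝ] F₁)} (hp : Tendsto (fun n => p n ∘L J) atTop (𝓝 e)) {T : M → F}
    (hT : LocBddOn U T) :
    TendstoLocallyUniformlyOn (fun n m => p n (J (T m))) (fun m => e (T m)) atTop U := by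
  rw [Metric.tendstoLocallyUniformlyOn_iff]
  intro ε hε m hm
  obtain ⟨C, hC⟩ := hT m hm
  refine ⟨_, mem_nhdsWithin_of_mem_nhds hC, ?_⟩
  have : Tendsto (fun n => ‖e - p n ∘L J‖ * (|C| + 1)) atTop (𝓝 0) := by
    simpa using ((hp.const_sub e).norm).mul_const (|C| + 1)
  filter_upwards [this.eventually_lt_const hε] with n hn x hx
  rw [dist_eq_norm]
  have h := (e - p n ∘L J).le_opNorm (T x)
  refine h.trans_lt (lt_of_le_of_lt ?_ hn)
  have hx' : ‖T x‖ ≤ C := hx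
  gcongr
  linarith [le_abs_self C]

/-- Evaluated on limits of smooth data, a family with `j` lossy derivatives is of class `C^j` after
`j` applications of the smoothing operator only. -/
theorem LossyReg.contDiffOn (hU : IsOpen U) (j : ℕ) : ∀ {F F₁ : Type u} [NormedAddCommGroup F]
    [NormedSpace ℝ F] [NormedAddCommGroup F₁] [NormedSpace ℝ F₁] {J : F →L[ℝ] F}
    {e : F →L[ℝ] F₁} (_ : SmoothingLimit J e) {T : M → F}, LossyReg U j J T →
    ContDiffOn ℝ (j : WithTop ℕ∞) (fun m => e ((J ^ j) (T m))) U := by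
  induction j with
  | zero =>
    intro F F₁ _ _ _ _ J e he T h
    obtain ⟨p, hp⟩ := he
    simp only [Nat.cast_zero, contDiffOn_zero, pow_zero, one_apply_eq_self]
    refine (SmoothingLimit.tendstoLocallyUniformlyOn hp h.1).continuousOn
      (Frequently.of_forall fun n => ?_)
    exact (p n).continuous.comp_continuousOn h.2
  | succ j ih =>
    intro F F₁ _ _ _ _ J e he T h
    have hloc := h.locBddOn
    obtain ⟨h1, h2, D, h3, h4⟩ := h
    -- One J is saved here: `e (J T)` is the limit of `p n (J (J T))`, whose derivatives `p n ∘ J ∘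
    -- D` converge locally uniformly to `e ∘ D`.
    have hd : ∀ {e : F →L[ℝ] F₁}, SmoothingLimit J e → ∀ m ∈ U,
        HasFDerivAt (fun x => e (J (T x))) (e ∘L D m) m := by
      intro e he m hm
      have he' := he.comp
      obtain ⟨p, hp⟩ := he
      have hp1 : Tendsto (fun n => ContinuousLinearMap.compL ℝ M F F₁ (p n) ∘L
          ContinuousLinearMap.compL ℝ M F F J) atTop (𝓝 (ContinuousLinearMap.compL ℝ M F F₁ e)) :=
        (((ContinuousLinearMap.compL ℝ M F F₁).continuous).tendsto e).comp hp
      refine hasFDerivAt_of_tendstoLocallyUniformlyOn (l := atTop)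
        (f := fun n x => p n (J (J (T x)))) (f' := fun n x => p n ∘L J ∘L D x)
        (g' := fun x => e ∘L D x) hU
        (SmoothingLimit.tendstoLocallyUniformlyOn hp1 h3.locBddOn) (fun n x hx => ?_)
        (fun x hx => ?_) hm
      · exact (p n).hasFDerivAt.comp x (h4 x hx)
      · exact (((ContinuousLinearMap.apply ℝ F₁ (J (T x))).continuous).tendsto e).comp hp
    have hej : SmoothingLimit J (e ∘L J ^ j) := by
      clear ih h3
      induction j with
      | zero => simpa [ContinuousLinearMap.one_def] using he
      | succ j ih => simpa [pow_succ, ContinuousLinearMap.mul_def, ContinuousLinearMap.comp_assoc]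
          using ih.comp
    have hk := ih (he.lift (M := M)) h3
    have hpow : ∀ (i : ℕ) (X : M →L[ℝ] F),
        (ContinuousLinearMap.compL ℝ M F F J ^ i) X = (J ^ i) ∘L X := by
      intro i
      induction i with
      | zero => intro X; rfl
      | succ i ihi => intro X; simp [pow_succ, ihi, ContinuousLinearMap.comp_assoc,
          ContinuousLinearMap.mul_def]
    push_cast
    rw [contDiffOn_succ_iff_hasFDerivWithinAt_of_uniqueDiffOn hU.uniqueDiffOn]
    refine ⟨by simp, _, hk, fun m hm => HasFDerivAt.hasFDerivWithinAt ?_⟩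
    have := hd hej m hm
    simp only [hpow, ContinuousLinearMap.compL_apply]
    simpa [pow_succ, ContinuousLinearMap.comp_assoc] using this

end LossyRegularity

/-! ### Integral operators on a compact interval -/

section IntervalOperators

variable {E F : Type*} [NormedAddCommGroup E] [NormedSpace ℝ E] [NormedAddCommGroup F]
  [NormedSpace ℝ F] {a b : ℝ}

theorem continuous_iccExtend (hab : a ≤ b) (u : C(Icc a b, E)) : Continuous (IccExtend hab u) :=
  u.continuous.Icc_extend'

theorem norm_iccExtend_le (hab : a ≤ b) (u : C(Icc a b, E)) (s : ℝ) : ‖IccExtend hab u s‖ ≤ ‖u‖ :=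
  u.norm_coe_le_norm _

variable (E a b) in
/-- The space of integrable functions on the interval `[a, b]`. -/
abbrev L1Icc : Type _ := Lp E 1 (volume.restrict (Icc a b))

theorem L1Icc.integrableOn (h : L1Icc E a b) : IntegrableOn h (Icc a b) := L1.integrable_coeFn h

theorem L1Icc.intervalIntegrable (h : L1Icc E a b) {s t : ℝ} (hs : s ∈ Icc a b)
    (ht : t ∈ Icc a b) : IntervalIntegrable h volume s t := by
  refine (h.integrableOn.mono_set ?_).intervalIntegrable
  exact uIcc_subset_Icc hs ht

theorem L1Icc.ae_interval {p : ℝ → Prop} (hp : ∀ᵐ s ∂(volume.restrict (Icc a b)), p s) {t : ℝ}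
    (ht : t ∈ Icc a b) : ∀ᵐ s : ℝ, s ∈ Set.uIoc a t → p s := by
  rw [ae_restrict_iff' measurableSet_Icc] at hp
  filter_upwards [hp] with s hs hst
  rw [uIoc_of_le ht.1] at hst
  exact hs ⟨hst.1.le, hst.2.trans ht.2⟩

variable (E a b) in
/-- The primitive vanishing at `a` of an integrable function on `[a, b]`. -/
noncomputable def primitiveL1 : L1Icc E a b →L[ℝ] C(Icc a b, E) :=
  LinearMap.mkContinuous
    { toFun := fun h => ⟨fun t => ∫ s in a..(t : ℝ), h s, by
        rcases le_or_gt a b with hab | hab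
        · have := intervalIntegral.continuousOn_primitive_interval
            (a := a) (b := b) (f := h) (μ := volume) (by rw [uIcc_of_le hab]; exact h.integrableOn)
          rw [uIcc_of_le hab] at this
          exact this.domRestrict
        · have : IsEmpty (Icc a b) := by simp [hab]
          exact continuous_of_const fun x => (IsEmpty.false x).elim⟩
      map_add' := fun h h' => by
        ext t
        simp only [ContinuousMap.coe_mk, ContinuousMap.add_apply]
        have ha : a ∈ Icc a b := ⟨le_rfl, t.2.1.trans t.2.2⟩
        rw [← intervalIntegral.integral_add (h.intervalIntegrable ha t.2)
          (h'.intervalIntegrable ha t.2)]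
        exact intervalIntegral.integral_congr_ae (L1Icc.ae_interval (Lp.coeFn_add h h') t.2)
      map_smul' := fun c h => by
        ext t
        simp only [ContinuousMap.coe_mk, ContinuousMap.smul_apply, RingHom.id_apply]
        rw [← intervalIntegral.integral_smul]
        exact intervalIntegral.integral_congr_ae (L1Icc.ae_interval (Lp.coeFn_smul c h) t.2) }
    1 (fun h => by
      rw [one_mul, ContinuousMap.norm_le _ (norm_nonneg _)]
      intro t
      refine (intervalIntegral.norm_integral_le_integral_norm t.2.1).trans ?_
      rw [L1.norm_eq_integral_norm, intervalIntegral.integral_of_le t.2.1]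
      refine setIntegral_mono_set h.integrableOn.norm (Eventually.of_forall fun s => norm_nonneg _)
        (LE.le.eventuallyLE ?_)
      exact fun s hs => ⟨hs.1.le, hs.2.trans t.2.2⟩)

theorem integrable_iccExtend (hab : a ≤ b) (u : C(Icc a b, E)) :
    Integrable (IccExtend hab u) (volume.restrict (Icc a b)) :=
  (continuous_iccExtend hab u).integrableOn_Icc

theorem norm_toL1_iccExtend (hab : a ≤ b) (u : C(Icc a b, E)) :
    ‖(integrable_iccExtend hab u).toL1 _‖ = ∫ s in a..b, ‖IccExtend hab u s‖ := by
  rw [L1.norm_eq_integral_norm, intervalIntegral.integral_of_le hab, ← integral_Icc_eq_integral_Ioc]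
  refine integral_congr_ae ?_
  filter_upwards [(integrable_iccExtend hab u).coeFn_toL1] with s hs
  rw [hs]

/-- A continuous function on `[a, b]` as an element of `L¹`. -/
noncomputable def toL1Icc (hab : a ≤ b) : C(Icc a b, E) →L[ℝ] L1Icc E a b :=
  LinearMap.mkContinuous
    { toFun := fun u => (integrable_iccExtend hab u).toL1 _
      map_add' := by
        intro u v
        exact (integrable_iccExtend hab u).toL1_add _ _ (integrable_iccExtend hab v)
      map_smul' := by
        intro c u
        exact (integrable_iccExtend hab u).toL1_smul _ c }
    (b - a) (fun u => by
      refine (norm_toL1_iccExtend hab u).le.trans ?_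
      refine (intervalIntegral.integral_mono_on hab
        ((continuous_iccExtend hab u).norm.intervalIntegrable _ _)
        (intervalIntegrable_const (c := ‖u‖)) fun s _ => norm_iccExtend_le hab u s).trans_eq ?_
      simp)

theorem coeFn_toL1Icc (hab : a ≤ b) (u : C(Icc a b, E)) :
    (toL1Icc hab u : ℝ → E) =ᵐ[volume.restrict (Icc a b)] IccExtend hab u :=
  (integrable_iccExtend hab u).coeFn_toL1

theorem norm_toL1Icc (hab : a ≤ b) (u : C(Icc a b, E)) :
    ‖toL1Icc hab u‖ = ∫ s in a..b, ‖IccExtend hab u s‖ := norm_toL1_iccExtend hab u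

/-- The primitive vanishing at `a` of a continuous function on `[a, b]`. -/
noncomputable def primitive (hab : a ≤ b) : C(Icc a b, E) →L[ℝ] C(Icc a b, E) :=
  primitiveL1 E a b ∘L toL1Icc hab

theorem primitive_apply (hab : a ≤ b) (u : C(Icc a b, E)) (t : Icc a b) :
    primitive hab u t = ∫ s in a..(t : ℝ), IccExtend hab u s :=
  intervalIntegral.integral_congr_ae (L1Icc.ae_interval (coeFn_toL1Icc hab u) t.2)

theorem iccExtend_apply (hab : a ≤ b) (u : Icc a b → E) {s : ℝ} (hs : s ∈ Icc a b) :
    IccExtend hab u s = u ⟨s, hs⟩ := IccExtend_of_mem hab u hs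

theorem primitive_eq_of_hasDerivAt (hab : a ≤ b) {g g' : ℝ → E} [CompleteSpace E]
    (hg : ∀ t, HasDerivAt g (g' t) t) (hg' : Continuous g') {u : C(Icc a b, E)}
    (hu : ∀ t : Icc a b, u t = g' t) (t : Icc a b) : primitive hab u t = g t - g a := by
  rw [primitive_apply, ← intervalIntegral.integral_eq_sub_of_hasDerivAt (fun s _ => hg s)
    (hg'.intervalIntegrable _ _)]
  refine intervalIntegral.integral_congr fun s hs => ?_
  rw [uIcc_of_le t.2.1] at hs
  rw [iccExtend_apply hab u ⟨hs.1, hs.2.trans t.2.2⟩, hu]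

/-- The primitives of continuous functions are dense in `L¹`. -/
theorem denseRange_toL1Icc_primitive [CompleteSpace E] (hab : a ≤ b) :
    DenseRange (toL1Icc hab ∘L primitive hab : C(Icc a b, E) →L[ℝ] L1Icc E a b) := by
  set T : C(Icc a b, E) →L[ℝ] L1Icc E a b := toL1Icc hab ∘L primitive hab with hT
  let S : Submodule ℝ (L1Icc E a b) := (LinearMap.range (T : C(Icc a b, E) →ₗ[ℝ] L1Icc E a b)).topologicalClosure
  have hS : IsClosed (S : Set (L1Icc E a b)) := Submodule.isClosed_topologicalClosure _
  have hTS : ∀ u, T u ∈ S := fun u => Submodule.le_topologicalClosure _ ⟨u, rfl⟩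
  -- Primitives vanish at `a`, constants do not. They are approximated by (1 - exp(-(n+1)(t - a)))
  -- x, with L¹ error at most ‖x‖/(n+1). A smooth g is then the primitive of g' plus the constant
  -- g(a).
  have hconst : ∀ x : E, toL1Icc hab (ContinuousMap.const _ x) ∈ S := by
    intro x
    let u : ℕ → C(Icc a b, E) := fun n =>
      ⟨fun t => (((n : ℝ) + 1) * Real.exp (-((n : ℝ) + 1) * (t - a))) • x, by fun_prop⟩
    have hu : ∀ n t, primitive hab (u n) t = (1 - Real.exp (-((n : ℝ) + 1) * (t - a))) • x := by
      intro n t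
      rw [primitive_eq_of_hasDerivAt hab (g := fun t => (-Real.exp (-((n : ℝ) + 1) * (t - a))) • x)
        (g' := fun t => (((n : ℝ) + 1) * Real.exp (-((n : ℝ) + 1) * (t - a))) • x) _ (by fun_prop)
        (fun t => rfl) t]
      · rw [← sub_smul]; congr 1; simp; ring
      · intro t
        refine HasDerivAt.smul_const ?_ x
        have h1 : HasDerivAt (fun t => -((n : ℝ) + 1) * (t - a)) (-((n : ℝ) + 1)) t := by
          simpa using ((hasDerivAt_id t).sub_const a).const_mul (-((n : ℝ) + 1))
        exact h1.exp.neg.congr_deriv (by ring)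
    have key : Tendsto (fun n => T (u n)) atTop (𝓝 (toL1Icc hab (ContinuousMap.const _ x))) := by
      rw [tendsto_iff_norm_sub_tendsto_zero]
      have hb : ∀ n, ‖T (u n) - toL1Icc hab (ContinuousMap.const _ x)‖ ≤ ‖x‖ * (1 / ((n : ℝ) + 1)) := by
        intro n
        rw [hT, ContinuousLinearMap.comp_apply, ← map_sub, norm_toL1Icc]
        have hn : (0 : ℝ) < (n : ℝ) + 1 := by positivity
        have e1 : ∫ s in a..b, ‖IccExtend hab (⇑(primitive hab (u n) - ContinuousMap.const (Icc a b) x)) s‖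
            = ∫ s in a..b, Real.exp (-((n : ℝ) + 1) * (s - a)) * ‖x‖ := by
          refine intervalIntegral.integral_congr fun s hs => ?_
          rw [uIcc_of_le hab] at hs
          rw [iccExtend_apply hab _ hs]
          simp only [ContinuousMap.sub_apply, ContinuousMap.const_apply, hu]
          rw [sub_smul, one_smul, sub_sub_cancel_left, norm_neg, norm_smul, Real.norm_eq_abs,
            Real.abs_exp]
        have hd : ∀ s, HasDerivAt (fun s => -(1 / ((n : ℝ) + 1)) * Real.exp (-((n : ℝ) + 1) * (s - a)))
            (Real.exp (-((n : ℝ) + 1) * (s - a))) s := by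
          intro t
          have h1 : HasDerivAt (fun t => -((n : ℝ) + 1) * (t - a)) (-((n : ℝ) + 1)) t := by
            simpa using ((hasDerivAt_id t).sub_const a).const_mul (-((n : ℝ) + 1))
          exact (h1.exp.const_mul (-(1 / ((n : ℝ) + 1)))).congr_deriv (by field_simp)
        rw [e1, intervalIntegral.integral_mul_const, intervalIntegral.integral_eq_sub_of_hasDerivAt
          (fun s _ => hd s) (by apply Continuous.intervalIntegrable; fun_prop), mul_comm]
        gcongr
        simp only [sub_self, mul_zero, Real.exp_zero]
        have : 0 ≤ (1 / ((n : ℝ) + 1)) * Real.exp (-((n : ℝ) + 1) * (b - a)) := by positivity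
        linarith
      refine squeeze_zero (fun n => norm_nonneg _) hb ?_
      simpa using tendsto_one_div_add_atTop_nhds_zero_nat.const_mul ‖x‖
    exact hS.mem_of_tendsto key (Eventually.of_forall fun n => hTS _)
  have hdense := Lp.dense_hasCompactSupport_contDiff (E := ℝ) (F := E) (p := 1)
    (μ := volume.restrict (Icc a b)) (by simp)
  have hsub : {f : L1Icc E a b | ∃ (g : ℝ → E), f =ᵐ[volume.restrict (Icc a b)] g ∧
      HasCompactSupport g ∧ ContDiff ℝ ∞ g} ⊆ S := by
    rintro f ⟨g, hfg, -, hg⟩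
    have hd : Continuous (deriv g) := hg.continuous_deriv (by simp)
    let u : C(Icc a b, E) := ⟨fun t => deriv g t, by fun_prop⟩
    have hf : f = T u + toL1Icc hab (ContinuousMap.const _ (g a)) := by
      rw [hT, ContinuousLinearMap.comp_apply, ← map_add]
      apply Lp.ext
      refine hfg.trans (EventuallyEq.trans ?_ (coeFn_toL1Icc hab _).symm)
      rw [EventuallyEq, ae_restrict_iff' measurableSet_Icc]
      refine Eventually.of_forall fun s hs => ?_
      rw [iccExtend_apply hab _ hs, ContinuousMap.add_apply, primitive_eq_of_hasDerivAt hab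
        (fun t => (hg.differentiable (by simp) t).hasDerivAt) hd (fun t => rfl)]
      simp
    rw [hf]
    exact S.add_mem (hTS u) (hconst _)
  have h1 : Dense (S : Set (L1Icc E a b)) := hdense.mono hsub
  have h2 : (S : Set (L1Icc E a b)) = univ := by rw [← hS.closure_eq]; exact h1.closure_eq
  rw [DenseRange, dense_iff_closure_eq, ← h2]
  rfl

theorem denseRange_toL1Icc [CompleteSpace E] (hab : a ≤ b) :
    DenseRange (toL1Icc hab : C(Icc a b, E) →L[ℝ] L1Icc E a b) :=
  (denseRange_toL1Icc_primitive hab).mono (by rintro _ ⟨u, rfl⟩; exact ⟨primitive hab u, rfl⟩)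

variable (E F) in
/-- The action of bounded operators on continuous functions. -/
noncomputable def pointwiseOp (α : Type*) [TopologicalSpace α] [CompactSpace α] :
    (E →L[ℝ] F) →L[ℝ] C(α, E) →L[ℝ] C(α, F) :=
  LinearMap.mkContinuous
    { toFun := fun A => A.compLeftContinuous ℝ α
      map_add' := fun A B => by ext; rfl
      map_smul' := fun c A => by ext; rfl } 1 (fun A => by
        refine ContinuousLinearMap.opNorm_le_bound _ (by positivity) fun u => ?_
        rw [ContinuousMap.norm_le _ (by positivity), one_mul]
        exact fun t => (A.le_opNorm _).trans (by gcongr; exact u.norm_coe_le_norm t))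

@[simp]
theorem pointwiseOp_apply {α : Type*} [TopologicalSpace α] [CompactSpace α] (A : E →L[ℝ] F)
    (u : C(α, E)) (t : α) : pointwiseOp E F α A u t = A (u t) := rfl

theorem primitive_pointwiseOp [CompleteSpace E] [CompleteSpace F] (hab : a ≤ b) (A : E →L[ℝ] F)
    (u : C(Icc a b, E)) :
    primitive hab (pointwiseOp E F _ A u) = pointwiseOp E F _ A (primitive hab u) := by
  ext t
  rw [pointwiseOp_apply, primitive_apply, primitive_apply, ← ContinuousLinearMap.intervalIntegral_comp_comm _
    ((continuous_iccExtend hab u).intervalIntegrable _ _)]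
  rfl

/-- Fubini on the triangle a ≤ r ≤ s ≤ t. Integrability instead of continuity is needed for data
that are only locally integrable. -/
theorem integral_integral_triangle_of_integrableOn {G : ℝ → ℝ → E} {t : ℝ} (ht : a ≤ t)
    (hint : IntegrableOn (Function.uncurry G) (Icc a t ×ˢ Icc a t) (volume.prod volume)) :
    ∫ s in a..t, ∫ r in a..s, G s r = ∫ r in a..t, ∫ s in r..t, G s r := by
  have h1 : ∫ s in a..t, ∫ r in a..s, G s r
      = ∫ s in a..t, ∫ r in a..t, {x : ℝ | x ≤ s}.indicator (G s) r := by
    refine intervalIntegral.integral_congr fun s hs => ?_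
    rw [uIcc_of_le ht] at hs
    exact (intervalIntegral.integral_indicator hs).symm
  have h2 : ∫ r in a..t, ∫ s in r..t, G s r
      = ∫ r in a..t, ∫ s in a..t, {x : ℝ | x ≤ s}.indicator (G s) r := by
    refine intervalIntegral.integral_congr fun r hr => ?_
    rw [uIcc_of_le ht] at hr
    rw [intervalIntegral.integral_of_le ht, intervalIntegral.integral_of_le hr.2,
      ← integral_Icc_eq_integral_Ioc (x := r), ← integral_Icc_eq_integral_Ioc (x := a)]
    have : ∀ s, {x : ℝ | x ≤ s}.indicator (G s) r = (Ici r).indicator (fun s => G s r) s := by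
      intro s; simp [indicator]
    simp_rw [this]
    rw [setIntegral_indicator measurableSet_Ici]
    congr 2
    ext s
    simp only [mem_inter_iff, mem_Icc, mem_Ici]
    exact ⟨fun h => ⟨⟨hr.1.trans h.1, h.2⟩, h.1⟩, fun h => ⟨h.2, h.1.2⟩⟩
  rw [h1, h2, intervalIntegral_intervalIntegral_swap]
  have hmeas : MeasurableSet {p : ℝ × ℝ | p.2 ≤ p.1} := measurableSet_le measurable_snd measurable_fst
  rw [uIoc_of_le ht]
  have := (hint.mono_set (prod_mono Ioc_subset_Icc_self Ioc_subset_Icc_self)).indicator hmeas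
  refine this.congr (Eventually.of_forall fun p => ?_)
  simp [indicator, Function.uncurry]

theorem integral_integral_triangle {G : ℝ → ℝ → E} (hG : Continuous (Function.uncurry G))
    {t : ℝ} (ht : a ≤ t) :
    ∫ s in a..t, ∫ r in a..s, G s r = ∫ r in a..t, ∫ s in r..t, G s r :=
  integral_integral_triangle_of_integrableOn ht
    (hG.continuousOn.integrableOn_compact (isCompact_Icc.prod isCompact_Icc))

end IntervalOperators

/-! ### Causal convolution operators -/

section CausalConvolution

variable {H : Type*} [NormedAddCommGroup H] [InnerProductSpace ℝ H] [CompleteSpace H] {a b : ℝ}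

variable (H) in
/-- The inclusion of the self-adjoint operators in the bounded operators. -/
noncomputable def BSymm.inclusion : BSymm H →L[ℝ] (H →L[ℝ] H) :=
  (selfAdjoint.submodule ℝ (H →L[ℝ] H)).subtypeL

/-- A memory kernel, extended to the whole line by its value at `0`. -/
noncomputable def extendedKernel (q : ℝ≥0 →ᵇ BSymm H) (t : ℝ) : H →L[ℝ] H := (q t.toNNReal).toCLM

theorem continuous_extendedKernel (q : ℝ≥0 →ᵇ BSymm H) : Continuous (extendedKernel q) :=
  (BSymm.inclusion H).continuous.comp (q.continuous.comp continuous_real_toNNReal)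

theorem norm_extendedKernel_le (q : ℝ≥0 →ᵇ BSymm H) (t : ℝ) : ‖extendedKernel q t‖ ≤ ‖q‖ :=
  q.norm_coe_le_norm _

theorem continuous_kernel_integrand (hab : a ≤ b) (q : ℝ≥0 →ᵇ BSymm H) (u : C(Icc a b, H)) :
    Continuous (Function.uncurry fun (t s : ℝ) => extendedKernel q (t - s) (IccExtend hab u s)) := by
  have h1 := continuous_extendedKernel q
  have h2 := continuous_iccExtend hab u
  unfold Function.uncurry
  exact (h1.comp (continuous_fst.sub continuous_snd)).clm_apply (h2.comp continuous_snd)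

theorem continuous_kernel_integrand_right (hab : a ≤ b) (q : ℝ≥0 →ᵇ BSymm H) (u : C(Icc a b, H))
    (t : ℝ) : Continuous fun s : ℝ => extendedKernel q (t - s) (IccExtend hab u s) :=
  (continuous_kernel_integrand hab q u).comp (Continuous.prodMk_right t)

theorem norm_kernel_integrand_le (hab : a ≤ b) (q : ℝ≥0 →ᵇ BSymm H) (u : C(Icc a b, H)) (t s : ℝ) :
    ‖extendedKernel q (t - s) (IccExtend hab u s)‖ ≤ ‖q‖ * ‖IccExtend hab u s‖ :=
  (ContinuousLinearMap.le_opNorm _ _).trans (by gcongr; exact norm_extendedKernel_le q _)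

/-- Convolution with a memory kernel, acting on functions on `[a, b]` that are extended by `0` to
the left. -/
noncomputable def causalConv (hab : a ≤ b) :
    (ℝ≥0 →ᵇ BSymm H) →L[ℝ] C(Icc a b, H) →L[ℝ] C(Icc a b, H) :=
  LinearMap.mkContinuous₂
    (LinearMap.mk₂ ℝ
      (fun q u => (⟨fun t => ∫ s in a..(t : ℝ), extendedKernel q (t - s) (IccExtend hab u s),
        (intervalIntegral.continuous_parametric_intervalIntegral_of_continuous
          (continuous_kernel_integrand hab q u) continuous_id).comp continuous_subtype_val⟩ :
            C(Icc a b, H)))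
      (fun q q' u => by
        ext t
        simp only [ContinuousMap.coe_mk, ContinuousMap.add_apply]
        rw [← intervalIntegral.integral_add
          ((continuous_kernel_integrand_right hab q u t).intervalIntegrable _ _)
          ((continuous_kernel_integrand_right hab q' u t).intervalIntegrable _ _)]
        rfl)
      (fun c q u => by
        ext t
        simp only [ContinuousMap.coe_mk, ContinuousMap.smul_apply]
        rw [← intervalIntegral.integral_smul]
        rfl)
      (fun q u u' => by
        ext t
        simp only [ContinuousMap.coe_mk, ContinuousMap.add_apply]
        rw [← intervalIntegral.integral_add
          ((continuous_kernel_integrand_right hab q u t).intervalIntegrable _ _)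
          ((continuous_kernel_integrand_right hab q u' t).intervalIntegrable _ _)]
        refine intervalIntegral.integral_congr fun s _ => ?_
        exact map_add (extendedKernel q (t - s)) _ _)
      (fun c q u => by
        ext t
        simp only [ContinuousMap.coe_mk, ContinuousMap.smul_apply]
        rw [← intervalIntegral.integral_smul]
        refine intervalIntegral.integral_congr fun s _ => ?_
        exact map_smul (extendedKernel q (t - s)) _ _))
    (b - a)
    (fun q u => by
      have h0 : 0 ≤ b - a := sub_nonneg.2 hab
      rw [ContinuousMap.norm_le _ (by positivity)]
      intro t
      refine (intervalIntegral.norm_integral_le_of_norm_le_const (C := ‖q‖ * ‖u‖) fun s _ =>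
        (norm_kernel_integrand_le hab q u t s).trans (by gcongr; exact norm_iccExtend_le hab u s)).trans ?_
      rw [abs_of_nonneg (sub_nonneg.2 t.2.1), mul_comm, mul_assoc]
      have := t.2.2
      gcongr)

theorem causalConv_apply (hab : a ≤ b) (q : ℝ≥0 →ᵇ BSymm H) (u : C(Icc a b, H)) (t : Icc a b) :
    causalConv hab q u t = ∫ s in a..(t : ℝ), extendedKernel q (t - s) (IccExtend hab u s) := rfl

/-- Convolutions commute with J by translation invariance: after Fubini the weights of u(r) are the
integrals over [r, t] of q(s - r) and of q(t - s), and both are the integral of q over [0, t - r].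
-/
theorem primitive_causalConv (hab : a ≤ b) (q : ℝ≥0 →ᵇ BSymm H) (u : C(Icc a b, H)) :
    primitive hab (causalConv hab q u) = causalConv hab q (primitive hab u) := by
  ext t
  have hu := continuous_iccExtend hab u
  have hq := continuous_extendedKernel q
  rw [primitive_apply, causalConv_apply]
  have e1 : ∫ s in a..(t : ℝ), IccExtend hab (causalConv hab q u) s
      = ∫ s in a..(t : ℝ), ∫ r in a..s, extendedKernel q (s - r) (IccExtend hab u r) := by
    refine intervalIntegral.integral_congr fun s hs => ?_
    rw [uIcc_of_le t.2.1] at hs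
    rw [iccExtend_apply hab _ ⟨hs.1, hs.2.trans t.2.2⟩, causalConv_apply]
  have e2 : ∫ s in a..(t : ℝ), extendedKernel q (t - s) (IccExtend hab (primitive hab u) s)
      = ∫ s in a..(t : ℝ), ∫ r in a..s, extendedKernel q (t - s) (IccExtend hab u r) := by
    refine intervalIntegral.integral_congr fun s hs => ?_
    rw [uIcc_of_le t.2.1] at hs
    rw [iccExtend_apply hab _ ⟨hs.1, hs.2.trans t.2.2⟩, primitive_apply,
      ContinuousLinearMap.intervalIntegral_comp_comm _ (hu.intervalIntegrable _ _)]
  rw [e1, e2, integral_integral_triangle (continuous_kernel_integrand hab q u) t.2.1,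
    integral_integral_triangle _ t.2.1]
  · refine intervalIntegral.integral_congr fun r _ => ?_
    have h1 := intervalIntegral.integral_comp_sub_right
      (fun s => extendedKernel q s (IccExtend hab u r)) (a := r) (b := t) r
    have h2 := intervalIntegral.integral_comp_sub_left
      (fun s => extendedKernel q s (IccExtend hab u r)) (a := r) (b := t) t
    exact h1.trans (by rw [sub_self]; exact (h2.trans (by rw [sub_self])).symm)
  · exact (hq.comp (continuous_const.sub continuous_fst)).clm_apply (hu.comp continuous_snd)

/-! ### The first order part of the evolution operator -/

/-- The zeroth order part `B + Q *` of the evolution operator on `[a, b]`. -/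
noncomputable def lowerOrderOp (hab : a ≤ b) :
    CoeffSpace H →L[ℝ] C(Icc a b, H) →L[ℝ] C(Icc a b, H) :=
  (pointwiseOp H H (Icc a b)) ∘L (WithLp.fstL 1 ℝ (H →L[ℝ] H) (MemoryKernel H)) ∘L
      (WithLp.sndL 1 ℝ (BSymm H) (WithLp 1 ((H →L[ℝ] H) × MemoryKernel H))) +
    (causalConv hab) ∘L (ContinuousLinearMap.snd ℝ _ _) ∘L (MemoryKernel H).subtypeL ∘L
      (WithLp.sndL 1 ℝ (H →L[ℝ] H) (MemoryKernel H)) ∘L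
      (WithLp.sndL 1 ℝ (BSymm H) (WithLp 1 ((H →L[ℝ] H) × MemoryKernel H)))

theorem lowerOrderOp_apply (hab : a ≤ b) (m : CoeffSpace H) (u : C(Icc a b, H)) :
    lowerOrderOp hab m u = pointwiseOp H H _ m.opB u + causalConv hab m.snd.snd.1.2 u := rfl

theorem primitive_lowerOrderOp (hab : a ≤ b) (m : CoeffSpace H) (u : C(Icc a b, H)) :
    primitive hab (lowerOrderOp hab m u) = lowerOrderOp hab m (primitive hab u) := by
  simp only [lowerOrderOp_apply, map_add, primitive_pointwiseOp, primitive_causalConv]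

/-- The operator `v ↦ A v + (B + Q *) J v`, where `J v` is the primitive of `v`. -/
noncomputable def bulkOp (hab : a ≤ b) : CoeffSpace H →L[ℝ] C(Icc a b, H) →L[ℝ] C(Icc a b, H) :=
  (pointwiseOp H H (Icc a b)) ∘L (BSymm.inclusion H) ∘L
      (WithLp.fstL 1 ℝ (BSymm H) (WithLp 1 ((H →L[ℝ] H) × MemoryKernel H))) +
    ((ContinuousLinearMap.compL ℝ _ _ _).flip (primitive hab)) ∘L (lowerOrderOp hab)

theorem bulkOp_apply (hab : a ≤ b) (m : CoeffSpace H) (v : C(Icc a b, H)) :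
    bulkOp hab m v = pointwiseOp H H _ m.opA v + lowerOrderOp hab m (primitive hab v) := rfl

/-- The coefficients A and B do not depend on time and Q acts by convolution, so J passes through.
The calculus with loss of J rests on this. -/
theorem primitive_bulkOp (hab : a ≤ b) (m : CoeffSpace H) (v : C(Icc a b, H)) :
    primitive hab (bulkOp hab m v) = bulkOp hab m (primitive hab v) := by
  simp only [bulkOp_apply, map_add, primitive_pointwiseOp, primitive_lowerOrderOp]

end CausalConvolution

/-! ### Skew-adjoint operators and their resolvents -/

section SkewAdjoint

variable {H V : Type*} [NormedAddCommGroup H] [InnerProductSpace ℝ H] [CompleteSpace H]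
  [NormedAddCommGroup V] [InnerProductSpace ℝ V]

theorem unboundedOp_apply (ι : V →L[ℝ] H) (hι : Function.Injective ι) (P : V →ₗ[ℝ] H) (v : V)
    (h : ι v ∈ (unboundedOp ι hι P).domain) : unboundedOp ι hι P ⟨ι v, h⟩ = P v := by
  change P ((LinearEquiv.ofInjective (ι : V →ₗ[ℝ] H) hι).symm ⟨ι v, h⟩) = P v
  congr 1
  rw [LinearEquiv.symm_apply_eq]
  rfl

theorem mem_unboundedOp_domain (ι : V →L[ℝ] H) (hι : Function.Injective ι) (P : V →ₗ[ℝ] H) (v : V) :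
    ι v ∈ (unboundedOp ι hι P).domain := ⟨v, rfl⟩

theorem IsSkewAdjointOp.inner_eq {ι : V →L[ℝ] H} {hι : Function.Injective ι} {P : V →ₗ[ℝ] H}
    (h : IsSkewAdjointOp (unboundedOp ι hι P)) (v w : V) : ⟪P v, ι w⟫_ℝ = -⟪ι v, P w⟫_ℝ := by
  obtain ⟨hd, ha⟩ := h
  have h1 := LinearPMap.adjoint_isFormalAdjoint hd
  rw [ha] at h1
  have h2 := h1 ⟨ι v, mem_unboundedOp_domain ι hι P v⟩ ⟨ι w, mem_unboundedOp_domain ι hι P w⟩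
  rw [LinearPMap.neg_apply, unboundedOp_apply, unboundedOp_apply] at h2
  have h4 : ⟪-P v, ι w⟫_ℝ = ⟪ι v, P w⟫_ℝ := h2
  rw [inner_neg_left] at h4
  linarith

theorem IsSkewAdjointOp.inner_self {ι : V →L[ℝ] H} {hι : Function.Injective ι} {P : V →ₗ[ℝ] H}
    (h : IsSkewAdjointOp (unboundedOp ι hι P)) (v : V) : ⟪P v, ι v⟫_ℝ = 0 := by
  have := h.inner_eq v v
  rw [real_inner_comm (P v)] at this
  linarith

/-- Skewness kills the cross term. Hence 1 + rP controls both ‖v‖ and ‖P v‖, that is the graph norm,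
which makes it injective with closed range. -/
theorem IsSkewAdjointOp.norm_sq_add_smul {ι : V →L[ℝ] H} {hι : Function.Injective ι}
    {P : V →ₗ[ℝ] H} (h : IsSkewAdjointOp (unboundedOp ι hι P)) (r : ℝ) (v : V) :
    ‖ι v + r • P v‖ ^ 2 = ‖ι v‖ ^ 2 + r ^ 2 * ‖P v‖ ^ 2 := by
  rw [norm_add_sq_real, inner_smul_right, real_inner_comm, h.inner_self, norm_smul, mul_pow,
    Real.norm_eq_abs, sq_abs]
  ring

/-- A vector y orthogonal to the range of 1 + rP lies in the domain of the adjoint, which is the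
domain of P. Testing with y itself gives ‖y‖² = 0 since ⟨P y, y⟩ = 0. -/
theorem IsSkewAdjointOp.eq_zero_of_orthogonal {ι : V →L[ℝ] H} {hι : Function.Injective ι}
    {P : V →ₗ[ℝ] H} (h : IsSkewAdjointOp (unboundedOp ι hι P)) {r : ℝ} (hr : 0 < r) {y : H}
    (hy : ∀ v, ⟪ι v + r • P v, y⟫_ℝ = 0) : y = 0 := by
  have hdom : y ∈ (unboundedOp ι hι P).adjoint.domain := by
    refine LinearPMap.mem_adjoint_domain_of_exists y ⟨-(r⁻¹ • y), ?_⟩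
    rintro ⟨_, ⟨v, rfl⟩⟩
    have e : unboundedOp ι hι P ⟨(ι : V →ₗ[ℝ] H) v, ⟨v, rfl⟩⟩ = P v := unboundedOp_apply ι hι P v _
    rw [e]
    have := hy v
    rw [inner_add_left, inner_smul_left, real_inner_comm, real_inner_comm y (P v)] at this
    simp only [conj_trivial] at this
    change ⟪-(r⁻¹ • y), ι v⟫_ℝ = _
    rw [inner_neg_left, inner_smul_left]
    simp only [conj_trivial]
    field_simp
    linarith
  rw [h.2] at hdom
  obtain ⟨v, rfl⟩ : ∃ v, ι v = y := hdom
  have := hy v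
  rw [inner_add_left, inner_smul_left, h.inner_self, mul_zero, add_zero, real_inner_self_eq_norm_sq]
    at this
  simpa using this

/-- The resolvents of a skew-adjoint operator are bounded from `H` to the domain. -/
theorem IsSkewAdjointOp.exists_resolvent [CompleteSpace V] {ι : V →L[ℝ] H}
    {hι : Function.Injective ι}
    {P : V →L[ℝ] H} (h : IsSkewAdjointOp (unboundedOp ι hι (P : V →ₗ[ℝ] H)))
    (hP : GraphNormEquiv ι (P : V →ₗ[ℝ] H)) {r : ℝ} (hr : 0 < r) :
    ∃ R : H →L[ℝ] V, (∀ x, ι (R x) + r • P (R x) = x) ∧ ∀ v, R (ι v + r • P v) = v := by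
  obtain ⟨c, _, hc, _, hcC⟩ := hP
  let T : V →L[ℝ] H := ι + r • P
  have hT : ∀ v, T v = ι v + r • P v := fun v => rfl
  have hlow : ∀ v, ‖v‖ ≤ (c⁻¹ * (1 + r⁻¹)) * ‖T v‖ := by
    intro v
    have h1 := (hcC v).1
    have h2 := h.norm_sq_add_smul r v
    change ‖T v‖ ^ 2 = _ at h2
    have h3 : ‖ι v‖ ≤ ‖T v‖ := by
      refine (pow_le_pow_iff_left₀ (by positivity) (norm_nonneg _) two_ne_zero).1 ?_
      rw [h2]; nlinarith [sq_nonneg (r * ‖P v‖)]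
    have h4 : r * ‖P v‖ ≤ ‖T v‖ := by
      refine (pow_le_pow_iff_left₀ (by positivity) (norm_nonneg _) two_ne_zero).1 ?_
      rw [h2, mul_pow]
      exact le_add_of_nonneg_left (sq_nonneg _)
    have h5 : ‖P v‖ ≤ r⁻¹ * ‖T v‖ := by
      rw [inv_mul_eq_div, le_div_iff₀ hr]; linarith
    have h6 : c * ‖v‖ ≤ (1 + r⁻¹) * ‖T v‖ := by
      change c * ‖v‖ ≤ ‖ι v‖ + ‖P v‖ at h1
      linarith
    rw [mul_assoc, inv_mul_eq_div, le_div_iff₀ hc]; linarith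
  have hanti : AntilipschitzWith (Real.toNNReal (c⁻¹ * (1 + r⁻¹))) T := by
    refine T.antilipschitz_of_bound fun v => ?_
    rw [Real.coe_toNNReal _ (by positivity)]
    exact hlow v
  have hclosed : IsClosed (range T) := hanti.isClosed_range T.uniformContinuous
  have hker : T.ker = ⊥ := LinearMap.ker_eq_bot.2 hanti.injective
  have hrange : T.range = ⊤ := by
    have : IsClosed (T.range : Set H) := hclosed
    haveI : CompleteSpace T.range := this.completeSpace_coe
    rw [← Submodule.orthogonal_eq_bot_iff, Submodule.eq_bot_iff]
    intro y hy
    exact h.eq_zero_of_orthogonal hr fun v => hy (T v) ⟨v, rfl⟩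
  let e := ContinuousLinearEquiv.ofBijective T hker hrange
  have he : ∀ v, e v = T v := fun v => rfl
  exact ⟨e.symm, fun x => by
    have := e.apply_symm_apply x
    rwa [he, hT] at this, fun v => by
    rw [← hT, ← he]; exact e.symm_apply_apply v⟩

theorem GraphNormEquiv.exists_continuousLinearMap {ι : V →L[ℝ] H} {P : V →ₗ[ℝ] H}
    (hP : GraphNormEquiv ι P) : ∃ P' : V →L[ℝ] H, (P' : V →ₗ[ℝ] H) = P := by
  obtain ⟨_, C, _, _, h⟩ := hP
  exact ⟨P.mkContinuous C fun v => (le_add_of_nonneg_left (norm_nonneg _)).trans (h v).2, by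
    ext; rfl⟩

end SkewAdjoint

/-! ### Accretivity of the Yosida approximations -/

section Yosida

variable {H V : Type*} [NormedAddCommGroup H] [InnerProductSpace ℝ H]
  [NormedAddCommGroup V] [NormedSpace ℝ V]

/-- A bounded operator `P : V → H` on the domain `V ⊆ H` that is skew and has resolvents
`R n = (1 + P / (n + 1))⁻¹`. -/
structure SkewResolvents (ι : V →L[ℝ] H) (P : V →L[ℝ] H) (R : ℕ → (H →L[ℝ] V)) : Prop where
  inner_self : ∀ v, ⟪P v, ι v⟫_ℝ = 0
  apply_resolvent : ∀ n x, ι (R n x) + (1 / ((n : ℝ) + 1)) • P (R n x) = x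
  resolvent_apply : ∀ n v, R n (ι v + (1 / ((n : ℝ) + 1)) • P v) = v

variable {ι : V →L[ℝ] H} {P : V →L[ℝ] H} {R : ℕ → (H →L[ℝ] V)}

/-- As x = R_n x + P R_n x/(n+1) and P is skew, the pairing equals ‖P R_n x‖²/(n+1). -/
theorem SkewResolvents.inner_nonneg (h : SkewResolvents ι P R) (n : ℕ) (x : H) :
    0 ≤ ⟪P (R n x), x⟫_ℝ := by
  have e : ⟪P (R n x), x⟫_ℝ = 1 / ((n : ℝ) + 1) * ⟪P (R n x), P (R n x)⟫_ℝ := by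
    nth_rewrite 2 [← h.apply_resolvent n x]
    rw [inner_add_right, h.inner_self, inner_smul_right, zero_add]
  rw [e]
  exact mul_nonneg (by positivity) real_inner_self_nonneg

/-- Differences of Yosida approximations are almost accretive. -/
theorem SkewResolvents.neg_le_inner_sub (h : SkewResolvents ι P R) (n l : ℕ) {x y : H} {C : ℝ}
    (hx : ‖P (R n x)‖ ≤ C) (hy : ‖P (R l y)‖ ≤ C) :
    -(2 * C ^ 2 * (1 / ((n : ℝ) + 1) + 1 / ((l : ℝ) + 1))) ≤
      ⟪P (R n x) - P (R l y), x - y⟫_ℝ := by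
  have hC : 0 ≤ C := (norm_nonneg _).trans hx
  set ε : ℝ := 1 / ((n : ℝ) + 1) with hε
  set δ : ℝ := 1 / ((l : ℝ) + 1) with hδ
  have hε0 : 0 ≤ ε := by positivity
  have hδ0 : 0 ≤ δ := by positivity
  -- Up to terms that are small with 1/(n+1) and 1/(l+1), x - y is the element on which P is skew.
  have e : x - y = ι (R n x - R l y) + (ε • P (R n x) - δ • P (R l y)) := by
    nth_rewrite 1 [← h.apply_resolvent n x, ← h.apply_resolvent l y]
    rw [map_sub]
    abel
  rw [e, inner_add_right, ← map_sub, h.inner_self, zero_add]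
  have h1 := abs_real_inner_le_norm (P (R n x - R l y)) (ε • P (R n x) - δ • P (R l y))
  have h2 : ‖P (R n x - R l y)‖ ≤ 2 * C := by
    rw [map_sub]; exact (norm_sub_le _ _).trans (by linarith)
  have h3 : ‖ε • P (R n x) - δ • P (R l y)‖ ≤ C * (ε + δ) := by
    refine (norm_sub_le _ _).trans ?_
    rw [norm_smul, norm_smul, Real.norm_eq_abs, Real.norm_eq_abs, abs_of_nonneg hε0,
      abs_of_nonneg hδ0]
    nlinarith [mul_le_mul_of_nonneg_left hx hε0, mul_le_mul_of_nonneg_left hy hδ0]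
  have h4 : ‖P (R n x - R l y)‖ * ‖ε • P (R n x) - δ • P (R l y)‖ ≤ (2 * C) * (C * (ε + δ)) :=
    mul_le_mul h2 h3 (norm_nonneg _) (by positivity)
  have h5 := neg_abs_le ⟪P (R n x - R l y), ε • P (R n x) - δ • P (R l y)⟫_ℝ
  linarith

end Yosida

/-! ### Causally bounded operators and Volterra equations -/

section CausallyBounded

variable {E : Type*} [NormedAddCommGroup E] [NormedSpace ℝ E] {a b : ℝ}

/-- The values of `K u` up to time `t` are controlled, in all exponentially weighted norms, by those
of `u` up to time `t`. -/
def CausallyBounded (κ : ℝ) (K : C(Icc a b, E) → C(Icc a b, E)) : Prop :=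
  ∀ (ν C : ℝ), 0 ≤ ν → 0 ≤ C → ∀ (t : Icc a b) (u : C(Icc a b, E)),
    (∀ s : Icc a b, s ≤ t → ‖u s‖ ≤ C * Real.exp (ν * (s - a))) →
      ‖K u t‖ ≤ κ * (C * Real.exp (ν * (t - a)))

theorem CausallyBounded.add {κ κ' : ℝ} {K K' : C(Icc a b, E) →L[ℝ] C(Icc a b, E)}
    (h : CausallyBounded κ K) (h' : CausallyBounded κ' K') :
    CausallyBounded (κ + κ') (K + K' : C(Icc a b, E) →L[ℝ] C(Icc a b, E)) := by
  intro ν C hν hC t u hu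
  rw [add_mul]
  exact (norm_add_le _ _).trans (add_le_add (h ν C hν hC t u hu) (h' ν C hν hC t u hu))

theorem CausallyBounded.pointwiseOp_comp {κ : ℝ} {K : C(Icc a b, E) →L[ℝ] C(Icc a b, E)}
    (h : CausallyBounded κ K) (A : E →L[ℝ] E) :
    CausallyBounded (‖A‖ * κ) (pointwiseOp E E (Icc a b) A ∘L K) := by
  intro ν C hν hC t u hu
  rw [mul_assoc]
  exact (A.le_opNorm _).trans (by gcongr; exact h ν C hν hC t u hu)

theorem causallyBounded_pointwiseOp (A : E →L[ℝ] E) :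
    CausallyBounded ‖A‖ (pointwiseOp E E (Icc a b) A) := by
  intro ν C hν hC t u hu
  exact (A.le_opNorm _).trans (by gcongr; exact hu t le_rfl)

theorem integral_exp_mul_sub {ν : ℝ} (hν : ν ≠ 0) (t : ℝ) :
    ∫ s in a..t, Real.exp (ν * (s - a)) = (Real.exp (ν * (t - a)) - 1) / ν := by
  have hd : ∀ s, HasDerivAt (fun s => Real.exp (ν * (s - a)) / ν) (Real.exp (ν * (s - a))) s := by
    intro s
    have h1 : HasDerivAt (fun s => ν * (s - a)) ν s := by
      simpa using ((hasDerivAt_id s).sub_const a).const_mul ν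
    exact (h1.exp.div_const ν).congr_deriv (by field_simp)
  rw [intervalIntegral.integral_eq_sub_of_hasDerivAt (fun s _ => hd s)
    (by apply Continuous.intervalIntegrable; fun_prop)]
  simp
  ring

theorem norm_primitive_le_exp (hab : a ≤ b) {ν C : ℝ} (hν : 0 < ν) (hC : 0 ≤ C) (t : Icc a b)
    (u : C(Icc a b, E)) (hu : ∀ s : Icc a b, s ≤ t → ‖u s‖ ≤ C * Real.exp (ν * (s - a))) :
    ‖primitive hab u t‖ ≤ C / ν * Real.exp (ν * (t - a)) := by
  rw [primitive_apply]
  have h1 : ‖∫ s in a..(t : ℝ), IccExtend hab u s‖ ≤ ∫ s in a..(t : ℝ), C * Real.exp (ν * (s - a)) := by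
    refine intervalIntegral.norm_integral_le_of_norm_le t.2.1 ?_ (by
      apply Continuous.intervalIntegrable; fun_prop)
    refine Eventually.of_forall fun s hs => ?_
    rw [iccExtend_apply hab u ⟨hs.1.le, hs.2.trans t.2.2⟩]
    exact hu _ hs.2
  refine h1.trans ?_
  rw [intervalIntegral.integral_const_mul, integral_exp_mul_sub hν.ne', div_mul_eq_mul_div,
    mul_div_assoc]
  gcongr
  linarith

theorem CausallyBounded.isUnit_one_add [CompleteSpace E] (hab : a ≤ b) {κ : ℝ} (hκ : 0 ≤ κ)
    {K : C(Icc a b, E) →L[ℝ] C(Icc a b, E)} (h : CausallyBounded κ K) :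
    IsUnit (1 + K ∘L primitive hab : C(Icc a b, E) →L[ℝ] C(Icc a b, E)) := by
  set T : C(Icc a b, E) →L[ℝ] C(Icc a b, E) := K ∘L primitive hab with hT
  -- In the norm with weight exp(-ν(t - a)) a primitive gains the factor 1/ν, so each application of
  -- `T` contracts by κ/ν < 1/2.
  set ν : ℝ := 2 * κ + 1 with hν
  have hν0 : 0 < ν := by positivity
  have hpow : ∀ (n : ℕ) (u : C(Icc a b, E)) (t : Icc a b),
      ‖(T ^ n) u t‖ ≤ (κ / ν) ^ n * ‖u‖ * Real.exp (ν * (t - a)) := by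
    intro n u
    induction n with
    | zero =>
      intro t
      have h1 : (1 : ℝ) ≤ Real.exp (ν * (t - a)) :=
        Real.one_le_exp (mul_nonneg hν0.le (sub_nonneg.2 t.2.1))
      simp only [pow_zero, one_mul, one_apply_eq_self]
      exact (u.norm_coe_le_norm t).trans (le_mul_of_one_le_right (norm_nonneg _) h1)
    | succ n ih =>
      intro t
      rw [pow_succ', mul_apply_eq_comp, hT, ContinuousLinearMap.comp_apply]
      refine (h ν ((κ / ν) ^ n * ‖u‖ / ν) hν0.le (by positivity) t _ fun s _ =>
        norm_primitive_le_exp hab hν0 (by positivity) s _ fun r _ => ih r).trans_eq ?_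
      ring
  have hq : κ / ν < 1 := by rw [div_lt_one hν0]; linarith
  have hlim : Tendsto (fun n : ℕ => (κ / ν) ^ n * Real.exp (ν * (b - a))) atTop (𝓝 0) := by
    simpa using (tendsto_pow_atTop_nhds_zero_of_lt_one (by positivity) hq).mul_const
      (Real.exp (ν * (b - a)))
  obtain ⟨n, hn⟩ := (hlim.eventually_lt_const one_pos).exists
  have hTn : ‖T ^ n‖ < 1 := by
    refine lt_of_le_of_lt (ContinuousLinearMap.opNorm_le_bound _ (by positivity) fun u => ?_) hn
    rw [ContinuousMap.norm_le _ (by positivity)]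
    intro t
    refine (hpow n u t).trans ?_
    have := t.2.2
    have h2 : Real.exp (ν * (t - a)) ≤ Real.exp (ν * (b - a)) := by gcongr
    calc (κ / ν) ^ n * ‖u‖ * Real.exp (ν * (t - a))
        ≤ (κ / ν) ^ n * ‖u‖ * Real.exp (ν * (b - a)) := by gcongr
      _ = _ := by ring
  have hneg : ‖(-T) ^ n‖ < 1 := by
    rcases Nat.even_or_odd n with he | ho
    · rwa [he.neg_pow]
    · rwa [ho.neg_pow, norm_neg]
  -- In the unweighted norm only a high power of `T` is small. But 1 + T is a factor of 1 - (-T)^n,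
  -- and the cofactor, a geometric sum, commutes with it.
  have hu : IsUnit (1 - (-T) ^ n) := isUnit_one_sub_of_norm_lt_one hneg
  rw [← mul_neg_geom_sum] at hu
  have hc : Commute (1 - (-T)) (∑ i ∈ Finset.range n, (-T) ^ i) :=
    Commute.sum_right _ _ _ fun i _ =>
      ((Commute.one_left _).sub_left (Commute.refl _)).pow_right i
  have := (hc.isUnit_mul_iff.1 hu).1
  rwa [sub_neg_eq_add] at this

end CausallyBounded

/-! ### Causal bounds for the zeroth order part -/

section Convolution

variable {H : Type*} [NormedAddCommGroup H] [InnerProductSpace ℝ H] [CompleteSpace H] {a b : ℝ}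

theorem causallyBounded_causalConv (hab : a ≤ b) (q : ℝ≥0 →ᵇ BSymm H) :
    CausallyBounded (‖q‖ * (b - a)) (causalConv hab q) := by
  intro ν C hν hC t u hu
  rw [causalConv_apply]
  refine (intervalIntegral.norm_integral_le_of_norm_le_const
    (C := ‖q‖ * (C * Real.exp (ν * (t - a)))) fun s hs => ?_).trans ?_
  · rw [uIoc_of_le t.2.1] at hs
    refine (norm_kernel_integrand_le hab q u t s).trans ?_
    rw [iccExtend_apply hab u ⟨hs.1.le, hs.2.trans t.2.2⟩]
    have := hs.2
    gcongr
    refine (hu ⟨s, _⟩ hs.2).trans ?_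
    gcongr
  · rw [abs_of_nonneg (sub_nonneg.2 t.2.1), mul_right_comm]
    have := t.2.2
    gcongr

/-- The size of the zeroth order part on an interval of length `b - a`. -/
noncomputable def lowerOrderBound (a b : ℝ) (m : CoeffSpace H) : ℝ :=
  ‖m.opB‖ + ‖m.snd.snd.1.2‖ * (b - a)

theorem lowerOrderBound_nonneg (hab : a ≤ b) (m : CoeffSpace H) : 0 ≤ lowerOrderBound a b m := by
  have := sub_nonneg.2 hab
  unfold lowerOrderBound
  positivity

theorem causallyBounded_lowerOrderOp (hab : a ≤ b) (m : CoeffSpace H) :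
    CausallyBounded (lowerOrderBound a b m) (lowerOrderOp hab m) :=
  (causallyBounded_pointwiseOp m.opB).add (causallyBounded_causalConv hab m.snd.snd.1.2)

end Convolution

/-! ### The energy estimate -/

section Energy

variable {H : Type*} [NormedAddCommGroup H] [InnerProductSpace ℝ H] [CompleteSpace H] {a b : ℝ}

/-- This is the integrated identity (d/dt)⟨A u, u⟩ = 2⟨A u', u⟩, valid because A is self-adjoint and
constant in time, with u(a) = 0. -/
theorem inner_primitive_self (hab : a ≤ b) {A : H →L[ℝ] H} (hA : IsSelfAdjoint A)
    (v : C(Icc a b, H)) (t : Icc a b) :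
    ⟪A (primitive hab v t), primitive hab v t⟫_ℝ = 2 * ∫ s in a..(t : ℝ),
      ⟪A (IccExtend hab v s), IccExtend hab (primitive hab v) s⟫_ℝ := by
  set w : ℝ → H := fun t => ∫ s in a..t, IccExtend hab v s with hw
  have hv := continuous_iccExtend hab v
  have hd : ∀ s, HasDerivAt w (IccExtend hab v s) s := fun s =>
    intervalIntegral.integral_hasDerivAt_right (hv.intervalIntegrable _ _)
      hv.stronglyMeasurable.stronglyMeasurableAtFilter hv.continuousAt
  have hwc : Continuous w := continuous_iff_continuousAt.2 fun s => (hd s).continuousAt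
  have hd2 : ∀ s, HasDerivAt (fun s => ⟪A (w s), w s⟫_ℝ) (2 * ⟪A (IccExtend hab v s), w s⟫_ℝ) s := by
    intro s
    have h1 : HasDerivAt (fun s => A (w s)) (A (IccExtend hab v s)) s :=
      A.hasFDerivAt.comp_hasDerivAt s (hd s)
    refine (h1.inner ℝ (hd s)).congr_deriv ?_
    have : ⟪A (w s), IccExtend hab v s⟫_ℝ = ⟪A (IccExtend hab v s), w s⟫_ℝ := by
      rw [real_inner_comm]
      have := (ContinuousLinearMap.isSelfAdjoint_iff_isSymmetric.1 hA) (IccExtend hab v s) (w s)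
      exact this.symm
    rw [this]; ring
  have hFTC := intervalIntegral.integral_eq_sub_of_hasDerivAt (a := a) (b := t) (fun s _ => hd2 s)
    (by apply Continuous.intervalIntegrable; fun_prop)
  have hwa : w a = 0 := by simp [hw]
  rw [hwa, inner_zero_right, sub_zero, intervalIntegral.integral_const_mul] at hFTC
  rw [primitive_apply, ← hFTC]
  congr 1
  refine intervalIntegral.integral_congr fun s hs => ?_
  rw [uIcc_of_le t.2.1] at hs
  rw [iccExtend_apply hab (primitive hab v) ⟨hs.1, hs.2.trans t.2.2⟩, primitive_apply]

/-- The energy estimate, in an exponentially weighted supremum norm. -/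
theorem energy_estimate (hab : a ≤ b) {A : H →L[ℝ] H} (hA : IsSelfAdjoint A) {c β ε : ℝ}
    (hc : 0 < c) (hβ : 0 ≤ β) (hε : 0 ≤ ε) (hcA : ∀ x, c * ‖x‖ ^ 2 ≤ ⟪A x, x⟫_ℝ)
    (v : C(Icc a b, H)) {p : ℝ → ℝ} (hp : Continuous p) (hp0 : ∀ s, 0 ≤ p s)
    (h : ∀ (t : Icc a b) (ν C : ℝ), 0 ≤ ν → 0 ≤ C →
      (∀ s : Icc a b, s ≤ t → ‖primitive hab v s‖ ≤ C * Real.exp (ν * (s - a))) →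
      ⟪A (v t), primitive hab v t⟫_ℝ ≤ p t * ‖primitive hab v t‖ + ε
        + β * (C * Real.exp (ν * (t - a))) * ‖primitive hab v t‖) :
    ∃ N, 0 ≤ N ∧ (∀ t, ‖primitive hab v t‖ ≤ N * Real.exp ((4 * β / c + 1) * (t - a))) ∧
      c / 4 * N ^ 2 ≤ N * (∫ s in a..b, p s) + ε * (b - a) := by
  -- With 4β/c ≤ ν the history term contributes at most c/8 of the squared norm and is absorbed on
  -- the left; the summand 1 keeps ν positive when β = 0.
  set ν : ℝ := 4 * β / c + 1 with hν
  have hν0 : 0 < ν := by positivity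
  set u := primitive hab v with hu
  haveI : Nonempty (Icc a b) := ⟨⟨a, le_rfl, hab⟩⟩
  -- The energy identity is used only at a maximum point t of the weighted norm. There ‖u(t)‖ = N e
  -- exactly, while N controls the whole history on [a, t], which is what the memory term needs.
  obtain ⟨t, -, ht⟩ := isCompact_univ.exists_isMaxOn (s := (univ : Set (Icc a b))) univ_nonempty
    (f := fun t : Icc a b => ‖u t‖ * Real.exp (-(ν * (t - a)))) (by fun_prop)
  set N : ℝ := ‖u t‖ * Real.exp (-(ν * (t - a))) with hN
  have hN0 : 0 ≤ N := by positivity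
  have hbd : ∀ s : Icc a b, ‖u s‖ ≤ N * Real.exp (ν * (s - a)) := by
    intro s
    have h1 : ‖u s‖ * Real.exp (-(ν * (s - a))) ≤ N := ht (mem_univ s)
    have h2 : ‖u s‖ = ‖u s‖ * Real.exp (-(ν * (s - a))) * Real.exp (ν * (s - a)) := by
      rw [mul_assoc, ← Real.exp_add]; simp
    rw [h2]
    gcongr
  refine ⟨N, hN0, hbd, ?_⟩
  set e : ℝ := Real.exp (ν * (t - a)) with he
  have he1 : 1 ≤ e := Real.one_le_exp (mul_nonneg hν0.le (sub_nonneg.2 t.2.1))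
  have hut : ‖u t‖ = N * e := by
    rw [hN, he, mul_assoc, ← Real.exp_add]; simp
  have hI : ∫ s in a..(t : ℝ), ⟪A (IccExtend hab v s), IccExtend hab u s⟫_ℝ ≤
      ∫ s in a..(t : ℝ), (p s * (N * e) + ε + β * N ^ 2 * Real.exp (2 * ν * (s - a))) := by
    have hv := continuous_iccExtend hab v
    have huc := continuous_iccExtend hab u
    refine intervalIntegral.integral_mono_on t.2.1 ?_ ?_ fun s hs => ?_
    · apply Continuous.intervalIntegrable; fun_prop
    · apply Continuous.intervalIntegrable; fun_prop
    · have hs' : s ∈ Icc a b := ⟨hs.1, hs.2.trans t.2.2⟩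
      rw [iccExtend_apply hab v hs', iccExtend_apply hab u hs']
      refine (h ⟨s, hs'⟩ ν N hν0.le hN0 fun r _ => hbd r).trans ?_
      have h1 := hbd ⟨s, hs'⟩
      simp only at h1 ⊢
      have h2 : N * Real.exp (ν * (s - a)) ≤ N * e := by
        have := hs.2
        rw [he]
        gcongr
      have h3 : Real.exp (2 * ν * (s - a)) = Real.exp (ν * (s - a)) * Real.exp (ν * (s - a)) := by
        rw [← Real.exp_add]; congr 1; ring
      have h4 : p s * ‖u ⟨s, hs'⟩‖ ≤ p s * (N * e) :=
        mul_le_mul_of_nonneg_left (h1.trans h2) (hp0 s)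
      have h5 : β * (N * Real.exp (ν * (s - a))) * ‖u ⟨s, hs'⟩‖ ≤
          β * (N * Real.exp (ν * (s - a))) * (N * Real.exp (ν * (s - a))) :=
        mul_le_mul_of_nonneg_left h1 (by positivity)
      rw [h3]
      nlinarith
  have hJ : ∫ s in a..(t : ℝ), (p s * (N * e) + ε + β * N ^ 2 * Real.exp (2 * ν * (s - a))) =
      (∫ s in a..(t : ℝ), p s) * (N * e) + ε * (t - a) + β * N ^ 2 * ((e ^ 2 - 1) / (2 * ν)) := by
    rw [intervalIntegral.integral_add, intervalIntegral.integral_add,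
      intervalIntegral.integral_mul_const, intervalIntegral.integral_const_mul,
      integral_exp_mul_sub (by positivity)]
    · have : Real.exp (2 * ν * (t - a)) = e ^ 2 := by
        rw [he, ← Real.exp_nat_mul]; congr 1; push_cast; ring
      rw [this]
      simp
      ring
    all_goals apply Continuous.intervalIntegrable; fun_prop
  have hE := inner_primitive_self hab hA v t
  have hlow := hcA (u t)
  rw [hE] at hlow
  have hP : ∫ s in a..(t : ℝ), p s ≤ ∫ s in a..b, p s :=
    intervalIntegral.integral_mono_interval le_rfl t.2.1 t.2.2
      (Eventually.of_forall fun s => hp0 s) (hp.intervalIntegrable _ _)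
  have hP0 : 0 ≤ ∫ s in a..(t : ℝ), p s :=
    intervalIntegral.integral_nonneg t.2.1 fun s _ => hp0 s
  set I := ∫ s in a..b, p s
  set I' := ∫ s in a..(t : ℝ), p s
  have hβν : β * ((e ^ 2 - 1) / (2 * ν)) ≤ c / 8 * e ^ 2 := by
    have h1 : β ≤ c / 4 * ν := by
      rw [hν]; field_simp; nlinarith
    have h2 : β * ((e ^ 2 - 1) / (2 * ν)) ≤ (c / 4 * ν) * (e ^ 2 / (2 * ν)) := by
      have : 0 ≤ e ^ 2 - 1 := by nlinarith
      gcongr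
      linarith
    refine h2.trans_eq ?_
    field_simp
    ring
  have hmain : c * (N * e) ^ 2 ≤ 2 * (I * (N * e) + ε * (b - a) + c / 8 * e ^ 2 * N ^ 2) := by
    rw [← hut]
    refine hlow.trans ?_
    rw [hut]
    have h1 : I' * (N * e) ≤ I * (N * e) := by gcongr
    have h2 : ε * (t - a) ≤ ε * (b - a) := by have := t.2.2; gcongr
    have h3 : β * N ^ 2 * ((e ^ 2 - 1) / (2 * ν)) ≤ c / 8 * e ^ 2 * N ^ 2 := by
      calc β * N ^ 2 * ((e ^ 2 - 1) / (2 * ν)) = β * ((e ^ 2 - 1) / (2 * ν)) * N ^ 2 := by ring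
        _ ≤ _ := by gcongr
    linarith [hI.trans_eq hJ]
  have hI0 : 0 ≤ I := hP0.trans hP
  have he2 : 1 ≤ e ^ 2 := by nlinarith
  have hee : e ≤ e ^ 2 := by nlinarith
  have k1 : I * (N * e) ≤ (I * N) * e ^ 2 := by
    rw [← mul_assoc]; gcongr
  have k2 : ε * (b - a) ≤ ε * (b - a) * e ^ 2 :=
    le_mul_of_one_le_right (mul_nonneg hε (sub_nonneg.2 hab)) he2
  -- Since e ≥ 1, every term can be compared with a multiple of e², which then cancels; the final
  -- constant does not depend on where the maximum lies.
  have hfin : (c / 4 * N ^ 2) * e ^ 2 ≤ (N * I + ε * (b - a)) * e ^ 2 := by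
    have : 0 ≤ c * N ^ 2 * e ^ 2 := by positivity
    nlinarith
  exact le_of_mul_le_mul_right hfin (by positivity)

end Energy

/-! ### Strong limits of bounded operators -/

theorem exists_strong_limit {X Y : Type*} [NormedAddCommGroup X] [NormedSpace ℝ X]
    [CompleteSpace X] [NormedAddCommGroup Y] [NormedSpace ℝ Y] [CompleteSpace Y] (T : ℕ → X →L[ℝ] Y) {C : ℝ}
    (hC : ∀ n x, ‖T n x‖ ≤ C * ‖x‖) (hC0 : 0 ≤ C) {D : Set X} (hD : Dense D)
    (h : ∀ x ∈ D, CauchySeq fun n => T n x) :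
    ∃ L : X →L[ℝ] Y, ∀ x, Tendsto (fun n => T n x) atTop (𝓝 (L x)) := by
  have hcauchy : ∀ x, CauchySeq fun n => T n x := by
    intro x
    rw [Metric.cauchySeq_iff']
    intro ε hε
    obtain ⟨y, hyD, hy⟩ := hD.exists_dist_lt x (show 0 < ε / (3 * (C + 1)) by positivity)
    obtain ⟨N, hN⟩ := Metric.cauchySeq_iff'.1 (h y hyD) (ε / 3) (by positivity)
    refine ⟨N, fun n hn => ?_⟩
    have h1 : ∀ k, dist (T k x) (T k y) < ε / 3 := by
      intro k
      rw [dist_eq_norm, ← map_sub]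
      rw [dist_eq_norm] at hy
      calc ‖T k (x - y)‖ ≤ C * ‖x - y‖ := hC k _
        _ ≤ (C + 1) * ‖x - y‖ := by gcongr; linarith
        _ < (C + 1) * (ε / (3 * (C + 1))) := by gcongr
        _ = ε / 3 := by field_simp
    calc dist (T n x) (T N x) ≤ dist (T n x) (T n y) + dist (T n y) (T N y) + dist (T N y) (T N x) :=
          dist_triangle4 _ _ _ _
      _ < ε / 3 + ε / 3 + ε / 3 := by
          have := h1 N
          rw [dist_comm] at this
          linarith [h1 n, hN n hn]
      _ = ε := by ring
  choose L hL using fun x => cauchySeq_tendsto_of_complete (hcauchy x)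
  refine ⟨continuousLinearMapOfTendsto T (f := L) (tendsto_pi_nhds.2 hL), hL⟩

theorem norm_strong_limit_le {X Y : Type*} [NormedAddCommGroup X] [NormedSpace ℝ X]
    [NormedAddCommGroup Y] [NormedSpace ℝ Y] {T : ℕ → X →L[ℝ] Y} {L : X →L[ℝ] Y} {C : ℝ}
    (hC : ∀ n x, ‖T n x‖ ≤ C * ‖x‖) (h : ∀ x, Tendsto (fun n => T n x) atTop (𝓝 (L x))) (x : X) :
    ‖L x‖ ≤ C * ‖x‖ :=
  le_of_tendsto (h x).norm (Eventually.of_forall fun n => hC n x)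

/-- Strong convergence alone does not allow the argument to vary; the uniform bound does. It is used
to pass to the limit in products of solution operators. -/
theorem tendsto_comp_strong_limit {X Y : Type*} [NormedAddCommGroup X] [NormedSpace ℝ X]
    [NormedAddCommGroup Y] [NormedSpace ℝ Y] {T : ℕ → X →L[ℝ] Y} {L : X →L[ℝ] Y} {C : ℝ}
    (hC : ∀ n x, ‖T n x‖ ≤ C * ‖x‖) (h : ∀ x, Tendsto (fun n => T n x) atTop (𝓝 (L x)))
    {x : ℕ → X} {y : X} (hx : Tendsto x atTop (𝓝 y)) :
    Tendsto (fun n => T n (x n)) atTop (𝓝 (L y)) := by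
  have h1 : Tendsto (fun n => T n (x n - y)) atTop (𝓝 0) := by
    refine squeeze_zero_norm (fun n => hC n _) ?_
    simpa using ((hx.sub_const y).norm).const_mul C
  have h2 := h1.add (h y)
  simp only [map_sub, sub_add_cancel, zero_add] at h2
  exact h2

/-! ### Yosida approximations of the evolution problem -/

section Approximation

variable {H V : Type*} [NormedAddCommGroup H] [InnerProductSpace ℝ H] [CompleteSpace H]
  [NormedAddCommGroup V] [NormedSpace ℝ V] {a b : ℝ}

theorem CoeffSpace.isSelfAdjoint_opA (m : CoeffSpace H) : IsSelfAdjoint m.opA := m.fst.2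

/-- The coefficient `A` of `m` is bounded below by `c`. -/
def CoerciveWith (c : ℝ) (m : CoeffSpace H) : Prop := ∀ x : H, c * ‖x‖ ^ 2 ≤ ⟪m.opA x, x⟫_ℝ

/-- As in Lax–Milgram: coercivity gives injectivity and closed range, and a vector orthogonal to the
range is annihilated by the form. -/
theorem CoerciveWith.exists_inverse {c : ℝ} (hc : 0 < c) {m : CoeffSpace H}
    (h : CoerciveWith c m) :
    ∃ A' : H →L[ℝ] H, m.opA ∘L A' = 1 ∧ A' ∘L m.opA = 1 := by
  set T := m.opA with hT
  have hlow : ∀ x, ‖x‖ ≤ c⁻¹ * ‖T x‖ := by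
    intro x
    rcases eq_or_ne x 0 with rfl | hx
    · simp
    have h1 := (h x).trans (real_inner_le_norm _ _)
    have h2 : 0 < ‖x‖ := norm_pos_iff.2 hx
    rw [inv_mul_eq_div, le_div_iff₀ hc]
    nlinarith
  have hanti : AntilipschitzWith (Real.toNNReal c⁻¹) T := by
    refine T.antilipschitz_of_bound fun v => ?_
    rw [Real.coe_toNNReal _ (by positivity)]
    exact hlow v
  have hclosed : IsClosed (range T) := hanti.isClosed_range T.uniformContinuous
  have hker : T.ker = ⊥ := LinearMap.ker_eq_bot.2 hanti.injective
  have hrange : T.range = ⊤ := by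
    have : IsClosed (T.range : Set H) := hclosed
    haveI : CompleteSpace T.range := this.completeSpace_coe
    rw [← Submodule.orthogonal_eq_bot_iff, Submodule.eq_bot_iff]
    intro y hy
    have h1 := h y
    rw [show ⟪m.opA y, y⟫_ℝ = 0 from hy (T y) ⟨y, rfl⟩] at h1
    have h2 : ‖y‖ ^ 2 ≤ 0 := by nlinarith [sq_nonneg ‖y‖]
    simpa using le_antisymm h2 (sq_nonneg _)
  let e := ContinuousLinearEquiv.ofBijective T hker hrange
  refine ⟨e.symm, ?_, ?_⟩
  · ext x; exact e.apply_symm_apply x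
  · ext x; exact e.symm_apply_apply x

/-- The evolution operator on `[a, b]`, applied to the primitive of a function, with the unbounded
operator replaced by a bounded operator `K`. -/
noncomputable def approxOp (hab : a ≤ b) (K : H →L[ℝ] H) (m : CoeffSpace H) :
    C(Icc a b, H) →L[ℝ] C(Icc a b, H) :=
  bulkOp hab m + pointwiseOp H H _ K ∘L primitive hab

theorem approxOp_apply (hab : a ≤ b) (K : H →L[ℝ] H) (m : CoeffSpace H) (v : C(Icc a b, H)) :
    approxOp hab K m v = pointwiseOp H H _ m.opA v + lowerOrderOp hab m (primitive hab v) +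
      pointwiseOp H H _ K (primitive hab v) := rfl

theorem primitive_approxOp (hab : a ≤ b) (K : H →L[ℝ] H) (m : CoeffSpace H) (v : C(Icc a b, H)) :
    primitive hab (approxOp hab K m v) = approxOp hab K m (primitive hab v) := by
  simp only [approxOp_apply, map_add, primitive_pointwiseOp, primitive_lowerOrderOp]

/-- The operator factors as A (1 + A⁻¹(B + Q* + K) J), and the second factor is a Volterra
perturbation of the identity. -/
theorem CoerciveWith.isUnit_approxOp {c : ℝ} (hc : 0 < c) {m : CoeffSpace H}
    (h : CoerciveWith c m) (hab : a ≤ b) (K : H →L[ℝ] H) : IsUnit (approxOp hab K m) := by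
  obtain ⟨A', h1, h2⟩ := h.exists_inverse hc
  have hA : IsUnit (pointwiseOp H H (Icc a b) m.opA) := by
    refine ⟨⟨pointwiseOp H H (Icc a b) m.opA, pointwiseOp H H (Icc a b) A', ?_, ?_⟩, rfl⟩
    · ext u t; exact DFunLike.congr_fun h1 (u t)
    · ext u t; exact DFunLike.congr_fun h2 (u t)
  have hK := (((causallyBounded_lowerOrderOp hab m).add
    (causallyBounded_pointwiseOp K)).pointwiseOp_comp A').isUnit_one_add hab
      (by have := lowerOrderBound_nonneg hab m; positivity)
  convert hA.mul hK using 1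
  ext v t
  have h3 : ∀ x, m.opA (A' x) = x := fun x => DFunLike.congr_fun h1 x
  rw [mul_apply_eq_comp]
  simp only [approxOp_apply, ContinuousMap.add_apply, pointwiseOp_apply, add_apply,
    one_apply_eq_self, ContinuousLinearMap.comp_apply, map_add, h3]
  abel

/-- The solution operator of the approximate evolution problem. -/
noncomputable def approxSol (hab : a ≤ b) (K : H →L[ℝ] H) (m : CoeffSpace H) :
    L1Icc H a b →L[ℝ] C(Icc a b, H) :=
  Ring.inverse (approxOp hab K m) ∘L primitiveL1 H a b

variable {K : H →L[ℝ] H} {c : ℝ} {m : CoeffSpace H}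

theorem CoerciveWith.approxOp_inverse (hc : 0 < c) (h : CoerciveWith c m) (hab : a ≤ b)
    (u : C(Icc a b, H)) : approxOp hab K m (Ring.inverse (approxOp hab K m) u) = u :=
  DFunLike.congr_fun (Ring.mul_inverse_cancel _ (h.isUnit_approxOp hc hab K)) u

theorem CoerciveWith.inverse_approxOp (hc : 0 < c) (h : CoerciveWith c m) (hab : a ≤ b)
    (u : C(Icc a b, H)) : Ring.inverse (approxOp hab K m) (approxOp hab K m u) = u :=
  DFunLike.congr_fun (Ring.inverse_mul_cancel _ (h.isUnit_approxOp hc hab K)) u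

theorem CoerciveWith.primitive_inverse (hc : 0 < c) (h : CoerciveWith c m) (hab : a ≤ b)
    (u : C(Icc a b, H)) : primitive hab (Ring.inverse (approxOp hab K m) u) =
      Ring.inverse (approxOp hab K m) (primitive hab u) := by
  rw [← h.inverse_approxOp hc hab (K := K) (primitive hab (Ring.inverse (approxOp hab K m) u)),
    ← primitive_approxOp, h.approxOp_inverse hc]

/-- For continuous data the solution is itself a primitive, so its derivative is available for the
energy estimate. -/
theorem CoerciveWith.approxSol_toL1 (hc : 0 < c) (h : CoerciveWith c m) (hab : a ≤ b)
    (u : C(Icc a b, H)) : approxSol hab K m (toL1Icc hab u) =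
      primitive hab (Ring.inverse (approxOp hab K m) u) := by
  rw [h.primitive_inverse hc]
  rfl

theorem CoerciveWith.approxSol_primitive (hc : 0 < c) (h : CoerciveWith c m) (hab : a ≤ b)
    (x : L1Icc H a b) : approxSol hab K m (toL1Icc hab (primitiveL1 H a b x)) =
      primitive hab (approxSol hab K m x) :=
  (h.primitive_inverse hc hab (primitiveL1 H a b x)).symm

/-- The second resolvent identity. -/
theorem CoerciveWith.approxSol_sub (hc : 0 < c) (h : CoerciveWith c m) {c' : ℝ} (hc' : 0 < c')
    {m' : CoeffSpace H} (h' : CoerciveWith c' m') (hab : a ≤ b) (x : L1Icc H a b) :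
    primitive hab (approxSol hab K m' x) - primitive hab (approxSol hab K m x) =
      -approxSol hab K m' (toL1Icc hab (bulkOp hab (m' - m) (approxSol hab K m x))) := by
  -- The operators for m and m' differ by a term free of K, so the identity survives when K tends to
  -- the unbounded operator.
  have e : ∀ u, approxOp hab K m' u = approxOp hab K m u + bulkOp hab (m' - m) u := by
    intro u
    rw [map_sub, sub_apply, approxOp, approxOp, add_apply, add_apply]
    abel
  have h1 : approxOp hab K m (approxSol hab K m x) = primitiveL1 H a b x :=
    h.approxOp_inverse hc hab _
  have h2 : approxOp hab K m' (approxSol hab K m' x) = primitiveL1 H a b x :=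
    h'.approxOp_inverse hc' hab _
  have h3 : approxOp hab K m' (approxSol hab K m' x - approxSol hab K m x) =
      -bulkOp hab (m' - m) (approxSol hab K m x) := by
    rw [map_sub, h2, e, h1]
    abel
  rw [← map_sub, ← h'.inverse_approxOp hc' hab (K := K) (approxSol hab K m' x - approxSol hab K m x),
    h3, map_neg, map_neg, h'.approxSol_toL1 hc']

/-- The bound for the solution operators on `[a, b]`. -/
noncomputable def solBound (a b c β : ℝ) : ℝ := 4 / c * Real.exp ((4 * β / c + 1) * (b - a))

theorem solBound_nonneg {c β : ℝ} (hc : 0 < c) : 0 ≤ solBound a b c β := by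
  unfold solBound; positivity

/-- The energy estimate with source p = ‖u‖ and ε = 0; K only contributes a term of favourable sign.
The factor 4/c comes from dividing (c/4) N² ≤ N ‖u‖ by N, the exponential from removing the weight.
-/
theorem CoerciveWith.norm_approxSol_toL1_le (hc : 0 < c) (h : CoerciveWith c m) (hab : a ≤ b)
    (hK : ∀ x, 0 ≤ ⟪K x, x⟫_ℝ) {β : ℝ} (hβ : lowerOrderBound a b m ≤ β) (u : C(Icc a b, H)) :
    ‖approxSol hab K m (toL1Icc hab u)‖ ≤ solBound a b c β * ‖toL1Icc hab u‖ := by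
  rw [h.approxSol_toL1 hc]
  set v := Ring.inverse (approxOp hab K m) u with hv
  have hβ0 := (lowerOrderBound_nonneg hab m).trans hβ
  have heq : approxOp hab K m v = u := h.approxOp_inverse hc hab u
  obtain ⟨N, hN0, hN, hNI⟩ := energy_estimate hab m.isSelfAdjoint_opA hc hβ0 le_rfl h v
    (p := fun s => ‖IccExtend hab u s‖) (continuous_iccExtend hab u).norm (fun s => norm_nonneg _)
    (fun t ν C hν hC hb => by
      have h1 : m.opA (v t) = u t - lowerOrderOp hab m (primitive hab v) t -
          K (primitive hab v t) := by
        rw [← heq, approxOp_apply]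
        simp only [ContinuousMap.add_apply, pointwiseOp_apply]
        abel
      rw [h1, inner_sub_left, inner_sub_left, iccExtend_apply hab u t.2]
      have h2 := causallyBounded_lowerOrderOp hab m ν C hν hC t _ hb
      have h3 := real_inner_le_norm (u t) (primitive hab v t)
      have h4 := neg_le_of_abs_le
        (abs_real_inner_le_norm (lowerOrderOp hab m (primitive hab v) t) (primitive hab v t))
      have h5 : ‖lowerOrderOp hab m (primitive hab v) t‖ * ‖primitive hab v t‖ ≤
          β * (C * Real.exp (ν * (t - a))) * ‖primitive hab v t‖ := by
        gcongr
        exact h2.trans (by gcongr)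
      linarith [hK (primitive hab v t)])
  rw [zero_mul, add_zero, ← norm_toL1Icc] at hNI
  have hN' : N ≤ 4 / c * ‖toL1Icc hab u‖ := by
    rcases hN0.eq_or_lt with h0 | h0
    · rw [← h0]; positivity
    · rw [div_mul_eq_mul_div, le_div_iff₀ hc]
      nlinarith
  rw [ContinuousMap.norm_le _ (by have := solBound_nonneg (a := a) (b := b) (β := β) hc; positivity)]
  intro t
  refine (hN t).trans ?_
  rw [solBound, mul_right_comm]
  have := t.2.2
  gcongr

theorem CoerciveWith.norm_approxSol_le (hc : 0 < c) (h : CoerciveWith c m) (hab : a ≤ b)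
    (hK : ∀ x, 0 ≤ ⟪K x, x⟫_ℝ) {β : ℝ} (hβ : lowerOrderBound a b m ≤ β) (x : L1Icc H a b) :
    ‖approxSol hab K m x‖ ≤ solBound a b c β * ‖x‖ := by
  refine (denseRange_toL1Icc hab).induction_on (p := fun x =>
    ‖approxSol hab K m x‖ ≤ solBound a b c β * ‖x‖) x ?_ fun u => ?_
  · exact isClosed_le (by fun_prop) (by fun_prop)
  · exact h.norm_approxSol_toL1_le hc hab hK hβ u

end Approximation

/-! ### The solution operator of the evolution problem -/

section SolutionOperator

variable {H V : Type*} [NormedAddCommGroup H] [InnerProductSpace ℝ H] [CompleteSpace H]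
  [NormedAddCommGroup V] [NormedSpace ℝ V] {a b : ℝ}
  {ι : V →L[ℝ] H} {P : V →L[ℝ] H} {R : ℕ → (H →L[ℝ] V)} {c : ℝ} {m : CoeffSpace H}

theorem CoerciveWith.yosida_apply (hc : 0 < c) (h : CoerciveWith c m) (hab : a ≤ b) (n : ℕ)
    (g : C(Icc a b, H)) :
    pointwiseOp H H _ (P ∘L R n) (primitive hab (approxSol hab (P ∘L R n) m (toL1Icc hab g))) =
      primitive hab g - bulkOp hab m (approxSol hab (P ∘L R n) m (toL1Icc hab g)) := by
  set K := P ∘L R n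
  have h1 : approxOp hab K m (approxSol hab K m (toL1Icc hab g)) = primitive hab g :=
    h.approxOp_inverse hc hab _
  rw [← h1, approxOp, add_apply, add_sub_cancel_left]
  rfl

/-- For data J g the solutions are J v_n with v_n bounded, and the equation then bounds P R_n J v_n
uniformly in n. Differences of Yosida approximations are therefore accretive up to O(1/(n+1) +
1/(l+1)), and the energy estimate converts this error into a norm bound. -/
theorem CoerciveWith.cauchySeq_approxSol (hc : 0 < c) (h : CoerciveWith c m)
    (hR : SkewResolvents ι P R) (hab : a ≤ b) (g : C(Icc a b, H)) :
    CauchySeq fun n => approxSol hab (P ∘L R n) m (toL1Icc hab (primitive hab g)) := by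
  set v : ℕ → C(Icc a b, H) := fun n => approxSol hab (P ∘L R n) m (toL1Icc hab g) with hv
  have hw : ∀ n, approxSol hab (P ∘L R n) m (toL1Icc hab (primitive hab g)) = primitive hab (v n) :=
    fun n => h.approxSol_primitive hc hab _
  simp_rw [hw]
  set β := lowerOrderBound a b m with hβdef
  have hβ0 : 0 ≤ β := lowerOrderBound_nonneg hab m
  set D : ℝ := ‖primitive hab g‖ + ‖bulkOp hab m‖ * (solBound a b c β * ‖toL1Icc hab g‖) with hD
  have hvn : ∀ n, ‖v n‖ ≤ solBound a b c β * ‖toL1Icc hab g‖ := fun n =>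
    h.norm_approxSol_le hc hab (hR.inner_nonneg n) le_rfl _
  have hPn : ∀ n t, P (R n (primitive hab (v n) t)) =
      primitive hab g t - bulkOp hab m (v n) t := fun n t =>
    DFunLike.congr_fun (h.yosida_apply hc hab n g) t
  have hPb : ∀ n t, ‖P (R n (primitive hab (v n) t))‖ ≤ D := by
    intro n t
    rw [hPn]
    refine (norm_sub_le _ _).trans (add_le_add ((primitive hab g).norm_coe_le_norm t) ?_)
    refine ((bulkOp hab m (v n)).norm_coe_le_norm t).trans ?_
    exact ((bulkOp hab m).le_opNorm _).trans (by gcongr; exact hvn n)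
  set W : ℝ := Real.exp ((4 * β / c + 1) * (b - a)) with hW
  have hba : 0 ≤ b - a := sub_nonneg.2 hab
  -- The source is zero and only the accretivity defect remains; since n ≤ l it is at most ε =
  -- 4D²/(n+1), so the distance is of order (n+1)^(-1/2).
  have hest : ∀ n l, n ≤ l → dist (primitive hab (v n)) (primitive hab (v l)) ≤
      Real.sqrt (4 / c * (4 * D ^ 2 * (1 / ((n : ℝ) + 1))) * (b - a)) * W := by
    intro n l hnl
    rw [dist_eq_norm, ← map_sub]
    have hnl' : 1 / ((l : ℝ) + 1) ≤ 1 / ((n : ℝ) + 1) := by gcongr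
    obtain ⟨N, hN0, hN, hNI⟩ := energy_estimate hab m.isSelfAdjoint_opA hc hβ0
      (ε := 4 * D ^ 2 * (1 / ((n : ℝ) + 1))) (by positivity) h (v n - v l)
      (p := fun _ => 0) continuous_const (fun _ => le_rfl)
      (fun t ν C hν hC hb => by
        have e1 := hPn n t
        have e2 := hPn l t
        rw [bulkOp_apply, ContinuousMap.add_apply, pointwiseOp_apply] at e1 e2
        have h1 : m.opA ((v n - v l) t) = - lowerOrderOp hab m (primitive hab (v n - v l)) t -
            (P (R n (primitive hab (v n) t)) - P (R l (primitive hab (v l) t))) := by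
          rw [e1, e2, ContinuousMap.sub_apply]
          simp only [map_sub, ContinuousMap.sub_apply]
          abel
        rw [h1, inner_sub_left, inner_neg_left]
        have h2 := causallyBounded_lowerOrderOp hab m ν C hν hC t _ hb
        have h3 := hR.neg_le_inner_sub n l (hPb n t) (hPb l t)
        have h4 := neg_le_of_abs_le (abs_real_inner_le_norm
          (lowerOrderOp hab m (primitive hab (v n - v l)) t) (primitive hab (v n - v l) t))
        have h5 : ‖lowerOrderOp hab m (primitive hab (v n - v l)) t‖ *
            ‖primitive hab (v n - v l) t‖ ≤
            β * (C * Real.exp (ν * (t - a))) * ‖primitive hab (v n - v l) t‖ := by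
          gcongr
        have h6 : primitive hab (v n - v l) t = primitive hab (v n) t - primitive hab (v l) t := by
          rw [map_sub]; rfl
        rw [← h6] at h3
        have h7 : 2 * D ^ 2 * (1 / ((n : ℝ) + 1) + 1 / ((l : ℝ) + 1)) ≤
            4 * D ^ 2 * (1 / ((n : ℝ) + 1)) := by nlinarith [sq_nonneg D]
        linarith)
    rw [intervalIntegral.integral_zero, mul_zero, zero_add] at hNI
    have hN' : N ≤ Real.sqrt (4 / c * (4 * D ^ 2 * (1 / ((n : ℝ) + 1))) * (b - a)) := by
      apply Real.le_sqrt_of_sq_le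
      calc N ^ 2 = 4 / c * (c / 4 * N ^ 2) := by field_simp
        _ ≤ 4 / c * (4 * D ^ 2 * (1 / ((n : ℝ) + 1)) * (b - a)) := by gcongr
        _ = _ := by ring
    rw [ContinuousMap.norm_le _ (by positivity)]
    intro t
    refine (hN t).trans ?_
    have := t.2.2
    rw [hW]
    gcongr
  refine cauchySeq_of_le_tendsto_0' _ hest ?_
  have h1 : Tendsto (fun n : ℕ => 4 / c * (4 * D ^ 2 * (1 / ((n : ℝ) + 1))) * (b - a)) atTop (𝓝 0) := by
    simpa using (((tendsto_one_div_add_atTop_nhds_zero_nat (𝕜 := ℝ)).const_mul (4 * D ^ 2)).const_mul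
      (4 / c)).mul_const (b - a)
  simpa using (h1.sqrt).mul_const W

open Classical in
/-- The solution operator of the evolution problem with vanishing initial data at time `a`, as the
limit of the solution operators with `P` replaced by its Yosida approximations. -/
noncomputable def solOp (hab : a ≤ b) (P : V →L[ℝ] H) (R : ℕ → (H →L[ℝ] V)) (m : CoeffSpace H) :
    L1Icc H a b →L[ℝ] C(Icc a b, H) :=
  if h : ∃ L : L1Icc H a b →L[ℝ] C(Icc a b, H),
    ∀ x, Tendsto (fun n => approxSol hab (P ∘L R n) m x) atTop (𝓝 (L x)) then h.choose else 0

theorem CoerciveWith.tendsto_approxSol (hc : 0 < c) (h : CoerciveWith c m)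
    (hR : SkewResolvents ι P R) (hab : a ≤ b) (x : L1Icc H a b) :
    Tendsto (fun n => approxSol hab (P ∘L R n) m x) atTop (𝓝 (solOp hab P R m x)) := by
  have hex : ∃ L : L1Icc H a b →L[ℝ] C(Icc a b, H),
      ∀ x, Tendsto (fun n => approxSol hab (P ∘L R n) m x) atTop (𝓝 (L x)) := by
    refine exists_strong_limit _ (fun n x => h.norm_approxSol_le hc hab (hR.inner_nonneg n) le_rfl x)
      (solBound_nonneg hc) (denseRange_toL1Icc_primitive hab) ?_
    rintro _ ⟨g, rfl⟩
    exact h.cauchySeq_approxSol hc hR hab g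
  rw [solOp, dif_pos hex]
  exact hex.choose_spec x

theorem CoerciveWith.norm_solOp_le (hc : 0 < c) (h : CoerciveWith c m)
    (hR : SkewResolvents ι P R) (hab : a ≤ b) {β : ℝ} (hβ : lowerOrderBound a b m ≤ β)
    (x : L1Icc H a b) : ‖solOp hab P R m x‖ ≤ solBound a b c β * ‖x‖ :=
  norm_strong_limit_le (fun n x => h.norm_approxSol_le hc hab (hR.inner_nonneg n) hβ x)
    (h.tendsto_approxSol hc hR hab) x

theorem CoerciveWith.solOp_primitive (hc : 0 < c) (h : CoerciveWith c m)
    (hR : SkewResolvents ι P R) (hab : a ≤ b) (x : L1Icc H a b) :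
    solOp hab P R m (toL1Icc hab (primitiveL1 H a b x)) = primitive hab (solOp hab P R m x) := by
  have h1 := h.tendsto_approxSol hc hR hab (toL1Icc hab (primitiveL1 H a b x))
  simp only [h.approxSol_primitive hc hab] at h1
  exact tendsto_nhds_unique h1
    (((primitive hab).continuous.tendsto _).comp (h.tendsto_approxSol hc hR hab x))

/-- The second resolvent identity for the solution operators. -/
theorem CoerciveWith.solOp_sub (hc : 0 < c) (h : CoerciveWith c m) {c' : ℝ} (hc' : 0 < c')
    {m' : CoeffSpace H} (h' : CoerciveWith c' m') (hR : SkewResolvents ι P R) (hab : a ≤ b)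
    (x : L1Icc H a b) :
    primitive hab (solOp hab P R m' x) - primitive hab (solOp hab P R m x) =
      -solOp hab P R m' (toL1Icc hab (bulkOp hab (m' - m) (solOp hab P R m x))) := by
  have hl := h.tendsto_approxSol hc hR hab x
  have hl' := h'.tendsto_approxSol hc' hR hab x
  have t1 := (((primitive hab).continuous.tendsto _).comp hl').sub
    (((primitive hab).continuous.tendsto _).comp hl)
  have t2 := tendsto_comp_strong_limit
    (fun n x => h'.norm_approxSol_le hc' hab (hR.inner_nonneg n) le_rfl x)
    (h'.tendsto_approxSol hc' hR hab)
    ((((toL1Icc hab).continuous.comp (bulkOp hab (m' - m)).continuous).tendsto _).comp hl)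
  refine tendsto_nhds_unique t1 (t2.neg.congr fun n => ?_)
  exact (h.approxSol_sub hc hc' h' hab x).symm

/-- With u_n = J v_n, both R_n u_n and P R_n u_n converge in H, the latter by the approximate
equation. As R_0 = (1 + P)⁻¹, the elements R_n u_n = R_0 (R_n u_n + P R_n u_n) converge in V, so the
limit lies in the domain and satisfies the equation with P itself. -/
theorem CoerciveWith.solOp_continuous_data (hc : 0 < c) (h : CoerciveWith c m)
    (hR : SkewResolvents ι P R) (hab : a ≤ b) (g : C(Icc a b, H)) (t : Icc a b) :
    ι (R 0 (primitive hab (solOp hab P R m (toL1Icc hab g)) t + (primitive hab g -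
      bulkOp hab m (solOp hab P R m (toL1Icc hab g))) t)) =
        primitive hab (solOp hab P R m (toL1Icc hab g)) t ∧
    P (R 0 (primitive hab (solOp hab P R m (toL1Icc hab g)) t + (primitive hab g -
      bulkOp hab m (solOp hab P R m (toL1Icc hab g))) t)) =
        (primitive hab g - bulkOp hab m (solOp hab P R m (toL1Icc hab g))) t := by
  set v := solOp hab P R m (toL1Icc hab g) with hv
  set z := primitive hab g - bulkOp hab m v with hz
  set vn : ℕ → C(Icc a b, H) := fun n => approxSol hab (P ∘L R n) m (toL1Icc hab g) with hvn
  have hlim : Tendsto vn atTop (𝓝 v) := h.tendsto_approxSol hc hR hab _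
  have heval : Continuous fun u : C(Icc a b, H) => u t := by fun_prop
  have hu : Tendsto (fun n => primitive hab (vn n) t) atTop (𝓝 (primitive hab v t)) :=
    ((heval.comp (primitive hab).continuous).tendsto v).comp hlim
  have hPn : ∀ n, P (R n (primitive hab (vn n) t)) = (primitive hab g - bulkOp hab m (vn n)) t :=
    fun n => DFunLike.congr_fun (h.yosida_apply hc hab n g) t
  have hzn : Tendsto (fun n => P (R n (primitive hab (vn n) t))) atTop (𝓝 (z t)) := by
    simp_rw [hPn]
    have : Continuous fun w => (primitive hab g - bulkOp hab m w) t :=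
      heval.comp (continuous_const.sub (bulkOp hab m).continuous)
    exact (this.tendsto v).comp hlim
  have hιR : Tendsto (fun n => ι (R n (primitive hab (vn n) t))) atTop (𝓝 (primitive hab v t)) := by
    have e : ∀ n, ι (R n (primitive hab (vn n) t)) = primitive hab (vn n) t -
        (1 / ((n : ℝ) + 1)) • P (R n (primitive hab (vn n) t)) := fun n =>
      eq_sub_of_add_eq (hR.apply_resolvent n _)
    simp_rw [e]
    simpa using hu.sub ((tendsto_one_div_add_atTop_nhds_zero_nat (𝕜 := ℝ)).smul hzn)
  have hRn : Tendsto (fun n => R n (primitive hab (vn n) t)) atTop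
      (𝓝 (R 0 (primitive hab v t + z t))) := by
    have e : ∀ n, R n (primitive hab (vn n) t) =
        R 0 (ι (R n (primitive hab (vn n) t)) + P (R n (primitive hab (vn n) t))) := by
      intro n
      have := hR.resolvent_apply 0 (R n (primitive hab (vn n) t))
      simpa using this.symm
    rw [show (fun n => R n (primitive hab (vn n) t)) = _ from funext e]
    exact ((R 0).continuous.tendsto _).comp (hιR.add hzn)
  exact ⟨tendsto_nhds_unique ((ι.continuous.tendsto _).comp hRn) hιR,
    tendsto_nhds_unique ((P.continuous.tendsto _).comp hRn) hzn⟩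

end SolutionOperator

/-! ### Families of operators that commute with a smoothing operator -/

section SmoothingOperators

universe u

variable {X Y M : Type u} [NormedAddCommGroup X] [NormedSpace ℝ X] [NormedAddCommGroup Y]
  [NormedSpace ℝ Y] [NormedAddCommGroup M] [NormedSpace ℝ M]
  {i : Y →L[ℝ] X} {p : X →L[ℝ] Y}

/-- The operators `T : X → Y` that commute with the smoothing operator `p`, where `Y` is mapped to
`X` by `i`. -/
def SmoothingCommutant (i : Y →L[ℝ] X) (p : X →L[ℝ] Y) : Submodule ℝ (X →L[ℝ] Y) where
  carrier := {T | ∀ x, T (i (p x)) = p (i (T x))}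
  add_mem' := by
    intro S T hS hT x
    rw [add_apply, add_apply, map_add, map_add, hS x, hT x]
  zero_mem' := by intro x; simp
  smul_mem' := by
    intro c T hT x
    rw [smul_apply, smul_apply, map_smul, map_smul, hT x]

namespace SmoothingCommutant

theorem ext' {S T : SmoothingCommutant i p} (h : ∀ x, S.1 x = T.1 x) : S = T :=
  Subtype.ext (ContinuousLinearMap.ext h)

variable (i p) in
/-- Composition with the smoothing operator. -/
noncomputable def smooth : SmoothingCommutant i p →L[ℝ] SmoothingCommutant i p :=
  ((ContinuousLinearMap.compL ℝ X Y Y (p ∘L i)) ∘L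
    (SmoothingCommutant i p).subtypeL).codRestrict (SmoothingCommutant i p) (by
      intro T x
      exact congrArg (fun y => p (i y)) (T.2 x))

theorem smooth_apply (T : SmoothingCommutant i p) (x : X) : (smooth i p T).1 x = p (i (T.1 x)) := rfl

theorem smooth_pow_apply (j : ℕ) (T : SmoothingCommutant i p) (x : X) :
    ((smooth i p ^ j) T).1 x = ((p ∘L i) ^ j) (T.1 x) := by
  induction j with
  | zero => rfl
  | succ j ih =>
    rw [pow_succ', pow_succ', mul_apply_eq_comp, mul_apply_eq_comp,
      smooth_apply, ih]
    rfl

/-- The composition `-S L_δ T`, as a map of `δ`. -/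
noncomputable def sandwich {L : M →L[ℝ] Y →L[ℝ] Y} (hL : ∀ δ y, p (i (L δ y)) = L δ (p (i y)))
    (S T : SmoothingCommutant i p) : M →L[ℝ] SmoothingCommutant i p :=
  ((ContinuousLinearMap.compL ℝ X Y Y (-(S.1 ∘L i))) ∘L
    (((ContinuousLinearMap.compL ℝ X Y Y).flip T.1) ∘L L)).codRestrict
      (SmoothingCommutant i p) (by
      intro δ x
      change -(S.1 (i (L δ (T.1 (i (p x)))))) = p (i (-(S.1 (i (L δ (T.1 x))))))
      -- The smoothing operator passes through all three factors in turn.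
      rw [T.2 x, ← hL, S.2, map_neg, map_neg])

variable {L : M →L[ℝ] Y →L[ℝ] Y}

theorem sandwich_apply (hL : ∀ δ y, p (i (L δ y)) = L δ (p (i y))) (S T : SmoothingCommutant i p)
    (δ : M) (x : X) : (sandwich hL S T δ).1 x = -S.1 (i (L δ (T.1 x))) := rfl

theorem norm_sandwich_le (hL : ∀ δ y, p (i (L δ y)) = L δ (p (i y)))
    (S T : SmoothingCommutant i p) : ‖sandwich hL S T‖ ≤ ‖i‖ * ‖L‖ * ‖S‖ * ‖T‖ := by
  refine ContinuousLinearMap.opNorm_le_bound _ (by positivity) fun δ => ?_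
  change ‖(sandwich hL S T δ).1‖ ≤ _
  refine ContinuousLinearMap.opNorm_le_bound _ (by positivity) fun x => ?_
  rw [sandwich_apply, norm_neg]
  calc ‖S.1 (i (L δ (T.1 x)))‖ ≤ ‖S.1‖ * (‖i‖ * ((‖L‖ * ‖δ‖) * (‖T.1‖ * ‖x‖))) := by
        refine (S.1.le_opNorm _).trans ?_
        gcongr
        refine (i.le_opNorm _).trans ?_
        gcongr
        refine ((L δ).le_opNorm _).trans ?_
        gcongr
        · exact L.le_opNorm δ
        · exact T.1.le_opNorm x
    _ = ‖i‖ * ‖L‖ * ‖S.1‖ * ‖T.1‖ * ‖δ‖ * ‖x‖ := by ring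

/-- The composition `-S L_δ T` as a bounded trilinear map. -/
noncomputable def sandwichL (hL : ∀ δ y, p (i (L δ y)) = L δ (p (i y))) :
    SmoothingCommutant i p →L[ℝ] SmoothingCommutant i p →L[ℝ] (M →L[ℝ] SmoothingCommutant i p) :=
  LinearMap.mkContinuous₂
    (LinearMap.mk₂ ℝ (sandwich hL)
      (fun S S' T => by
        ext1 δ
        refine ext' fun x => ?_
        change -(S.1 (i (L δ (T.1 x))) + S'.1 (i (L δ (T.1 x)))) =
          -S.1 (i (L δ (T.1 x))) + -S'.1 (i (L δ (T.1 x)))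
        rw [neg_add])
      (fun c S T => by
        ext1 δ
        refine ext' fun x => ?_
        change -(c • S.1 (i (L δ (T.1 x)))) = c • (-S.1 (i (L δ (T.1 x))))
        rw [smul_neg])
      (fun S T T' => by
        ext1 δ
        refine ext' fun x => ?_
        change -S.1 (i (L δ (T.1 x + T'.1 x))) =
          -S.1 (i (L δ (T.1 x))) + -S.1 (i (L δ (T'.1 x)))
        rw [map_add, map_add, map_add, neg_add])
      (fun c S T => by
        ext1 δ
        refine ext' fun x => ?_
        change -S.1 (i (L δ (c • T.1 x))) = c • (-S.1 (i (L δ (T.1 x))))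
        rw [map_smul, map_smul, map_smul, smul_neg]))
    (‖i‖ * ‖L‖) (norm_sandwich_le hL)

variable (i p) in
/-- Evaluation of operators at a point. -/
noncomputable def evalL (x : X) : SmoothingCommutant i p →L[ℝ] Y :=
  (ContinuousLinearMap.apply ℝ Y x) ∘L (SmoothingCommutant i p).subtypeL

theorem evalL_apply (x : X) (T : SmoothingCommutant i p) : evalL i p x T = T.1 x := rfl

/-- If x is the limit of i p g_n, commutation gives T (i p g_n) = p i T g_n, which is evaluation at
g_n of the smoothed operator. The error ‖T (i p g_n - x)‖ is small uniformly for T in the unit ball.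
-/
theorem smoothingLimit_evalL (h : DenseRange (i ∘L p)) (x : X) :
    SmoothingLimit (smooth i p) (evalL i p x) := by
  obtain ⟨y, hy, hyx⟩ := mem_closure_iff_seq_limit.1 (h x)
  choose g hg using hy
  refine ⟨fun n => evalL i p (g n), ?_⟩
  refine tendsto_iff_norm_sub_tendsto_zero.2 ?_
  refine squeeze_zero (fun n => norm_nonneg _) (fun n => ?_) (tendsto_iff_norm_sub_tendsto_zero.1 hyx)
  refine ContinuousLinearMap.opNorm_le_bound _ (norm_nonneg _) fun T => ?_
  have e : (evalL i p (g n) ∘L smooth i p - evalL i p x) T = T.1 (y n - x) := by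
    change p (i (T.1 (g n))) - T.1 x = _
    rw [map_sub, ← hg n]
    congr 1
    exact (T.2 (g n)).symm
  rw [e, mul_comm]
  exact T.1.le_opNorm _

end SmoothingCommutant

open SmoothingCommutant in
/-- A locally bounded family of operators that satisfies a second resolvent identity up to a
smoothing operator is of class `C^j`, pointwise, after `j` applications of the latter; and so are
the affine expressions in the result `w` and in `L_m w`. -/
theorem contDiffOn_smooth_pow {L : M →L[ℝ] Y →L[ℝ] Y}
    (hL : ∀ δ y, p (i (L δ y)) = L δ (p (i y))) (hd : DenseRange (i ∘L p)) {U : Set M}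
    (hU : IsOpen U) {T : M → (X →L[ℝ] Y)} (hTU : ∀ m ∈ U, T m ∈ SmoothingCommutant i p)
    (hT : LocBddOn U T)
    (h : ∀ m ∈ U, ∀ m' ∈ U, ∀ x, p (i (T m' x)) - p (i (T m x)) =
      -T m' (i (L (m' - m) (T m x)))) (j : ℕ) (x : X) {Z : Type*} [NormedAddCommGroup Z]
    [NormedSpace ℝ Z] (α β : Y →L[ℝ] Z) (z : Z) :
    ContDiffOn ℝ (j : WithTop ℕ∞) (fun m => α (((p ∘L i) ^ j) (T m x)) +
      β (L m (((p ∘L i) ^ j) (T m x))) + z) U := by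
  classical
  -- The value 0 is a default, never taken on U.
  let S : M → SmoothingCommutant i p := fun m =>
    if h : T m ∈ SmoothingCommutant i p then ⟨T m, h⟩ else 0
  have hS : ∀ m ∈ U, (S m).1 = T m := fun m hm => by
    simp only [S]
    rw [dif_pos (hTU m hm)]
  have hSb : LocBddOn U S := by
    intro m hm
    obtain ⟨C, hC⟩ := hT m hm
    refine ⟨C, ?_⟩
    filter_upwards [hC, hU.mem_nhds hm] with m' h1 h2
    change ‖(S m').1‖ ≤ C
    rwa [hS m' h2]
  have hreg : LossyReg U j (smooth i p) S := by
    refine LossyReg.of_resolvent_identity hU (sandwichL hL) ?_ ?_ hSb ?_ j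
    · intro S T
      ext1 δ
      refine ext' fun x => ?_
      change -(p (i (S.1 (i (L δ (T.1 x)))))) = p (i (-(S.1 (i (L δ (T.1 x))))))
      rw [map_neg, map_neg]
    -- To extract the smoothing operator from the right factor it has to be moved past L and S; this
    -- is why the argument lives in the commutant.
    · intro S T
      ext1 δ
      refine ext' fun x => ?_
      change -(S.1 (i (L δ (p (i (T.1 x)))))) = p (i (-(S.1 (i (L δ (T.1 x))))))
      rw [← hL, S.2, map_neg, map_neg]
    · intro m hm m' hm'
      refine ext' fun x => ?_
      change p (i ((S m').1 x)) - p (i ((S m).1 x)) = -(S m').1 (i (L (m' - m) ((S m).1 x)))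
      rw [hS m hm, hS m' hm']
      exact h m hm m' hm' x
  have hw : ContDiffOn ℝ (j : WithTop ℕ∞) (fun m => ((p ∘L i) ^ j) (T m x)) U := by
    refine (LossyReg.contDiffOn hU j (smoothingLimit_evalL hd x) hreg).congr fun m hm => ?_
    rw [evalL_apply, smooth_pow_apply, hS m hm]
  exact ((α.contDiff.comp_contDiffOn hw).add
    (β.contDiff.comp_contDiffOn (L.contDiff.contDiffOn.clm_apply hw))).add contDiffOn_const

end SmoothingOperators

/-! ### Differentiability of the solution operator in the coefficients -/

section Smoothness

universe u

variable {H : Type u} {V : Type*} [NormedAddCommGroup H] [InnerProductSpace ℝ H] [CompleteSpace H]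
  [NormedAddCommGroup V] [NormedSpace ℝ V] {a b : ℝ}
  {ι : V →L[ℝ] H} {P : V →L[ℝ] H} {R : ℕ → (H →L[ℝ] V)}

variable (H) in
/-- The coefficients with a coercive leading part. -/
def coerciveSet : Set (CoeffSpace H) := {m | ∃ c, 0 < c ∧ CoerciveWith c m}

theorem CoeffSpace.opA_sub (m m' : CoeffSpace H) : (m - m').opA = m.opA - m'.opA := rfl

theorem CoeffSpace.norm_opA_le (m : CoeffSpace H) : ‖m.opA‖ ≤ ‖m‖ := by
  have h1 := CoeffSpace.norm_eq m
  have h2 : 0 ≤ max ‖m.snd.snd.1.1‖ ‖m.snd.snd.1.2‖ := le_max_of_le_left (norm_nonneg _)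
  linarith [norm_nonneg m.opB]

theorem CoeffSpace.norm_opB_le (m : CoeffSpace H) : ‖m.opB‖ ≤ ‖m‖ := by
  have h1 := CoeffSpace.norm_eq m
  have h2 : 0 ≤ max ‖m.snd.snd.1.1‖ ‖m.snd.snd.1.2‖ := le_max_of_le_left (norm_nonneg _)
  linarith [norm_nonneg m.opA]

theorem CoeffSpace.norm_kernel_le (m : CoeffSpace H) : ‖m.snd.snd.1.2‖ ≤ ‖m‖ := by
  have h1 := CoeffSpace.norm_eq m
  have h2 := le_max_right ‖m.snd.snd.1.1‖ ‖m.snd.snd.1.2‖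
  linarith [norm_nonneg m.opA, norm_nonneg m.opB]

theorem CoerciveWith.eventually {c : ℝ} (hc : 0 < c) {m : CoeffSpace H} (h : CoerciveWith c m) :
    ∀ᶠ m' in 𝓝 m, CoerciveWith (c / 2) m' := by
  filter_upwards [Metric.ball_mem_nhds m (half_pos hc)] with m' hm' x
  rw [mem_ball_iff_norm] at hm'
  have h1 : ⟪m'.opA x, x⟫_ℝ = ⟪m.opA x, x⟫_ℝ + ⟪(m' - m).opA x, x⟫_ℝ := by
    rw [CoeffSpace.opA_sub, sub_apply, inner_sub_left]; ring
  have h2 := neg_le_of_abs_le (abs_real_inner_le_norm ((m' - m).opA x) x)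
  have h3 : ‖(m' - m).opA x‖ * ‖x‖ ≤ c / 2 * ‖x‖ ^ 2 := by
    rw [sq, ← mul_assoc]
    gcongr
    refine ((m' - m).opA.le_opNorm x).trans ?_
    gcongr
    exact (CoeffSpace.norm_opA_le _).trans hm'.le
  have h4 := h x
  rw [h1]
  linarith

theorem isOpen_coerciveSet : IsOpen (coerciveSet H) := by
  rw [isOpen_iff_mem_nhds]
  rintro m ⟨c, hc, h⟩
  filter_upwards [h.eventually hc] with m' hm' using ⟨c / 2, half_pos hc, hm'⟩

/-- For a given triple all bounds other than the coercivity of A come for free, with constants read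
off from the norms; the maximum with c ensures c ≤ C. -/
theorem admissible_eq_coerciveSet : admissible H = coerciveSet H := by
  ext m
  constructor
  · rintro ⟨c, C, β, q, hc, -, -, -, h, -⟩
    exact ⟨c, hc, fun x => (h x).1⟩
  · rintro ⟨c, hc, h⟩
    refine ⟨c, max c ‖m.opA‖, ‖m.opB‖, ‖m.snd.snd.1.1‖ + ‖m.snd.snd.1.2‖, hc, le_max_left _ _,
      norm_nonneg _, by positivity, fun x => ⟨h x, ?_⟩, le_rfl, le_rfl⟩
    refine (real_inner_le_norm _ _).trans ?_
    rw [sq, ← mul_assoc]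
    gcongr
    exact (m.opA.le_opNorm x).trans (by gcongr; exact le_max_right _ _)

/-- The bound depends only on a coercivity constant and on the sizes of B and Q. Near m these may be
taken as c/2 and ‖m‖ + 1. -/
theorem locBddOn_solOp (hR : SkewResolvents ι P R) (hab : a ≤ b) :
    LocBddOn (coerciveSet H) (solOp hab P R) := by
  rintro m ⟨c, hc, h⟩
  have hba := sub_nonneg.2 hab
  refine ⟨solBound a b (c / 2) ((‖m‖ + 1) + (‖m‖ + 1) * (b - a)), ?_⟩
  filter_upwards [h.eventually hc, Metric.ball_mem_nhds m one_pos] with m' hm' hball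
  have hn : ‖m'‖ ≤ ‖m‖ + 1 := by
    rw [mem_ball_iff_norm] at hball
    have := norm_sub_norm_le m' m
    linarith
  refine ContinuousLinearMap.opNorm_le_bound _ (solBound_nonneg (half_pos hc)) fun x =>
    hm'.norm_solOp_le (half_pos hc) hR hab ?_ x
  unfold lowerOrderBound
  gcongr
  · exact (CoeffSpace.norm_opB_le _).trans hn
  · exact (CoeffSpace.norm_kernel_le _).trans hn

set_option synthInstance.maxHeartbeats 400000 in
set_option maxHeartbeats 2000000 in
/-- Affine expressions in `w`, the `j`-fold primitive of the solution, and in `L_m w` are of class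
`C^j` in the coefficients. -/
theorem contDiffOn_primitive_pow_solOp (hR : SkewResolvents ι P R) (hab : a ≤ b) (j : ℕ)
    (x : L1Icc H a b) {Z : Type*} [NormedAddCommGroup Z] [NormedSpace ℝ Z]
    (α β : C(Icc a b, H) →L[ℝ] Z) (z : Z) :
    ContDiffOn ℝ (j : WithTop ℕ∞) (fun m => α (((primitive hab) ^ j) (solOp hab P R m x)) +
      β (bulkOp hab m (((primitive hab) ^ j) (solOp hab P R m x))) + z) (coerciveSet H) := by
  have hd : DenseRange (toL1Icc hab ∘L primitiveL1 H a b) :=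
    (denseRange_toL1Icc_primitive hab).mono (by rintro _ ⟨u, rfl⟩; exact ⟨toL1Icc hab u, rfl⟩)
  have hT : ∀ m ∈ coerciveSet H, solOp hab P R m ∈
      SmoothingCommutant (toL1Icc hab) (primitiveL1 H a b) := by
    rintro m ⟨c, hc, h⟩ x
    exact h.solOp_primitive hc hR hab x
  refine contDiffOn_smooth_pow (primitive_bulkOp hab) hd isOpen_coerciveSet hT
    (locBddOn_solOp hR hab) ?_ j x α β z
  rintro m ⟨c, hc, h⟩ m' ⟨c', hc', h'⟩ x
  exact h.solOp_sub hc hc' h' hR hab x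

end Smoothness

/-! ### Completeness of the coefficient space -/

section Completeness

variable {H : Type*} [NormedAddCommGroup H] [InnerProductSpace ℝ H] [CompleteSpace H]

theorem completeSpace_bSymm : CompleteSpace (BSymm H) := by
  have h : IsClosed ((selfAdjoint.submodule ℝ (H →L[ℝ] H) : Submodule ℝ (H →L[ℝ] H)) :
      Set (H →L[ℝ] H)) := by
    have : ((selfAdjoint.submodule ℝ (H →L[ℝ] H) : Submodule ℝ (H →L[ℝ] H)) : Set (H →L[ℝ] H)) =
        {A | star A = A} := rfl
    rw [this]
    exact isClosed_eq continuous_star continuous_id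
  exact h.completeSpace_coe

/-- An L¹ limit is an almost everywhere limit along a subsequence, and a uniform limit is a
pointwise limit; so the two components of a limit still agree. -/
theorem isClosed_memoryKernel : IsClosed (MemoryKernel H : Set (Lp (BSymm H) 1 (volume : Measure ℝ) ×
    (ℝ≥0 →ᵇ BSymm H))) := by
  refine IsSeqClosed.isClosed fun q p hq hp => ?_
  have h1 : Tendsto (fun n => (q n).1) atTop (𝓝 p.1) := (continuous_fst.tendsto p).comp hp
  have h2 : Tendsto (fun n => (q n).2) atTop (𝓝 p.2) := (continuous_snd.tendsto p).comp hp
  obtain ⟨ns, hns, hlim⟩ := (tendstoInMeasure_of_tendsto_Lp h1).exists_seq_tendsto_ae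
  change (p.1 : ℝ → BSymm H) =ᵐ[volume] causalExt p.2
  have hall : ∀ᵐ t : ℝ, ∀ n, (q n).1 t = causalExt (q n).2 t := ae_all_iff.2 fun n => hq n
  filter_upwards [hlim, hall] with t ht hqt
  have h3 : Tendsto (fun n => causalExt (q n).2 t) atTop (𝓝 (causalExt p.2 t)) := by
    unfold causalExt
    split_ifs
    · exact ((continuous_eval_const t.toNNReal).tendsto p.2).comp h2
    · exact tendsto_const_nhds
  simp only [hqt] at ht
  exact tendsto_nhds_unique ht (h3.comp hns.tendsto_atTop)

theorem completeSpace_coeffSpace : CompleteSpace (CoeffSpace H) := by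
  haveI : CompleteSpace (BSymm H) := completeSpace_bSymm
  haveI : CompleteSpace (MemoryKernel H) := isClosed_memoryKernel.completeSpace_coe
  infer_instance

end Completeness

/-! ### Causal functions with weak derivatives are iterated primitives -/

section WeakDerivatives

variable {E : Type*} [NormedAddCommGroup E] [NormedSpace ℝ E] {a T : ℝ}

theorem MemL2Loc.locallyIntegrable {g : ℝ → E} (hg : MemL2Loc g) :
    LocallyIntegrable g volume := by
  intro x
  refine ⟨Icc (x - 1) (x + 1), Icc_mem_nhds (by linarith) (by linarith), ?_⟩
  exact (hg (x - 1) (x + 1)).integrable (by norm_num)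

theorem MeasureTheory.LocallyIntegrable.intervalIntegrable {g : ℝ → E}
    (hg : LocallyIntegrable g volume) (s t : ℝ) : IntervalIntegrable g volume s t :=
  (hg.integrableOn_isCompact isCompact_uIcc).intervalIntegrable

/-- The primitive of `g` that vanishes at `a`. -/
noncomputable def primitiveFrom (a : ℝ) (g : ℝ → E) (t : ℝ) : E := ∫ s in a..t, g s

theorem continuous_primitiveFrom {g : ℝ → E} (hg : LocallyIntegrable g volume) :
    Continuous (primitiveFrom a g) :=
  intervalIntegral.continuous_primitive hg.intervalIntegrable a

theorem primitiveFrom_congr {g h : ℝ → E} (hgh : g =ᵐ[volume] h) :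
    primitiveFrom a g = primitiveFrom a h := by
  ext t
  exact intervalIntegral.integral_congr_ae (hgh.mono fun s hs _ => hs)

theorem primitiveFrom_eq_zero {g : ℝ → E} (hg : ∀ᵐ t : ℝ, t < T → g t = 0) (ha : a < T) {t : ℝ}
    (ht : t ≤ T) : primitiveFrom a g t = 0 := by
  refine intervalIntegral.integral_zero_ae ?_
  filter_upwards [hg, (measure_eq_zero_iff_ae_notMem.1 (Real.volume_singleton (a := T)))]
    with s hs hsT hst
  refine hs (lt_of_le_of_ne ?_ hsT)
  have := hst.2
  simp only [le_sup_iff] at this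
  rcases this with h | h
  · linarith
  · linarith

variable [CompleteSpace E]

/-- Test functions supported in (-∞, T) do not see g, hence integrate g' to zero. -/
theorem IsWeakDeriv.ae_eq_zero {g g' : ℝ → E} (h : IsWeakDeriv g g')
    (hg' : LocallyIntegrable g' volume) (hT : ∀ᵐ t : ℝ, t < T → g t = 0) :
    ∀ᵐ t : ℝ, t < T → g' t = 0 := by
  refine isOpen_Iio.ae_eq_zero_of_integral_contDiff_smul_eq_zero
    (fun x _ => (hg' x).filter_mono nhdsWithin_le_nhds) fun φ hφ hφc hφT => ?_
  have h1 := h φ hφ hφc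
  have h2 : ∫ t, deriv φ t • g t = 0 := by
    refine integral_eq_zero_of_ae ?_
    filter_upwards [hT] with t ht
    rcases lt_or_ge t T with h3 | h3
    · simp [ht h3]
    · have : deriv φ t = 0 := by
        by_contra h4
        exact absurd (hφT (support_deriv_subset h4)) (not_lt.2 h3)
      simp [this]
  rw [h2] at h1
  simpa using h1.symm

theorem integral_smul_primitiveFrom {g : ℝ → E} (hg : LocallyIntegrable g volume) {ψ : ℝ → ℝ}
    (hψ : Continuous ψ) {b : ℝ} (hab : a ≤ b) :
    ∫ s in a..b, ψ s • primitiveFrom a g s = ∫ r in a..b, (∫ s in r..b, ψ s) • g r := by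
  have h := integral_integral_triangle_of_integrableOn (G := fun s r => ψ s • g r) hab (by
    rw [IntegrableOn, ← Measure.prod_restrict]
    exact Integrable.smul_prod (hψ.integrableOn_Icc) (hg.integrableOn_isCompact isCompact_Icc))
  simp only [intervalIntegral.integral_smul, intervalIntegral.integral_smul_const] at h
  exact h

/-- Given a test function ψ, its antiderivative Ψ vanishing to the right of the support need not
have compact support on the left. A cutoff χ, equal to 0 before a and 1 after T, repairs this and
goes unnoticed because g and g' vanish before T. Testing with χΨ and applying Fubini gives ∫ ψ g = ∫
ψ J g'. -/
theorem IsWeakDeriv.ae_eq_primitiveFrom {g g' : ℝ → E} (h : IsWeakDeriv g g')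
    (hg : LocallyIntegrable g volume) (hg' : LocallyIntegrable g' volume)
    (hT : ∀ᵐ t : ℝ, t < T → g t = 0) (ha : a < T) : g =ᵐ[volume] primitiveFrom a g' := by
  have hT' := h.ae_eq_zero hg' hT
  refine ae_eq_of_integral_contDiff_smul_eq hg (continuous_primitiveFrom hg').locallyIntegrable
    fun ψ hψ hψc => ?_
  obtain ⟨b, hTb, hb⟩ : ∃ b, T ≤ b ∧ ∀ t, b ≤ t → ψ t = 0 := by
    obtain ⟨B, hB⟩ := hψc.isCompact.bddAbove
    refine ⟨max T (B + 1), le_max_left _ _, fun t ht => ?_⟩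
    by_contra h1
    have h2 := hB (subset_tsupport _ h1)
    have h3 := (le_max_right T (B + 1)).trans ht
    linarith
  have hab : a ≤ b := ha.le.trans hTb
  set Ψ : ℝ → ℝ := fun t => -∫ s in t..b, ψ s with hΨ
  have hΨd : ∀ t, HasDerivAt Ψ (ψ t) t := by
    intro t
    have := (intervalIntegral.integral_hasDerivAt_left (hψ.continuous.intervalIntegrable t b)
      hψ.continuous.stronglyMeasurable.stronglyMeasurableAtFilter hψ.continuous.continuousAt).neg
    rwa [neg_neg] at this
  have hΨs : ContDiff ℝ ∞ Ψ := by
    rw [contDiff_infty_iff_deriv]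
    refine ⟨fun t => (hΨd t).differentiableAt, ?_⟩
    rw [show deriv Ψ = ψ from funext fun t => (hΨd t).deriv]
    exact hψ
  set χ : ℝ → ℝ := fun t => Real.smoothTransition ((t - a) / (T - a)) with hχ
  have hTa : 0 < T - a := sub_pos.2 ha
  have hχs : ContDiff ℝ ∞ χ :=
    Real.smoothTransition.contDiff.comp ((contDiff_id.sub contDiff_const).div_const _)
  have hχ0 : ∀ t, t ≤ a → χ t = 0 := fun t ht =>
    Real.smoothTransition.zero_of_nonpos (div_nonpos_of_nonpos_of_nonneg (by linarith) hTa.le)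
  have hχ1 : ∀ t, T ≤ t → χ t = 1 := fun t ht =>
    Real.smoothTransition.one_of_one_le (by rw [le_div_iff₀ hTa]; linarith)
  have hΨb : ∀ t, b ≤ t → Ψ t = 0 := by
    intro t ht
    simp only [hΨ, neg_eq_zero]
    refine intervalIntegral.integral_zero_ae (Eventually.of_forall fun s hs => hb s ?_)
    rw [uIoc_of_ge ht] at hs
    exact hs.1.le
  have hφs : ContDiff ℝ ∞ (fun t => χ t * Ψ t) := hχs.mul hΨs
  have hφc : HasCompactSupport (fun t => χ t * Ψ t) := by
    refine HasCompactSupport.intro (isCompact_Icc (a := a) (b := b)) fun t ht => ?_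
    rw [mem_Icc, not_and_or, not_le, not_le] at ht
    rcases ht with h1 | h1
    · rw [hχ0 t h1.le, zero_mul]
    · rw [hΨb t h1.le, mul_zero]
  have hmain := h _ hφs hφc
  have hne := measure_eq_zero_iff_ae_notMem.1 (Real.volume_singleton (a := T))
  have e1 : ∫ t, deriv (fun t => χ t * Ψ t) t • g t = ∫ t, ψ t • g t := by
    refine integral_congr_ae ?_
    filter_upwards [hT, hne] with t ht htT
    rcases lt_or_ge t T with h1 | h1
    · simp [ht h1]
    · have h2 : T < t := lt_of_le_of_ne h1 (fun h => htT h.symm)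
      have h3 : (fun t => χ t * Ψ t) =ᶠ[𝓝 t] Ψ := by
        filter_upwards [lt_mem_nhds h2] with s hs
        rw [hχ1 s (le_of_lt hs), one_mul]
      rw [h3.deriv_eq, (hΨd t).deriv]
  have e2 : ∫ t, (χ t * Ψ t) • g' t = -∫ r in a..b, (∫ s in r..b, ψ s) • g' r := by
    rw [← intervalIntegral.integral_neg, intervalIntegral.integral_of_le hab,
      ← integral_indicator measurableSet_Ioc]
    refine integral_congr_ae ?_
    filter_upwards [hT'] with t ht
    by_cases h1 : t ∈ Ioc a b
    · rw [indicator_of_mem h1]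
      rcases lt_or_ge t T with h2 | h2
      · simp [ht h2]
      · rw [hχ1 t h2, one_mul, hΨ, neg_smul]
    · rw [indicator_of_notMem h1]
      rw [mem_Ioc, not_and_or, not_lt, not_le] at h1
      rcases h1 with h2 | h2
      · rw [hχ0 t h2, zero_mul, zero_smul]
      · rw [hΨb t h2.le, mul_zero, zero_smul]
  have e3 : ∫ t, ψ t • primitiveFrom a g' t = ∫ s in a..b, ψ s • primitiveFrom a g' s := by
    rw [intervalIntegral.integral_of_le hab, ← integral_indicator measurableSet_Ioc]
    refine integral_congr_ae (Eventually.of_forall fun t => ?_)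
    by_cases h1 : t ∈ Ioc a b
    · simp only [indicator_of_mem h1]
    · simp only [indicator_of_notMem h1]
      rw [mem_Ioc, not_and_or, not_lt, not_le] at h1
      rcases h1 with h2 | h2
      · rw [primitiveFrom_eq_zero hT' ha (h2.trans ha.le), smul_zero]
      · rw [hb t h2.le, zero_smul]
  rw [e1, e2, neg_neg] at hmain
  rw [hmain, e3, integral_smul_primitiveFrom hg' hψ.continuous hab]

theorem MemHLoc.memL2Loc {k : ℕ} {f : ℝ → E} (hf : MemHLoc k f) : MemL2Loc f := by
  cases k with
  | zero => exact hf
  | succ k => exact hf.1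

/-- A causal function in `H^k_loc` is the `k`-fold primitive of a causal function in `L²_loc`. -/
theorem MemHLoc.exists_iterate_primitiveFrom {k : ℕ} {f : ℝ → E} (hf : MemHLoc k f)
    (hT : ∀ᵐ t : ℝ, t < T → f t = 0) (ha : a < T) :
    ∃ h : ℝ → E, LocallyIntegrable h volume ∧ (∀ᵐ t : ℝ, t < T → h t = 0) ∧
      f =ᵐ[volume] (primitiveFrom a)^[k] h := by
  induction k generalizing f with
  | zero => exact ⟨f, hf.memL2Loc.locallyIntegrable, hT, EventuallyEq.rfl⟩
  | succ k ih =>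
    obtain ⟨h1, g, hg, hgk⟩ := hf
    have hgi := hgk.memL2Loc.locallyIntegrable
    obtain ⟨h, hh, hhT, hgh⟩ := ih hgk (hg.ae_eq_zero hgi hT)
    refine ⟨h, hh, hhT, ?_⟩
    rw [Function.iterate_succ_apply', ← primitiveFrom_congr hgh]
    exact hg.ae_eq_primitiveFrom h1.locallyIntegrable hgi hT ha

end WeakDerivatives

/-! ### Solutions up to a given time -/

section SolutionsUpTo

variable {H V : Type*} [NormedAddCommGroup H] [InnerProductSpace ℝ H] [CompleteSpace H]
  [NormedAddCommGroup V] [InnerProductSpace ℝ V] {a b c : ℝ}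
  {ι : V →L[ℝ] H} {P : V →L[ℝ] H} {R : ℕ → (H →L[ℝ] V)} {m : CoeffSpace H}
  {f v v' : ℝ → H} {u u' : ℝ → V}

/-- `u` is a solution of the evolution equation on `(-∞, b]` which vanishes on `(-∞, a]`, and `v` is
its derivative. -/
structure IsSolutionUpTo (ι P : V →L[ℝ] H) (m : CoeffSpace H) (f : ℝ → H) (a b : ℝ)
    (v : ℝ → H) (u : ℝ → V) : Prop where
  continuous_deriv : Continuous v
  continuous : Continuous u
  deriv_eq_zero : ∀ t ≤ a, v t = 0
  eq_zero : ∀ t ≤ a, u t = 0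
  primitive_eq : ∀ t ≤ b, ι (u t) = ∫ s in a..t, v s
  equation : ∀ t ≤ b, m.opA (v t) + P (u t) + m.opB (ι (u t)) +
    ∫ s in a..t, extendedKernel m.snd.snd.1.2 (t - s) (ι (u s)) = f t

theorem IsSolutionUpTo.mono (h : IsSolutionUpTo ι P m f a b v u) {b' : ℝ} (hb : b' ≤ b) :
    IsSolutionUpTo ι P m f a b' v u :=
  ⟨h.continuous_deriv, h.continuous, h.deriv_eq_zero, h.eq_zero,
    fun t ht => h.primitive_eq t (ht.trans hb), fun t ht => h.equation t (ht.trans hb)⟩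

theorem CoerciveWith.eq_zero_of_opA (hc : 0 < c) (h : CoerciveWith c m) {x : H}
    (hx : m.opA x = 0) : x = 0 := by
  have h1 := h x
  rw [hx, inner_zero_left] at h1
  have h2 : ‖x‖ ^ 2 ≤ 0 := by
    by_contra h3
    exact absurd h1 (not_le.2 (mul_pos hc (not_le.1 h3)))
  have h3 : ‖x‖ ^ 2 = 0 := le_antisymm h2 (sq_nonneg _)
  exact norm_eq_zero.1 (pow_eq_zero_iff two_ne_zero |>.1 h3)

/-- Solutions up to time `b` are unique. -/
theorem IsSolutionUpTo.eq (hι : Function.Injective ι) (hP : ∀ x, ⟪P x, ι x⟫_ℝ = 0) (hc : 0 < c)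
    (hm : CoerciveWith c m) (h : IsSolutionUpTo ι P m f a b v u)
    (h' : IsSolutionUpTo ι P m f a b v' u') {t : ℝ} (ht : t ≤ b) : v t = v' t ∧ u t = u' t := by
  rcases le_total t a with hta | hta
  · rw [h.deriv_eq_zero t hta, h.eq_zero t hta, h'.deriv_eq_zero t hta, h'.eq_zero t hta]
    exact ⟨rfl, rfl⟩
  have hab : a ≤ b := hta.trans ht
  have hvc := h.continuous_deriv
  have hvc' := h'.continuous_deriv
  let w : C(Icc a b, H) := ⟨fun s => v s - v' s, by fun_prop⟩
  have hw : ∀ s : Icc a b, primitive hab w s = ι (u s - u' s) := by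
    intro s
    rw [primitive_apply, map_sub, h.primitive_eq s s.2.2, h'.primitive_eq s s.2.2,
      ← intervalIntegral.integral_sub (hvc.intervalIntegrable _ _) (hvc'.intervalIntegrable _ _)]
    refine intervalIntegral.integral_congr fun r hr => ?_
    rw [uIcc_of_le s.2.1] at hr
    exact iccExtend_apply hab w ⟨hr.1, hr.2.trans s.2.2⟩
  have hL : ∀ s : Icc a b, m.opA (w s) =
      -lowerOrderOp hab m (primitive hab w) s - P (u s - u' s) := by
    intro s
    have hq := continuous_extendedKernel m.snd.snd.1.2
    have hu := h.continuous
    have hu' := h'.continuous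
    have e1 := h.equation s s.2.2
    have e2 := h'.equation s s.2.2
    have e3 : causalConv hab m.snd.snd.1.2 (primitive hab w) s =
        (∫ r in a..(s : ℝ), extendedKernel m.snd.snd.1.2 (s - r) (ι (u r))) -
        ∫ r in a..(s : ℝ), extendedKernel m.snd.snd.1.2 (s - r) (ι (u' r)) := by
      rw [causalConv_apply, ← intervalIntegral.integral_sub]
      · refine intervalIntegral.integral_congr fun r hr => ?_
        rw [uIcc_of_le s.2.1] at hr
        rw [iccExtend_apply hab _ ⟨hr.1, hr.2.trans s.2.2⟩, hw, ← map_sub, ← map_sub]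
      all_goals
        apply Continuous.intervalIntegrable
        exact (hq.comp (continuous_const.sub continuous_id)).clm_apply (ι.continuous.comp ‹_›)
    rw [lowerOrderOp_apply, ContinuousMap.add_apply, pointwiseOp_apply, e3, hw]
    have e4 : w s = v s - v' s := rfl
    rw [e4]
    simp only [map_sub]
    rw [eq_sub_of_add_eq (eq_sub_of_add_eq (eq_sub_of_add_eq e1)),
      eq_sub_of_add_eq (eq_sub_of_add_eq (eq_sub_of_add_eq e2))]
    abel
  -- There is no source and ⟨P u, u⟩ vanishes exactly, so the estimate forces N = 0.
  obtain ⟨N, hN0, hN, hNI⟩ := energy_estimate hab m.isSelfAdjoint_opA hc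
    (lowerOrderBound_nonneg hab m) le_rfl hm w (p := fun _ => 0) continuous_const
    (fun _ => le_rfl) (fun s ν C hν hC hb => by
      rw [hL, inner_sub_left, inner_neg_left]
      have h2 := causallyBounded_lowerOrderOp hab m ν C hν hC s _ hb
      have h3 : ⟪P (u s - u' s), primitive hab w s⟫_ℝ = 0 := by rw [hw, hP]
      have h4 := neg_le_of_abs_le (abs_real_inner_le_norm
        (lowerOrderOp hab m (primitive hab w) s) (primitive hab w s))
      have h5 : ‖lowerOrderOp hab m (primitive hab w) s‖ * ‖primitive hab w s‖ ≤
          lowerOrderBound a b m * (C * Real.exp (ν * (s - a))) * ‖primitive hab w s‖ := by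
        gcongr
      linarith)
  rw [intervalIntegral.integral_zero, mul_zero, zero_mul, add_zero] at hNI
  have hN2 : N = 0 := by
    by_contra h3
    have : 0 < N ^ 2 := by positivity
    have : 0 < c / 4 * N ^ 2 := by positivity
    linarith
  have hw0 : primitive hab w = 0 := by
    ext s
    have := hN s
    rw [hN2, zero_mul] at this
    exact norm_le_zero_iff.1 this
  have hu0 : u t - u' t = 0 := by
    apply hι
    rw [map_zero, ← hw ⟨t, hta, ht⟩, hw0]
    rfl
  -- Once u = u' is known, the equation leaves A (v - v') = 0, and A is injective.
  have hv0 : w ⟨t, hta, ht⟩ = 0 := by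
    refine hm.eq_zero_of_opA hc ?_
    rw [hL, hw0]
    simp only [hu0, map_zero, ContinuousMap.zero_apply, neg_zero, sub_zero]
  exact ⟨sub_eq_zero.1 hv0, sub_eq_zero.1 hu0⟩

/-- For data J g with g continuous, T(m) g is the derivative of the solution, and the solution
itself is recovered in V through R_0. Extending both by their values at a gives zero on (-∞, a]. -/
theorem CoerciveWith.isSolutionUpTo_solOp (hc : 0 < c) (hm : CoerciveWith c m)
    (hι : Function.Injective ι) (hR : SkewResolvents ι P R) (hab : a ≤ b) {g : ℝ → H}
    (hg : ∀ t ≤ a, primitiveFrom a g t = 0) {gC : C(Icc a b, H)} (hgC : ∀ t, gC t = g t) :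
    IsSolutionUpTo ι P m (primitiveFrom a g) a b
      (IccExtend hab (solOp hab P R m (toL1Icc hab gC)))
      (IccExtend hab fun t => R 0 (primitive hab (solOp hab P R m (toL1Icc hab gC)) t +
        (primitive hab gC - bulkOp hab m (solOp hab P R m (toL1Icc hab gC))) t)) := by
  have hsol := hm.solOp_continuous_data hc hR hab gC
  set v : C(Icc a b, H) := solOp hab P R m (toL1Icc hab gC) with hv
  set y : C(Icc a b, V) := ⟨fun t => R 0 (primitive hab v t +
    (primitive hab gC - bulkOp hab m v) t), by fun_prop⟩ with hy
  have hι1 : ∀ t, ι (y t) = primitive hab v t := fun t => (hsol t).1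
  have hP1 : ∀ t, P (y t) = primitive hab gC t - bulkOp hab m v t := fun t => (hsol t).2
  have ha : a ∈ Icc a b := ⟨le_rfl, hab⟩
  have hya : y ⟨a, ha⟩ = 0 := by
    apply hι
    rw [hι1, primitive_apply, intervalIntegral.integral_same, map_zero]
  have hprim : ∀ t : Icc a b, primitive hab gC t = primitiveFrom a g t := by
    intro t
    rw [primitive_apply]
    refine intervalIntegral.integral_congr fun r hr => ?_
    rw [uIcc_of_le t.2.1] at hr
    rw [iccExtend_apply hab _ ⟨hr.1, hr.2.trans t.2.2⟩, hgC]
  have heq : ∀ t : Icc a b, m.opA (v t) + P (y t) + m.opB (ι (y t)) +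
      ∫ s in a..(t : ℝ), extendedKernel m.snd.snd.1.2 (t - s) (ι (IccExtend hab y s)) =
        primitiveFrom a g t := by
    intro t
    have e1 : causalConv hab m.snd.snd.1.2 (primitive hab v) t =
        ∫ s in a..(t : ℝ), extendedKernel m.snd.snd.1.2 (t - s) (ι (IccExtend hab y s)) := by
      rw [causalConv_apply]
      refine intervalIntegral.integral_congr fun s hs => ?_
      rw [uIcc_of_le t.2.1] at hs
      have hs' : s ∈ Icc a b := ⟨hs.1, hs.2.trans t.2.2⟩
      rw [iccExtend_apply hab _ hs', iccExtend_apply hab _ hs', hι1]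
    rw [hP1, hprim, hι1, ← e1, bulkOp_apply, lowerOrderOp_apply, ContinuousMap.add_apply,
      ContinuousMap.add_apply, pointwiseOp_apply, pointwiseOp_apply]
    abel
  -- At t = a every other term of the equation vanishes, so A v(a) = 0. Hence v remains continuous
  -- when extended by zero.
  have hva : v ⟨a, ha⟩ = 0 := by
    refine hm.eq_zero_of_opA hc ?_
    have := heq ⟨a, ha⟩
    simpa only [hya, map_zero, intervalIntegral.integral_same, add_zero, hg a le_rfl] using this
  have hv0 : ∀ t ≤ a, IccExtend hab v t = 0 := fun t ht => by
    rw [IccExtend_of_le_left hab _ ht]; exact hva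
  have hy0 : ∀ t ≤ a, IccExtend hab y t = 0 := fun t ht => by
    rw [IccExtend_of_le_left hab _ ht]; exact hya
  refine ⟨v.continuous.Icc_extend', y.continuous.Icc_extend', hv0, hy0, fun t ht => ?_,
    fun t ht => ?_⟩
  · change ι (IccExtend hab y t) = _
    rcases le_total t a with hta | hta
    · rw [hy0 t hta, map_zero, eq_comm]
      refine intervalIntegral.integral_zero_ae (Eventually.of_forall fun s hs => hv0 s ?_)
      rw [uIoc_of_ge hta] at hs
      exact hs.2
    · rw [iccExtend_apply hab _ ⟨hta, ht⟩, hι1, primitive_apply]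
  · change _ + P (IccExtend hab y t) + m.opB (ι (IccExtend hab y t)) +
      ∫ s in a..t, extendedKernel m.snd.snd.1.2 (t - s) (ι (IccExtend hab y s)) = _
    rcases le_total t a with hta | hta
    · have h0 : ∫ s in a..t, extendedKernel m.snd.snd.1.2 (t - s) (ι (IccExtend hab y s)) = 0 := by
        refine intervalIntegral.integral_zero_ae (Eventually.of_forall fun s hs => ?_)
        rw [uIoc_of_ge hta] at hs
        rw [hy0 s hs.2, map_zero, map_zero]
      rw [h0, hy0 t hta, hv0 t hta, hg t hta]
      simp
    · rw [iccExtend_apply hab v ⟨hta, ht⟩, iccExtend_apply hab y ⟨hta, ht⟩]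
      exact heq ⟨t, hta, ht⟩

/-- Solutions up to all times can be patched together. -/
theorem IsSolutionUpTo.exists_global (hι : Function.Injective ι) (hP : ∀ x, ⟪P x, ι x⟫_ℝ = 0)
    (hc : 0 < c) (hm : CoerciveWith c m)
    (h : ∀ b, a < b → ∃ v u, IsSolutionUpTo ι P m f a b v u) :
    ∃ v u, ∀ b, IsSolutionUpTo ι P m f a b v u := by
  choose! V U hVU using h
  -- The global solution takes at time t the value of the solution up to time max t a + 1; the
  -- margin 1 lets a single local solution serve on a neighbourhood of t.
  have hlt : ∀ t, a < max t a + 1 := fun t => by linarith [le_max_right t a]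
  have hle : ∀ t, t ≤ max t a + 1 := fun t => by linarith [le_max_left t a]
  have key : ∀ b, a < b → ∀ t ≤ b, V (max t a + 1) t = V b t ∧ U (max t a + 1) t = U b t := by
    intro b hb t ht
    exact ((hVU _ (hlt t)).mono (hle t)).eq hι hP hc hm ((hVU b hb).mono ht) le_rfl
  refine ⟨fun t => V (max t a + 1) t, fun t => U (max t a + 1) t, fun b => ?_⟩
  have hev : ∀ t, ∀ᶠ s in 𝓝 t, s ≤ max t a + 1 := fun t => by
    have : t < max t a + 1 := by linarith [le_max_left t a]
    filter_upwards [gt_mem_nhds this] with s hs using le_of_lt hs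
  have hint : ∀ t, ∫ s in a..t, V (max s a + 1) s = ∫ s in a..t, V (max t a + 1) s := by
    intro t
    refine intervalIntegral.integral_congr fun s hs => (key _ (hlt t) s ?_).1
    rcases le_total a t with h1 | h1
    · rw [uIcc_of_le h1] at hs
      exact hs.2.trans (hle t)
    · rw [uIcc_of_ge h1] at hs
      exact hs.2.trans (hlt t).le
  have hint' : ∀ t, ∫ s in a..t, extendedKernel m.snd.snd.1.2 (t - s) (ι (U (max s a + 1) s)) =
      ∫ s in a..t, extendedKernel m.snd.snd.1.2 (t - s) (ι (U (max t a + 1) s)) := by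
    intro t
    refine intervalIntegral.integral_congr fun s hs => ?_
    have : U (max s a + 1) s = U (max t a + 1) s := by
      refine (key _ (hlt t) s ?_).2
      rcases le_total a t with h1 | h1
      · rw [uIcc_of_le h1] at hs
        exact hs.2.trans (hle t)
      · rw [uIcc_of_ge h1] at hs
        exact hs.2.trans (hlt t).le
    simp only [this]
  refine ⟨continuous_iff_continuousAt.2 fun t => ?_, continuous_iff_continuousAt.2 fun t => ?_,
    fun t ht => (hVU _ (hlt t)).deriv_eq_zero t ht, fun t ht => (hVU _ (hlt t)).eq_zero t ht,
    fun t _ => ?_, fun t _ => ?_⟩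
  · refine ((hVU _ (hlt t)).continuous_deriv.continuousAt (x := t)).congr ?_
    filter_upwards [hev t] with s hs using (key _ (hlt t) s hs).1.symm
  · refine ((hVU _ (hlt t)).continuous.continuousAt (x := t)).congr ?_
    filter_upwards [hev t] with s hs using (key _ (hlt t) s hs).2.symm
  · rw [hint]
    exact (hVU _ (hlt t)).primitive_eq t (hle t)
  · rw [hint']
    exact (hVU _ (hlt t)).equation t (hle t)

end SolutionsUpTo

/-! ### Causal strong solutions -/

section StrongSolutions

variable {H V : Type*} [NormedAddCommGroup H] [InnerProductSpace ℝ H] [CompleteSpace H]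
  [NormedAddCommGroup V] [InnerProductSpace ℝ V] {a b c : ℝ}
  {ι : V →L[ℝ] H} {P : V →L[ℝ] H} {R : ℕ → (H →L[ℝ] V)} {m : CoeffSpace H}
  {f f₀ v : ℝ → H} {u u' : ℝ → V}

/-- The vanishing of w cuts off s ≤ a and causality cuts off s > t; on what remains t - s ≥ 0, where
the kernel, which may jump at 0, agrees with its continuous extension. -/
theorem CoeffSpace.memory_eq_intervalIntegral (m : CoeffSpace H) {w : ℝ → H}
    (hw : ∀ t ≤ a, w t = 0) (t : ℝ) :
    m.memory w t = ∫ s in a..t, extendedKernel m.snd.snd.1.2 (t - s) (w s) := by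
  have h1 : m.memory w t =
      ∫ s in Ioc a t, extendedKernel m.snd.snd.1.2 (t - s) (w s) := by
    rw [← integral_indicator measurableSet_Ioc, CoeffSpace.memory]
    congr 1
    ext s
    by_cases hs : s ∈ Ioc a t
    · rw [indicator_of_mem hs, CoeffSpace.kernel, causalExt, if_pos (sub_nonneg.2 hs.2)]
      rfl
    · rw [indicator_of_notMem hs]
      rw [mem_Ioc, not_and_or, not_lt, not_le] at hs
      rcases hs with h | h
      · rw [hw s h, map_zero]
      · rw [CoeffSpace.kernel, causalExt, if_neg (by linarith)]
        rfl
  rw [h1]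
  rcases le_total a t with hat | hat
  · rw [intervalIntegral.integral_of_le hat]
  · rw [Ioc_eq_empty (not_lt.2 hat), Measure.restrict_empty, integral_zero_measure, eq_comm]
    refine intervalIntegral.integral_zero_ae (Eventually.of_forall fun s hs => ?_)
    rw [uIoc_of_ge hat] at hs
    rw [hw s hs.2, map_zero]

theorem IsSolutionUpTo.hasDerivAt (h : ∀ b, IsSolutionUpTo ι P m f a b v u) (t : ℝ) :
    HasDerivAt (fun s => ι (u s)) (v t) t := by
  have e : (fun s => ι (u s)) = fun s => ∫ r in a..s, v r := funext fun s =>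
    (h s).primitive_eq s le_rfl
  have hv := (h t).continuous_deriv
  rw [e]
  exact intervalIntegral.integral_hasDerivAt_right (hv.intervalIntegrable _ _)
    hv.stronglyMeasurable.stronglyMeasurableAtFilter hv.continuousAt

theorem IsSolutionUpTo.isCausalStrongSolution (h : ∀ b, IsSolutionUpTo ι P m f₀ a b v u)
    (hf : f =ᵐ[volume] f₀) : IsCausalStrongSolution ι (P : V →ₗ[ℝ] H) f m u := by
  have hd := IsSolutionUpTo.hasDerivAt h
  have hderiv : deriv (fun s => ι (u s)) = v := funext fun t => (hd t).deriv
  have hu := (h 0).continuous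
  have hιu : Continuous fun s => ι (u s) := ι.continuous.comp hu
  have h0 : ∀ t ≤ a, ι (u t) = 0 := fun t ht => by rw [(h 0).eq_zero t ht, map_zero]
  refine ⟨hu, ?_, fun T => ?_, ⟨a, Eventually.of_forall fun t ht => (h 0).eq_zero t ht.le⟩, ?_⟩
  · rw [contDiff_one_iff_deriv, hderiv]
    exact ⟨fun t => (hd t).differentiableAt, (h 0).continuous_deriv⟩
  · obtain ⟨C, hC⟩ := isCompact_Icc.exists_bound_of_continuousOn
      (s := Icc a T) hιu.continuousOn
    have h1 : MemLp (fun s => ι (u s)) 2 (volume.restrict (Icc a T)) :=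
      MemLp.of_bound hιu.aestronglyMeasurable C
        ((ae_restrict_iff' measurableSet_Icc).2 (Eventually.of_forall hC))
    have h2 := (memLp_indicator_iff_restrict measurableSet_Icc).2 h1
    refine (h2.restrict (Iic T)).ae_eq ?_
    rw [EventuallyEq, ae_restrict_iff' measurableSet_Iic]
    refine Eventually.of_forall fun t ht => ?_
    by_cases hat : a ≤ t
    · rw [indicator_of_mem (show t ∈ Icc a T from ⟨hat, ht⟩)]
    · rw [indicator_of_notMem (fun h => hat h.1), h0 t (le_of_not_ge hat)]
  · filter_upwards [hf] with t ht
    rw [hderiv, m.memory_eq_intervalIntegral h0, ht]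
    exact (h t).equation t le_rfl

/-- Both sides of the equation are continuous, so it holds everywhere once it holds almost
everywhere. The strict inequality a < T makes the derivative vanish at a as well. -/
theorem IsCausalStrongSolution.isSolutionUpTo
    (h : IsCausalStrongSolution ι (P : V →ₗ[ℝ] H) f m u) {T : ℝ} (hT : ∀ t < T, u t = 0)
    (ha : a < T) (hf : f =ᵐ[volume] f₀) (hf₀ : Continuous f₀) (b : ℝ) :
    IsSolutionUpTo ι P m f₀ a b (deriv fun s => ι (u s)) u := by
  have hu := h.continuous
  have hιu : Continuous fun s => ι (u s) := ι.continuous.comp hu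
  obtain ⟨hd, hv⟩ := contDiff_one_iff_deriv.1 h.contDiff
  have hu0 : ∀ t ≤ a, u t = 0 := fun t ht => hT t (ht.trans_lt ha)
  have h0 : ∀ t ≤ a, ι (u t) = 0 := fun t ht => by rw [hu0 t ht, map_zero]
  have hva : ∀ t ≤ a, deriv (fun s => ι (u s)) t = 0 := by
    intro t ht
    have : (fun s => ι (u s)) =ᶠ[𝓝 t] fun _ => 0 := by
      filter_upwards [gt_mem_nhds (ht.trans_lt ha)] with s hs
      rw [hT s hs, map_zero]
    rw [this.deriv_eq, deriv_const]
  have hq := continuous_extendedKernel m.snd.snd.1.2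
  have hK : Continuous fun t : ℝ => ∫ s in a..t, extendedKernel m.snd.snd.1.2 (t - s) (ι (u s)) := by
    refine intervalIntegral.continuous_parametric_intervalIntegral_of_continuous
      (f := fun t s => extendedKernel m.snd.snd.1.2 (t - s) (ι (u s))) ?_ continuous_id
    exact (hq.comp (continuous_fst.sub continuous_snd)).clm_apply (hιu.comp continuous_snd)
  have heq : (fun t => m.opA (deriv (fun s => ι (u s)) t) + P (u t) + m.opB (ι (u t)) +
      ∫ s in a..t, extendedKernel m.snd.snd.1.2 (t - s) (ι (u s))) = f₀ := by
    refine (Continuous.ae_eq_iff_eq volume ?_ hf₀).1 ?_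
    · exact (((m.opA.continuous.comp hv).add (P.continuous.comp hu)).add
        (m.opB.continuous.comp hιu)).add hK
    · filter_upwards [h.equation, hf] with t h1 h2
      rw [← h2, ← h1, m.memory_eq_intervalIntegral h0]
      rfl
  refine ⟨hv, hu, hva, hu0, fun t _ => ?_, fun t _ => congrFun heq t⟩
  rw [intervalIntegral.integral_eq_sub_of_hasDerivAt (fun s _ => (hd s).hasDerivAt)
    (hv.intervalIntegrable _ _), h0 a le_rfl, sub_zero]

theorem IsCausalStrongSolution.exists_eq_zero
    (h : IsCausalStrongSolution ι (P : V →ₗ[ℝ] H) f m u) : ∃ T, ∀ t < T, u t = 0 := by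
  obtain ⟨T, hT⟩ := h.causal
  refine ⟨T, fun t ht => ?_⟩
  refine Measure.eqOn_open_of_ae_eq (μ := volume) (f := u) (g := fun _ => 0) ?_ isOpen_Iio
    h.continuous.continuousOn continuousOn_const ht
  rw [EventuallyEq, ae_restrict_iff' measurableSet_Iio]
  exact hT

/-- Causal strong solutions are unique. -/
theorem IsCausalStrongSolution.eq (hι : Function.Injective ι) (hP : ∀ x, ⟪P x, ι x⟫_ℝ = 0)
    (hc : 0 < c) (hm : CoerciveWith c m) (hf₀ : Continuous f₀) (hf : f =ᵐ[volume] f₀)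
    (h : IsCausalStrongSolution ι (P : V →ₗ[ℝ] H) f m u)
    (h' : IsCausalStrongSolution ι (P : V →ₗ[ℝ] H) f m u') : u = u' := by
  obtain ⟨T, hT⟩ := h.exists_eq_zero
  obtain ⟨T', hT'⟩ := h'.exists_eq_zero
  have h1 := h.isSolutionUpTo (a := min T T' - 1) hT (by linarith [min_le_left T T']) hf hf₀
  have h2 := h'.isSolutionUpTo (a := min T T' - 1) hT' (by linarith [min_le_right T T']) hf hf₀
  exact funext fun t => ((h1 t).eq hι hP hc hm (h2 t) le_rfl).2

end StrongSolutions

/-! ### Iterated primitives on an interval -/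

section IteratedPrimitives

variable {H V : Type*} [NormedAddCommGroup H] [InnerProductSpace ℝ H] [CompleteSpace H]
  [NormedAddCommGroup V] [NormedSpace ℝ V] {a b T : ℝ}

theorem iterate_primitiveFrom_succ {h : ℝ → H} (hh : LocallyIntegrable h volume)
    (hT : ∀ᵐ t : ℝ, t < T → h t = 0) (ha : a < T) (j : ℕ) :
    Continuous ((primitiveFrom a)^[j + 1] h) ∧ ∀ t ≤ T, (primitiveFrom a)^[j + 1] h t = 0 := by
  induction j with
  | zero => exact ⟨continuous_primitiveFrom hh, fun t ht => primitiveFrom_eq_zero hT ha ht⟩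
  | succ j ih =>
    rw [Function.iterate_succ_apply']
    exact ⟨continuous_primitiveFrom ih.1.locallyIntegrable, fun t ht =>
      primitiveFrom_eq_zero (Eventually.of_forall fun s hs => ih.2 s hs.le) ha ht⟩

theorem primitive_pow_apply (hab : a ≤ b) {h : ℝ → H}
    (hh : Integrable h (volume.restrict (Icc a b))) (j : ℕ)
    (t : Icc a b) : ((primitive hab) ^ j) (primitiveL1 H a b (hh.toL1 h)) t =
      (primitiveFrom a)^[j + 1] h t := by
  induction j generalizing t with
  | zero => exact intervalIntegral.integral_congr_ae (L1Icc.ae_interval hh.coeFn_toL1 t.2)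
  | succ j ih =>
    rw [Function.iterate_succ_apply', pow_succ', mul_apply_eq_comp, primitive_apply]
    refine intervalIntegral.integral_congr fun s hs => ?_
    rw [uIcc_of_le t.2.1] at hs
    rw [iccExtend_apply hab _ ⟨hs.1, hs.2.trans t.2.2⟩, ih]

theorem CoerciveWith.solOp_primitive_pow {ι : V →L[ℝ] H} {P : V →L[ℝ] H} {R : ℕ → (H →L[ℝ] V)}
    {c : ℝ} {m : CoeffSpace H} (hc : 0 < c) (hm : CoerciveWith c m) (hR : SkewResolvents ι P R)
    (hab : a ≤ b) (x : L1Icc H a b) (j : ℕ) :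
    solOp hab P R m (toL1Icc hab (((primitive hab) ^ j) (primitiveL1 H a b x))) =
      ((primitive hab) ^ (j + 1)) (solOp hab P R m x) := by
  induction j with
  | zero =>
    rw [pow_zero, zero_add, pow_one]
    exact hm.solOp_primitive hc hR hab x
  | succ j ih =>
    rw [pow_succ' _ (j + 1), mul_apply_eq_comp, ← ih, pow_succ',
      mul_apply_eq_comp]
    exact hm.solOp_primitive hc hR hab _

end IteratedPrimitives

/-! ### The forward map -/

section ForwardMap

variable {H V W : Type*} [NormedAddCommGroup H] [InnerProductSpace ℝ H] [CompleteSpace H]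
  [NormedAddCommGroup V] [InnerProductSpace ℝ V] [NormedAddCommGroup W] [InnerProductSpace ℝ W]
  {a T c : ℝ} {ι : V →L[ℝ] H} {P : V →L[ℝ] H} {R : ℕ → (H →L[ℝ] V)} {m : CoeffSpace H}
  {f h : ℝ → H} {j : ℕ}

/-- Existence of causal strong solutions, with a formula on every compact interval. -/
theorem CoerciveWith.exists_isCausalStrongSolution (hc : 0 < c) (hm : CoerciveWith c m)
    (hι : Function.Injective ι) (hR : SkewResolvents ι P R) (hh : LocallyIntegrable h volume)
    (hT : ∀ᵐ t : ℝ, t < T → h t = 0) (ha : a < T)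
    (hf : f =ᵐ[volume] (primitiveFrom a)^[j + 2] h) :
    ∃ u, IsCausalStrongSolution ι (P : V →ₗ[ℝ] H) f m u ∧
      ∀ (b : ℝ) (hab : a ≤ b) (x : L1Icc H a b), x =ᵐ[volume.restrict (Icc a b)] h →
        ∀ t : Icc a b, u t = R 0 (primitive hab (((primitive hab) ^ (j + 1)) (solOp hab P R m x)) t +
          (primitive hab (((primitive hab) ^ j) (primitiveL1 H a b x)) -
            bulkOp hab m (((primitive hab) ^ (j + 1)) (solOp hab P R m x))) t) := by
  have hint : ∀ b, IntegrableOn h (Icc a b) := fun b => hh.integrableOn_isCompact isCompact_Icc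
  have hg := (iterate_primitiveFrom_succ hh hT ha (j + 1)).2
  -- The data are f = J g with g = J^(j+1) h continuous, and the derivative of the solution is T(m)
  -- g = J^(j+1) T(m) h.
  have hloc : ∀ (b : ℝ) (hab : a ≤ b), IsSolutionUpTo ι P m ((primitiveFrom a)^[j + 2] h) a b _ _ :=
    fun b hab => by
      have := hm.isSolutionUpTo_solOp hc hι hR hab (g := (primitiveFrom a)^[j + 1] h)
        (fun t ht => by
          have := hg t (ht.trans ha.le)
          rwa [Function.iterate_succ_apply'] at this) (primitive_pow_apply hab (hint b) j)
      rw [hm.solOp_primitive_pow hc hR hab] at this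
      rw [Function.iterate_succ_apply']
      exact this
  obtain ⟨v, u, hu⟩ := IsSolutionUpTo.exists_global hι hR.inner_self hc hm
    (fun b hb => ⟨_, _, hloc b hb.le⟩)
  refine ⟨u, IsSolutionUpTo.isCausalStrongSolution hu hf, fun b hab x hx t => ?_⟩
  have hx' : x = (hint b).toL1 h := Lp.ext (hx.trans (hint b).coeFn_toL1.symm)
  rw [((hu b).eq hι hR.inner_self hc hm (hloc b hab) t.2.2).2, iccExtend_apply hab _ t.2, hx']

end ForwardMap

/-! ### Well-posedness and regularity of the forward map -/

section ForwardMap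

variable {H V W : Type*} [NormedAddCommGroup H] [InnerProductSpace ℝ H] [CompleteSpace H]
  [NormedAddCommGroup V] [InnerProductSpace ℝ V] [NormedAddCommGroup W] [InnerProductSpace ℝ W]
  {ι : V →L[ℝ] H} {P : V →L[ℝ] H} {R : ℕ → (H →L[ℝ] V)} {m : CoeffSpace H}
  {f : ℝ → H} {k : ℕ}

theorem existsUnique_isCausalStrongSolution (hι : Function.Injective ι)
    (hR : SkewResolvents ι P R) (hk : 2 ≤ k) (hf : MemHLoc k f) (hfc : IsCausal f)
    (hm : m ∈ coerciveSet H) : ∃! u, IsCausalStrongSolution ι (P : V →ₗ[ℝ] H) f m u := by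
  obtain ⟨c, hc, hm⟩ := hm
  obtain ⟨T, hT⟩ := hfc
  obtain ⟨j, rfl⟩ := Nat.exists_eq_add_of_le' hk
  have ha : T - 1 < T := by linarith
  obtain ⟨h, hh, hhT, hfh⟩ := hf.exists_iterate_primitiveFrom hT ha
  obtain ⟨u, hu, -⟩ := hm.exists_isCausalStrongSolution hc hι hR hh hhT ha hfh
  exact ⟨u, hu, fun u' hu' => hu'.eq hι hR.inner_self hc hm
    (iterate_primitiveFrom_succ hh hhT ha (j + 1)).1 hfh hu⟩

theorem exists_contDiffOn_forwardMap (hι : Function.Injective ι) (hR : SkewResolvents ι P R)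
    (S : V →L[ℝ] W) (hk : 2 ≤ k) (hf : MemHLoc k f) (hfc : IsCausal f) (T₀ T₁ : ℝ) :
    ∃ F : CoeffSpace H → C(Icc T₀ T₁, W),
      (∀ m ∈ coerciveSet H, ∀ t : Icc T₀ T₁,
        F m t = forwardMap ι (P : V →ₗ[ℝ] H) S f m t) ∧
      ContDiffOn ℝ ((k - 1 : ℕ) : WithTop ℕ∞) F (coerciveSet H) := by
  have hex := fun m (hm : m ∈ coerciveSet H) =>
    existsUnique_isCausalStrongSolution hι hR hk hf hfc hm
  obtain ⟨T, hT⟩ := hfc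
  obtain ⟨j, rfl⟩ := Nat.exists_eq_add_of_le' hk
  -- The starting time lies before the support of f and before the observation window.
  set a := min T T₀ - 1 with haT
  have ha : a < T := by linarith [min_le_left T T₀]
  have ha₀ : a ≤ T₀ := by linarith [min_le_right T T₀]
  -- The maximum keeps a ≤ b even if the window is empty.
  set b := max a T₁
  have hab : a ≤ b := le_max_left _ _
  have hsub : Icc T₀ T₁ ⊆ Icc a b := Icc_subset_Icc ha₀ (le_max_right _ _)
  obtain ⟨h, hh, hhT, hfh⟩ := hf.exists_iterate_primitiveFrom hT ha
  have hint : Integrable h (volume.restrict (Icc a b)) := hh.integrableOn_isCompact isCompact_Icc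
  set x : L1Icc H a b := hint.toL1 h
  set y : C(Icc a b, H) := primitive hab (((primitive hab) ^ j) (primitiveL1 H a b x))
  let ρ : C(Icc a b, H) →L[ℝ] C(Icc T₀ T₁, W) :=
    ContinuousMap.compCLM ℝ W ⟨Set.inclusion hsub, continuous_inclusion hsub⟩ ∘L pointwiseOp H W (Icc a b) (S ∘L R 0)
  -- Here w = J^(j+1) T(m) h is u', `y` is f on [a, b] and ρ is S R_0 followed by restriction to the
  -- window, so the formula is S R_0 (u + f - L_m u'). The exponent j + 1 = k - 1 is the number of
  -- derivatives obtained.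
  refine ⟨fun m => (ρ ∘L primitive hab) (((primitive hab) ^ (j + 1)) (solOp hab P R m x)) +
    (-ρ) (bulkOp hab m (((primitive hab) ^ (j + 1)) (solOp hab P R m x))) + ρ y, ?_,
    contDiffOn_primitive_pow_solOp hR hab (j + 1) x (ρ ∘L primitive hab) (-ρ) (ρ y)⟩
  rintro m hm t
  obtain ⟨u, hu, hux⟩ : ∃ u, IsCausalStrongSolution ι (P : V →ₗ[ℝ] H) f m u ∧
      u t = R 0 (primitive hab (((primitive hab) ^ (j + 1)) (solOp hab P R m x)) ⟨t, hsub t.2⟩ +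
        (y - bulkOp hab m (((primitive hab) ^ (j + 1)) (solOp hab P R m x))) ⟨t, hsub t.2⟩) := by
    obtain ⟨c, hc, hm⟩ := hm
    obtain ⟨u, hu, hux⟩ := hm.exists_isCausalStrongSolution hc hι hR hh hhT ha hfh
    exact ⟨u, hu, hux b hab x hint.coeFn_toL1 ⟨t, hsub t.2⟩⟩
  -- Uniqueness identifies the chosen solution with the one given by the formula.
  have hsol : causalSolution ι (P : V →ₗ[ℝ] H) f m = u := by
    have hex' : ∃ u, IsCausalStrongSolution ι (P : V →ₗ[ℝ] H) f m u := ⟨u, hu⟩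
    rw [causalSolution, dif_pos hex']
    exact (hex m hm).unique hex'.choose_spec hu
  have e : ∀ w : C(Icc a b, H), ρ w t = S (R 0 (w ⟨t, hsub t.2⟩)) := fun w => rfl
  rw [forwardMap, hsol, hux]
  beta_reduce
  generalize ((primitive hab) ^ (j + 1)) (solOp hab P R m x) = w
  change ρ (primitive hab w) t + -ρ (bulkOp hab m w) t + ρ y t = _
  rw [e, e, e, ContinuousMap.sub_apply]
  simp only [map_add, map_sub]
  abel

theorem exists_skewResolvents [CompleteSpace V] {hι : Function.Injective ι}
    (hP : IsSkewAdjointOp (unboundedOp ι hι (P : V →ₗ[ℝ] H)))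
    (hPV : GraphNormEquiv ι (P : V →ₗ[ℝ] H)) : ∃ R, SkewResolvents ι P R := by
  choose R hR₁ hR₂ using fun n : ℕ =>
    hP.exists_resolvent hPV (r := 1 / ((n : ℝ) + 1)) (by positivity)
  exact ⟨R, fun v => hP.inner_self v, hR₁, hR₂⟩

end ForwardMap

theorem theorem9
    {H V W : Type*}
    [NormedAddCommGroup H] [InnerProductSpace ℝ H] [CompleteSpace H]
    [TopologicalSpace.SeparableSpace H]
    [NormedAddCommGroup V] [InnerProductSpace ℝ V] [CompleteSpace V]
    [TopologicalSpace.SeparableSpace V]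
    [NormedAddCommGroup W] [InnerProductSpace ℝ W] [CompleteSpace W]
    (ι : V →L[ℝ] H) (hι : Function.Injective ι) (hιd : DenseRange ι)
    (P : V →ₗ[ℝ] H) (hP : IsSkewAdjointOp (unboundedOp ι hι P)) (hPV : GraphNormEquiv ι P)
    (S : V →L[ℝ] W)
    (k : ℕ) (hk : 2 ≤ k) (f : ℝ → H) (hf : MemHLoc k f) (hfc : IsCausal f) :
    CompleteSpace (CoeffSpace H) ∧
    IsOpen (admissible H) ∧
    (∀ m ∈ admissible H, ∃! u : ℝ → V, IsCausalStrongSolution ι P f m u) ∧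
    ∀ T₀ T₁ : ℝ, T₀ ≤ T₁ →
      ∃ F : CoeffSpace H → C(Icc T₀ T₁, W),
        (∀ m ∈ admissible H, ∀ t : Icc T₀ T₁, F m t = forwardMap ι P S f m t) ∧
        ContDiffOn ℝ ((k - 1 : ℕ) : WithTop ℕ∞) F (admissible H) := by
  obtain ⟨P, rfl⟩ := hPV.exists_continuousLinearMap
  obtain ⟨R, hR⟩ := exists_skewResolvents hP hPV
  rw [admissible_eq_coerciveSet]
  exact ⟨completeSpace_coeffSpace, isOpen_coerciveSet,
    fun m hm => existsUnique_isCausalStrongSolution hι hR hk hf hfc hm,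
    fun T₀ T₁ _ => exists_contDiffOn_forwardMap hι hR S hk hf hfc T₀ T₁⟩
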